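/- **Setting.** Let $\mathbf N$ be the space of counting measures on $\mathbb R$ (countable sums of measures that assign values in $\mathbb N_0$ to every Borel set), with the smallest $\sigma$-algebra $\mathcal N$ making all maps $\mu\mapsto\mu(B)$, $B$ Borel, measurable. Put $\iota_n(x)=\sum_{k=1}^n\delta_{x_k}$ for $x\in\mathbb R^n$, $n\in\mathbb N\cup\{\infty\}$ (and $\iota_0=0$). For $\mu=\sum_{i=1}^m\delta_{x_i}\in\mathbf N$, $m\in\mathbb N_0\cup\{\infty\}$, the $k$-th factorial measure is $\mu^{(k)}=\sum\delta_{(x_{i_1},\dots,x_{i_k})}$, summed over pairwise different $i_1,\dots,i_k$. A random $\zeta\in\mathbf N$ is *proper* if $\zeta=\sum_{k=1}^K\delta_{Z_k}$ with random variables $Z_k\in\mathbb R$, $K\in\mathbb N_0\cup\{\infty\}$. A *Markov family* $(\Omega,\mathcal F,(\eta_t)_{t\ge0},(\mathbb P_\mu)_{\mu\in\mathbf N})$ consists of a measurable space, measurable $\eta_t:\Omega\to\mathbf N$ and probability measures $\mathbb P_\mu$ such that $\eta_0=\mu$ $\mathbb P_\mu$-a.s.; $x\mapsto\mathbb P_{\iota_n(x)}[\eta_t\in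 A]$ is measurable on $\mathbb R^n$ for all $n\in\mathbb N\cup\{\infty\}$, $t\ge 0$, $A\in\mathcal N$; and the Markov property $\mathbb P_\mu[B\cap\{\eta_{s+t}\in A\}]=\mathbb E_\mu[\mathbf 1_B\,\mathbb P_{\eta_s}[\eta_t\in A]]$ holds for $\mu\in\mathbf N$, $s,t\ge0$, $A\in\mathcal N$, $B\in\sigma(\eta_u:u\le s)$. Let such a family be given, with $\eta_t$ proper for every $t$. Assume that it is *consistent*, $$\mathbb E_\mu\Big[\int F(\iota_n(x))\,\eta_t^{(n)}(dx)\Big]=\int\mathbb E_{\iota_n(x)}[F(\eta_t)]\,\mu^{(n)}(dx)$$ for all $\mu\in\mathbf N$, $t\ge0$, $n\in\mathbb N$ and measurable $F\ge0$, and *conservative*, $\eta_t(\mathbb R)=\mu(\mathbb R)$ $\mathbb P_\mu$-a.s. for all $\mu\in\mathbf N$, $t\ge0$. A measure $m$ on $\mathbf N$ is *reversible* if $\int\mathbb E_\mu[F(\eta_t)]\,G(\mu)\,m(d\mu)=\int F(\mu)\,\mathbb E_\mu[G(\eta_t)]\,m(d\mu)$ for all $t\ge0$ and measurable $F,G:\mathbf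 N\to[0,\infty]$. For symmetric $f:\mathbb R^n\to\mathbb R$ write $f=F\circ\iota_n$ and let $P_t^{[n]}f(x)=\mathbb E_{\iota_n(x)}[F(\eta_t)]$ whenever this is defined ($P_t^{[0]}$ is the identity). Let $\mathcal C_n$ be the set of bounded measurable functions on $\mathbb R^n$ with bounded support, $\widetilde f$ the symmetrization of $f$, and $L^2_{\mathrm{sym}}(\nu)$ the space of symmetric functions in $L^2(\nu)$. Let $\lambda$ be Lebesgue measure on $\mathbb R$, $\theta>0$, $\alpha=\theta\lambda$, $0<p<1$. For $f\in\mathcal C_n$ put $$I_nf(\mu)=\sum_{k=0}^n\binom nk(-1)^{n-k}\iint\widetilde f(x_1,\dots,x_n)\,\lambda^{\otimes(n-k)}(d(x_{k+1},\dots,x_n))\,\mu^{(k)}(d(x_1,\dots,x_k)),$$ $$\mathcal M_n^{p,\alpha}f(\mu)=\sum_{k=0}^n\binom nk\Big(1-\frac1p\Big)^{k-n}\iint\widetilde f(x_1,\dots,x_n)\,\kappa_{n,k}(x_1,\dots,x_k,d(x_{k+1},\dots,x_n))\,\mu^{(k)}(d(x_1,\dots,x_k)),$$ where $\kappa_{n,k}(x_1,\dots,x_k,d(x_{k+1},\dots,x_n))=(\alpha+\delta_{x_1}+\dots+\delta_{x_{n-1}})(dx_n)\cdots(\alpha+\delta_{x_1}+\dots+\delta_{x_k})(dx_{k+1})$.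 Let $\lambda_n=\sum_\sigma\big(\prod_{A\in\sigma}(|A|-1)!\big)\alpha_\sigma$, summed over the partitions $\sigma$ of $\{1,\dots,n\}$, where $\alpha_\sigma$ is the image of $\alpha^{\otimes|\sigma|}$ under the map $\mathbb R^\sigma\to\mathbb R^n$ that repeats the value $z_A$ in all coordinates $i\in A$. **Theorem.** (i) Let $\zeta$ be a proper Poisson process with intensity measure $\lambda$, with law $\pi_\lambda$, and suppose that the push-forward of $\lambda^{\otimes n}$ under $\iota_n$ is reversible for every $n\in\mathbb N$. For every $n\in\mathbb N_0$, $I_n$ extends from the symmetric functions in $\mathcal C_n$ to a bounded linear operator $I_n:L^2_{\mathrm{sym}}(\lambda^{\otimes n})\to L^2(\pi_\lambda)$, and for all $t\ge0$ and $f_n\in L^2_{\mathrm{sym}}(\lambda^{\otimes n})$ we have $P_t^{[n]}f_n\in L^2_{\mathrm{sym}}(\lambda^{\otimes n})$ and $$\mathbb E_\zeta[I_nf_n(\eta_t)]=I_nP_t^{[n]}f_n(\zeta)\quad\text{almost surely}$$ (in particular the left-hand side exists almost surely, whichever version of $I_nf_n$ is used). (ii) Let $\zeta$ be a proper Pascal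 process with parameters $p$ and $\alpha$, with law $\rho_{p,\alpha}$: $\zeta(A_1),\dots,\zeta(A_N)$ are independent for pairwise disjoint Borel sets $A_i$; if $0<\alpha(A)<\infty$, then $\mathbb P[\zeta(A)=k]=\alpha(A)(\alpha(A)+1)\cdots(\alpha(A)+k-1)\frac{p^k}{k!}(1-p)^{\alpha(A)}$ for $k\in\mathbb N_0$; and $\zeta(A)=0$ a.s. if $\alpha(A)=0$, $\zeta(A)=\infty$ a.s. if $\alpha(A)=\infty$. Suppose that the push-forward of $\lambda_n$ under $\iota_n$ is reversible for every $n\in\mathbb N$. For every $n\in\mathbb N_0$, $\mathcal M_n^{p,\alpha}$ extends from the symmetric functions in $\mathcal C_n$ to a bounded linear operator $\mathcal M_n^{p,\alpha}:L^2_{\mathrm{sym}}(\lambda_n)\to L^2(\rho_{p,\alpha})$, and for all $t\ge0$ and $f_n\in L^2_{\mathrm{sym}}(\lambda_n)$ we have $P_t^{[n]}f_n\in L^2_{\mathrm{sym}}(\lambda_n)$ and $$\mathbb E_\zeta[\mathcal M_n^{p,\alpha}f_n(\eta_t)]=\mathcal M_n^{p,\alpha}P_t^{[n]}f_n(\zeta)\quad\text{almost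 surely}$$ (in particular the left-hand side exists almost surely, whichever version of $\mathcal M_n^{p,\alpha}f_n$ is used). -/

import Mathlib

open MeasureTheory ProbabilityTheory Filter
open scoped ENNReal NNReal

noncomputable section

namespace Intertwining

/-! ### Counting measures -/

/-- Counting measures on `ℝ`: countable sums of measures that assign values in `ℕ₀` to every
measurable set. -/
def IsCounting (μ : Measure ℝ) : Prop :=
  ∃ m : ℕ → Measure ℝ,
    (∀ i B, MeasurableSet B → ∃ k : ℕ, m i B = k) ∧ μ = Measure.sum m

/-- The space `𝐍` of counting measures. Its `σ`-algebra is the one induced from `Measure ℝ`, i.e.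
the smallest one that makes all evaluations `μ ↦ μ B`, `B` measurable, measurable. -/
abbrev Config : Type := {μ : Measure ℝ // IsCounting μ}

/-- A countable sum of Dirac measures is a counting measure. -/
theorem isCounting_sum_dirac {ι : Type} [Countable ι] (x : ι → ℝ) :
    IsCounting (Measure.sum fun i => Measure.dirac (x i)) := by
  obtain ⟨g, hg⟩ := exists_injective_nat ι
  refine ⟨Function.extend g (fun i => Measure.dirac (x i)) 0, ?_, ?_⟩
  · intro j B hB
    by_cases h : ∃ i, g i = j
    · obtain ⟨i, rfl⟩ := h
      rw [hg.extend_apply, Measure.dirac_apply' _ hB]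
      by_cases hx : x i ∈ B
      · exact ⟨1, by simp [hx]⟩
      · exact ⟨0, by simp [hx]⟩
    · rw [Function.extend_apply' _ _ _ h]
      exact ⟨0, by simp⟩
  · exact (Measure.sum_extend_zero hg _).symm

/-- The map `ι_n : x ↦ ∑ₖ δ_{xₖ}`, for a finite or countably infinite index set. -/
def iota {ι : Type} [Countable ι] (x : ι → ℝ) : Config :=
  ⟨Measure.sum fun i => Measure.dirac (x i), isCounting_sum_dirac x⟩

theorem measurable_iota {ι : Type} [Countable ι] :
    Measurable (iota : (ι → ℝ) → Config) := by
  refine Measurable.subtype_mk (Measure.measurable_of_measurable_coe _ fun s hs => ?_)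
  simp only [Measure.sum_apply _ hs]
  refine Measurable.tsum fun i => ?_
  simp only [Measure.dirac_apply' _ hs]
  exact (measurable_one.indicator hs).comp (measurable_pi_apply i)

/-- The particles of `μ`, counted with multiplicity: the particles sitting at `a` are labeled
`(a, 0), (a, 1), …`, with as many labels as `μ {a}` says. -/
def Label (μ : Measure ℝ) : Type := {p : ℝ × ℕ // (p.2 : ℝ≥0∞) < μ {p.1}}

/-- The `k`-th factorial measure `μ^(k)`: the sum of the Dirac measures at the positions of all
`k`-tuples of pairwise different particles of `μ`. -/
def factorialMeasure (k : ℕ) (μ : Measure ℝ) : Measure (Fin k → ℝ) :=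
  Measure.sum fun e : Fin k ↪ Label μ => Measure.dirac fun j => (e j).1.1

theorem nonempty_equiv_of_encard {α β : Type} [Countable α] [Countable β]
    (h : ENat.card α = ENat.card β) : Nonempty (α ≃ β) := by
  rcases finite_or_infinite α with hα | hα
  · have hβ : Finite β := by
      rw [← ENat.card_lt_top, ← h]; exact ENat.card_lt_top.2 hα
    refine Finite.card_eq.1 ?_
    rw [ENat.card_eq_coe_natCard, ENat.card_eq_coe_natCard] at h
    exact_mod_cast h
  · have hβ : Infinite β := by
      rw [← ENat.card_eq_top, ← h]; exact ENat.card_eq_top.2 hα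
    obtain ⟨d⟩ := nonempty_denumerable α
    obtain ⟨d'⟩ := nonempty_denumerable β
    exact ⟨(Denumerable.eqv α).trans (Denumerable.eqv β).symm⟩

theorem enatCard_lt (c : ℕ∞) : ENat.card {j : ℕ // (j : ℕ∞) < c} = c := by
  induction c using ENat.recTopCoe with
  | top =>
    rw [ENat.card_eq_top]
    have : {j : ℕ // (j : ℕ∞) < ⊤} ≃ ℕ := Equiv.subtypeUnivEquiv fun j => ENat.natCast_lt_top j
    exact this.infinite_iff.2 inferInstance
  | coe n =>
    have e : {j : ℕ // (j : ℕ∞) < n} ≃ Fin n :=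
      { toFun := fun j => ⟨j.1, by exact_mod_cast j.2⟩
        invFun := fun j => ⟨j.1, by exact_mod_cast j.2⟩
        left_inv := fun _ => rfl
        right_inv := fun _ => rfl }
    rw [ENat.card_congr e]; simp

/-- For `μ = ∑ᵢ δ_{xᵢ}` the factorial measure is the sum of `δ_{(x_{i₁}, …, x_{iₖ})}` over all
pairwise different `i₁, …, iₖ`. -/
theorem factorialMeasure_iota {ι : Type} [Countable ι] (x : ι → ℝ) (k : ℕ) :
    factorialMeasure k (iota x).1 =
      Measure.sum fun e : Fin k ↪ ι => Measure.dirac fun j => x (e j) := by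
  have key : ∀ a : ℝ, (iota x).1 {a} = (ENat.card {i // x i = a} : ℕ∞) := by
    intro a
    have h1 : (iota x).1 {a} = ∑' i, ({i | x i = a} : Set ι).indicator 1 i := by
      change Measure.sum _ _ = _
      rw [Measure.sum_apply _ (measurableSet_singleton a)]
      refine tsum_congr fun i => ?_
      rw [Measure.dirac_apply' _ (measurableSet_singleton a)]
      by_cases hx : x i = a <;> simp [hx]
    rw [h1, ← tsum_subtype]
    simp only [Pi.one_apply]
    rw [ENNReal.tsum_one]
    rfl
  have fib : ∀ a : ℝ, Nonempty ({i // x i = a} ≃ {j : ℕ // (j : ℝ≥0∞) < (iota x).1 {a}}) := by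
    intro a
    refine nonempty_equiv_of_encard ?_
    have e : {j : ℕ // (j : ℝ≥0∞) < (iota x).1 {a}} ≃
        {j : ℕ // (j : ℕ∞) < ENat.card {i // x i = a}} :=
      Equiv.subtypeEquivRight fun j => by
        rw [key a]; exact_mod_cast Iff.rfl
    rw [ENat.card_congr e, enatCard_lt]
  have f := fun a => Classical.choice (fib a)
  have aux : ∀ (a : ℝ) (q : {i // x i = a}),
      ((x q.1, (f (x q.1) ⟨q.1, rfl⟩).1) : ℝ × ℕ) = (a, (f a q).1) := by
    rintro a ⟨i, rfl⟩
    rfl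
  let E : ι ≃ Label (iota x).1 :=
    { toFun := fun i => ⟨(x i, (f (x i) ⟨i, rfl⟩).1), (f (x i) ⟨i, rfl⟩).2⟩
      invFun := fun p => ((f p.1.1).symm ⟨p.1.2, p.2⟩).1
      left_inv := fun i => by simp
      right_inv := fun p => Subtype.ext ((aux p.1.1 _).trans (by simp)) }
  have hE : ∀ i, (E i).1.1 = x i := fun i => rfl
  ext s hs
  rw [factorialMeasure, Measure.sum_apply _ hs, Measure.sum_apply _ hs]
  refine (Equiv.tsum_eq (Equiv.embeddingCongr (Equiv.refl (Fin k)) E) _).symm.trans ?_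
  rfl

/-- A random counting measure `ξ` is proper if `ξ = ∑_{k < K} δ_{Z_k}` for random variables
`Z_k ∈ ℝ` and `K ∈ ℕ₀ ∪ {∞}`. -/
def IsProper {Ω : Type*} [MeasurableSpace Ω] (ξ : Ω → Config) : Prop :=
  ∃ (K : Ω → ℕ∞) (Z : ℕ → Ω → ℝ), Measurable K ∧ (∀ k, Measurable (Z k)) ∧
    ∀ ω, (ξ ω).1 = Measure.sum fun k : {k : ℕ // (k : ℕ∞) < K ω} => Measure.dirac (Z k ω)

/-! ### Markov families of unlabeled particles -/

/-- A Markov family with state space `𝐍`. The Markov property with respect to the natural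
filtration is `P_μ[B ∩ {η_{s+t} ∈ A}] = E_μ[1_B P_{η_s}[η_t ∈ A]]` for `B ∈ σ(η_u : u ≤ s)`. -/
structure MarkovFamily (Ω : Type*) [MeasurableSpace Ω] where
  /-- the process -/
  η : ℝ≥0 → Ω → Config
  /-- the law of the process started at a given configuration -/
  P : Config → Measure Ω
  measurable_η : ∀ t, Measurable (η t)
  isProbabilityMeasure_P : ∀ μ, IsProbabilityMeasure (P μ)
  start : ∀ μ, ∀ᵐ ω ∂P μ, η 0 ω = μ
  measurable_finite : ∀ (n : ℕ) (t : ℝ≥0) (A : Set Config), MeasurableSet A →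
    Measurable fun x : Fin n → ℝ => P (iota x) (η t ⁻¹' A)
  measurable_infinite : ∀ (t : ℝ≥0) (A : Set Config), MeasurableSet A →
    Measurable fun x : ℕ → ℝ => P (iota x) (η t ⁻¹' A)
  markov : ∀ (μ : Config) (s t : ℝ≥0) (A : Set Config) (B : Set Ω), MeasurableSet A →
    MeasurableSet[⨆ u : {u : ℝ≥0 // u ≤ s}, MeasurableSpace.comap (η u) inferInstance] B →
    P μ (B ∩ η (s + t) ⁻¹' A) = ∫⁻ ω in B, P (η s ω) (η t ⁻¹' A) ∂P μ

variable {Ω : Type*} [MeasurableSpace Ω]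

/-- Consistency: choosing `n` particles of the evolved configuration is the same as evolving `n`
chosen particles of the initial configuration. -/
def MarkovFamily.IsConsistent (X : MarkovFamily Ω) : Prop :=
  ∀ (μ : Config) (t : ℝ≥0) (F : Config → ℝ≥0) (n : ℕ), Measurable F → 1 ≤ n →
    ∫⁻ ω, ∫⁻ x, F (iota x) ∂(factorialMeasure n (X.η t ω).1) ∂(X.P μ) =
      ∫⁻ x, ∫⁻ ω, F (X.η t ω) ∂(X.P (iota x)) ∂(factorialMeasure n μ.1)

/-- Conservation of the number of particles. -/
def MarkovFamily.IsConservative (X : MarkovFamily Ω) : Prop :=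
  ∀ (μ : Config) (t : ℝ≥0), ∀ᵐ ω ∂(X.P μ), (X.η t ω).1 Set.univ = μ.1 Set.univ

/-- Reversibility of a (possibly infinite) measure `m` on the space of counting measures, tested
with nonnegative measurable functions. -/
def MarkovFamily.IsReversible (X : MarkovFamily Ω) (m : Measure Config) : Prop :=
  ∀ (t : ℝ≥0) (F G : Config → ℝ≥0∞), Measurable F → Measurable G →
    ∫⁻ μ, (∫⁻ ω, F (X.η t ω) ∂(X.P μ)) * G μ ∂m = ∫⁻ μ, F μ * (∫⁻ ω, G (X.η t ω) ∂(X.P μ)) ∂m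

/-- For a symmetric `f : ℝⁿ → ℝ`, the function `F` on configurations with `F ∘ ι_n = f`
(and `F = 0` outside of the range of `ι_n`). -/
def unlabel {n : ℕ} (f : (Fin n → ℝ) → ℝ) (μ : Config) : ℝ :=
  open Classical in if h : ∃ x : Fin n → ℝ, iota x = μ then f h.choose else 0

/-- The `n`-particle semigroup `P_t^{[n]} f (x) = E_{ι_n(x)}[F(η_t)]`, where `F ∘ ι_n = f`, for
symmetric `f`. If `n = 0` and the family is conservative, then it is the identity. -/
def MarkovFamily.semigroup (X : MarkovFamily Ω) {n : ℕ} (t : ℝ≥0) (f : (Fin n → ℝ) → ℝ) :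
    (Fin n → ℝ) → ℝ :=
  fun x => ∫ ω, unlabel f (X.η t ω) ∂(X.P (iota x))

/-! ### Symmetric functions -/

/-- Symmetric functions of `n` real variables. -/
def IsSymm {n : ℕ} (f : (Fin n → ℝ) → ℝ) : Prop :=
  ∀ (s : Equiv.Perm (Fin n)) (x : Fin n → ℝ), f (fun i => x (s i)) = f x

/-- The symmetrization of a function. -/
def symmetrize {n : ℕ} (f : (Fin n → ℝ) → ℝ) (x : Fin n → ℝ) : ℝ :=
  (n.factorial : ℝ)⁻¹ * ∑ s : Equiv.Perm (Fin n), f fun i => x (s i)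

/-- The space `𝒞_n` of bounded measurable functions with bounded support. -/
def IsTest {n : ℕ} (f : (Fin n → ℝ) → ℝ) : Prop :=
  Measurable f ∧ (∃ C : ℝ, ∀ x, |f x| ≤ C) ∧ Bornology.IsBounded (Function.support f)

/-- Measurable, symmetric functions that are square-integrable with respect to `ν`. -/
def MemL2Sym {n : ℕ} (ν : Measure (Fin n → ℝ)) (f : (Fin n → ℝ) → ℝ) : Prop :=
  Measurable f ∧ IsSymm f ∧ MemLp f 2 ν

/-- The space `L²_sym(ν)`: the classes in `L²(ν)` with a measurable symmetric representative. -/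
def L2Sym {n : ℕ} (ν : Measure (Fin n → ℝ)) : Submodule ℝ (Lp ℝ 2 ν) where
  carrier := {g | ∃ f : (Fin n → ℝ) → ℝ, Measurable f ∧ IsSymm f ∧ g =ᵐ[ν] f}
  add_mem' := by
    rintro a b ⟨f, hf, hs, h⟩ ⟨f', hf', hs', h'⟩
    refine ⟨f + f', hf.add hf', fun s x => ?_, (Lp.coeFn_add a b).trans (h.add h')⟩
    simp only [Pi.add_apply, hs s x, hs' s x]
  zero_mem' := ⟨0, measurable_zero, fun _ _ => rfl, Lp.coeFn_zero _ _ _⟩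
  smul_mem' := by
    rintro c a ⟨f, hf, hs, h⟩
    refine ⟨c • f, hf.const_smul c, fun s x => ?_, (Lp.coeFn_smul c a).trans (h.const_smul c)⟩
    simp only [Pi.smul_apply, hs s x]

/-- The class of a function in `L²_sym(ν)`. -/
def MemL2Sym.toL2Sym {n : ℕ} {ν : Measure (Fin n → ℝ)} {f : (Fin n → ℝ) → ℝ}
    (hf : MemL2Sym ν f) : L2Sym ν :=
  ⟨hf.2.2.toLp f, f, hf.1, hf.2.1, hf.2.2.coeFn_toLp⟩

/-- `J` is a bounded linear operator `L²_sym(ν) → L²(π)` that agrees with `T` on the symmetric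
functions in `𝒞_n`. -/
def IsL2Extension {n : ℕ} (ν : Measure (Fin n → ℝ)) (π : Measure Config)
    (T : ((Fin n → ℝ) → ℝ) → Config → ℝ) (J : L2Sym ν →L[ℝ] Lp ℝ 2 π) : Prop :=
  ∀ (f : (Fin n → ℝ) → ℝ) (hf : MemL2Sym ν f), IsTest f → J hf.toL2Sym =ᵐ[π] T f

/-- The extension of `T` from the symmetric functions in `𝒞_n` to a bounded linear operator
`L²_sym(ν) → L²(π)` (zero, if there is none). -/
def l2Extension {n : ℕ} (ν : Measure (Fin n → ℝ)) (π : Measure Config)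
    (T : ((Fin n → ℝ) → ℝ) → Config → ℝ) : L2Sym ν →L[ℝ] Lp ℝ 2 π :=
  open Classical in if h : ∃ J, IsL2Extension ν π T J then h.choose else 0

/-- The point `(x₁, …, x_k, y₁, …, y_{n-k})`. -/
def glue {n k : ℕ} (x : Fin k → ℝ) (y : Fin (n - k) → ℝ) : Fin n → ℝ :=
  fun i => if h : (i : ℕ) < k then x ⟨i, h⟩ else y ⟨i - k, by omega⟩

/-! ### Poisson process and multiple Wiener–Itô integrals -/

/-- Poisson process with intensity measure the Lebesgue measure. -/
def IsPoissonProcess (Pr : Measure Ω) (ζ : Ω → Config) : Prop :=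
  Measurable ζ ∧
  (∀ (N : ℕ) (A : Fin N → Set ℝ), (∀ i, MeasurableSet (A i)) →
    Pairwise (fun i j => Disjoint (A i) (A j)) → iIndepFun (fun i ω => (ζ ω).1 (A i)) Pr) ∧
  (∀ A : Set ℝ, MeasurableSet A → volume A < ∞ → ∀ k : ℕ,
    Pr {ω | (ζ ω).1 A = k} = poissonMeasure (volume A).toNNReal {k}) ∧
  (∀ A : Set ℝ, MeasurableSet A → volume A = ∞ → ∀ᵐ ω ∂Pr, (ζ ω).1 A = ∞)

/-- The multiple Wiener–Itô integral of degree `n`, for `f ∈ 𝒞_n`. -/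
def wienerItoTest (n : ℕ) (f : (Fin n → ℝ) → ℝ) (μ : Config) : ℝ :=
  ∑ k ∈ Finset.range (n + 1), (n.choose k : ℝ) * (-1) ^ (n - k) *
    ∫ x : Fin k → ℝ, (∫ y : Fin (n - k) → ℝ, symmetrize f (glue x y)) ∂(factorialMeasure k μ.1)

/-- The multiple Wiener–Itô integral `I_n : L²_sym(λ^{⊗n}) → L²(π)`, where `π` is the law of the
Poisson process. -/
def wienerIto (n : ℕ) (π : Measure Config) :
    L2Sym (volume : Measure (Fin n → ℝ)) →L[ℝ] Lp ℝ 2 π :=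
  l2Extension volume π (wienerItoTest n)

/-! ### Pascal process and infinite-dimensional Meixner polynomials -/

/-- The measure `α = θ λ`. -/
def alpha (θ : ℝ≥0) : Measure ℝ := θ • volume

instance (θ : ℝ≥0) : SigmaFinite (alpha θ) := by unfold alpha; infer_instance

/-- Pascal process with parameters `p` and `α`. -/
def IsPascalProcess (p : ℝ) (α : Measure ℝ) (Pr : Measure Ω) (ζ : Ω → Config) : Prop :=
  Measurable ζ ∧
  (∀ (N : ℕ) (A : Fin N → Set ℝ), (∀ i, MeasurableSet (A i)) →
    Pairwise (fun i j => Disjoint (A i) (A j)) → iIndepFun (fun i ω => (ζ ω).1 (A i)) Pr) ∧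
  (∀ A : Set ℝ, MeasurableSet A → 0 < α A → α A < ∞ → ∀ k : ℕ,
    Pr {ω | (ζ ω).1 A = k} = ENNReal.ofReal
      ((∏ i ∈ Finset.range k, ((α A).toReal + i)) * (p ^ k / k.factorial) *
        (1 - p) ^ (α A).toReal)) ∧
  (∀ A : Set ℝ, MeasurableSet A → α A = 0 → ∀ᵐ ω ∂Pr, (ζ ω).1 A = 0) ∧
  (∀ A : Set ℝ, MeasurableSet A → α A = ∞ → ∀ᵐ ω ∂Pr, (ζ ω).1 A = ∞)

/-- The kernel `(y₁, …, y_m) ↦ α + δ_{x₁} + … + δ_{x_k} + δ_{y₁} + … + δ_{y_m}`. -/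
def addKernel (α : Measure ℝ) {k : ℕ} (x : Fin k → ℝ) (m : ℕ) : Kernel (Fin m → ℝ) ℝ :=
  Kernel.const _ α + ∑ i, Kernel.const _ (Measure.dirac (x i)) +
    ∑ j : Fin m, Kernel.deterministic (fun y => y j) (measurable_pi_apply j)

/-- The measure `κ_{k+m,k}(x, ·)` on `ℝ^m`, for `x ∈ ℝ^k`. -/
def kappa (α : Measure ℝ) {k : ℕ} (x : Fin k → ℝ) : (m : ℕ) → Measure (Fin m → ℝ)
  | 0 => Measure.dirac Fin.elim0
  | m + 1 => ((kappa α x m).compProd (addKernel α x m)).map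
      fun q : (Fin m → ℝ) × ℝ => (Fin.snoc q.1 q.2 : Fin (m + 1) → ℝ)

/-- The infinite-dimensional Meixner polynomial of degree `n`, for `f ∈ 𝒞_n`. -/
def meixnerTest (p : ℝ) (α : Measure ℝ) (n : ℕ) (f : (Fin n → ℝ) → ℝ) (μ : Config) : ℝ :=
  ∑ k ∈ Finset.range (n + 1), (n.choose k : ℝ) * (1 - 1 / p) ^ ((k : ℤ) - (n : ℤ)) *
    ∫ x : Fin k → ℝ, (∫ y, symmetrize f (glue x y) ∂(kappa α x (n - k)))
      ∂(factorialMeasure k μ.1)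

/-- The measure `α_σ`: the image of `α^{⊗|σ|}` under the map that gives to all variables in the
same block of `σ` the same value. -/
def partitionMeasure (α : Measure ℝ) {n : ℕ}
    (σ : Finpartition (Finset.univ : Finset (Fin n))) : Measure (Fin n → ℝ) :=
  (Measure.pi fun _ : {A // A ∈ σ.parts} => α).map fun z i =>
    z ⟨σ.part i, σ.part_mem.2 (Finset.mem_univ i)⟩

/-- The measure `λ_n = ∑_σ (∏_{A ∈ σ} (|A| - 1)!) α_σ`, summed over the partitions of
`{1, …, n}`. -/
def lambdaMeasure (α : Measure ℝ) (n : ℕ) : Measure (Fin n → ℝ) :=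
  ∑ σ : Finpartition (Finset.univ : Finset (Fin n)),
    (∏ A ∈ σ.parts, (A.card - 1).factorial) • partitionMeasure α σ

/-- The infinite-dimensional Meixner polynomial `ℳ_n : L²_sym(λ_n) → L²(ρ)`, where `ρ` is the law
of the Pascal process. -/
def meixner (p : ℝ) (α : Measure ℝ) (n : ℕ) (ρ : Measure Config) :
    L2Sym (lambdaMeasure α n) →L[ℝ] Lp ℝ 2 ρ :=
  l2Extension (lambdaMeasure α n) ρ (meixnerTest p α n)

/-- `E_ζ[J f (η_t)] = J P_t^{[n]} f (ζ)` almost surely, where `ζ` has law `π`, for all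
`f ∈ L²_sym(ν)`. It is part of the assertion that `P_t^{[n]} f` is again in `L²_sym(ν)`, that the
expected value on the left exists, and that any version `G` of `J f ∈ L²(π)` may be used there. -/
def MarkovFamily.Intertwines (X : MarkovFamily Ω) {Ω' : Type*} [MeasurableSpace Ω']
    (Pr : Measure Ω') (ζ : Ω' → Config) {n : ℕ} (ν : Measure (Fin n → ℝ))
    (J : L2Sym ν →L[ℝ] Lp ℝ 2 (Pr.map ζ)) : Prop :=
  ∀ (t : ℝ≥0) (f : (Fin n → ℝ) → ℝ) (hf : MemL2Sym ν f),
    ∃ hPf : MemL2Sym ν (X.semigroup t f),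
      ∀ G : Config → ℝ, G =ᵐ[Pr.map ζ] J hf.toL2Sym →
        ∀ᵐ ω ∂Pr, Integrable (fun ω' => G (X.η t ω')) (X.P (ζ ω)) ∧
          ∫ ω', G (X.η t ω') ∂(X.P (ζ ω)) = J hPf.toL2Sym (ζ ω)

end Intertwining

end

open MeasureTheory ProbabilityTheory Intertwining

open MeasureTheory ProbabilityTheory Filter
open scoped ENNReal NNReal

noncomputable section

namespace Intertwining

/-! ### Structure of counting measures -/

/-! The Poisson and the Pascal process are the cases `c = 0` and `c = 1` of one structure,
`Ensemble`: the counts of disjoint cells are independent, and the count of `B` has factorial moments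
`b ^ k a (a + c) ⋯ (a + (k - 1) c)` with `a = α B`, where `b = 1` for Poisson and `b = p / (1 - p)`
for Pascal. On products of disjoint bounded cells the measures `ν n` (that is, `λ^{⊗n}` or `λ_n`)
and the kernels `κ` are products of the same rising factorials. Such products determine a measure
(`ext_of_box`), so identities between measures reduce to algebra: `b ^ n ν n` is the mean of `ζ^(n)`
(`bind_factKernel`), and `κ` carries `ν k` to `ν n` (`bind_ext`). On symmetric test functions both
families of polynomials are almost surely `∑ₖ C(n,k) (-b)^(n-k) τ_k f`, where `τ_k f (μ)` integrates
the last `n - k` variables of `f` against `κ` and the others against `μ^(k)`.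

Commutation. By duality, reversibility of `ν k` and `ν n` together with consistency shows that the
`k`- and the `n`-particle semigroups are intertwined by `κ` (`trans_ext`). Consistency once more
moves the semigroup through `μ^(k)`, so each level satisfies `E_μ[τ_k f(η_t)] = τ_k P_t f(μ)` for
almost every `μ` (`lintegral_trans_tau`). This is the assertion for nonnegative symmetric test
functions (`integral_poly_trans`).

Boundedness. The one-dimensional Charlier and Meixner polynomials are orthogonal
(`integral_orthPoly_mul_orthPoly`). Multiplied over cells, this becomes an identity of measures on
`ℝ^n × ℝ^n` (`sum_pair`), and integrating `f ⊗ f` gives `‖poly f‖² = (b (1 + c b))^n n! ‖f‖²` for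
nonnegative symmetric test functions. Hence the bounded extension exists (`exists_isL2Extension`).
As `P_t f` need not have bounded support, it is also shown that the extension is given by the same
formula on `L¹ ∩ L²` (`ae_eq_poly`).

Invariance. Consistency and invariance of `ν n` keep the factorial moments of the configuration
constant in time. The counts have exponential moments, so these determine the law, and the law of
`ζ` is invariant (`bind_initKernel`). Therefore `G ↦ E_ζ[G(η_t)]` is a well-defined contraction on
`L²`, independent of the version of `G`. Both sides of the relation are then continuous in `f`, and
truncation carries it from test functions to all of `L²_sym` (`intertwines`). -/

theorem exists_atom_of_natValued {μ : Measure ℝ}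
    (h : ∀ B, MeasurableSet B → ∃ k : ℕ, μ B = k) (hμ : μ ≠ 0) : ∃ a, 1 ≤ μ {a} := by
  have hfin : IsFiniteMeasure μ := ⟨by
    obtain ⟨k, hk⟩ := h _ MeasurableSet.univ
    rw [hk]; exact ENNReal.natCast_lt_top k⟩
  have one_le : ∀ B, MeasurableSet B → μ B ≠ 0 → 1 ≤ μ B := by
    intro B hB h0
    obtain ⟨k, hk⟩ := h B hB
    rw [hk] at h0 ⊢
    exact_mod_cast Nat.one_le_iff_ne_zero.2 (by exact_mod_cast h0)
  -- The distribution function has values in `ℕ`, so it is zero up to its first jump and at least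
  -- one from there on. The location of the jump is `sInf S`, and the mass gained there sits at a
  -- single point.
  set S : Set ℝ := {x | 1 ≤ μ (Set.Iic x)} with hS
  have hne : S.Nonempty := by
    by_contra hcon
    rw [Set.not_nonempty_iff_eq_empty] at hcon
    refine hμ (Measure.measure_univ_eq_zero.1 ?_)
    have : (Set.univ : Set ℝ) = ⋃ n : ℕ, Set.Iic (n : ℝ) := by
      ext x; simpa using exists_nat_ge x
    rw [this, measure_iUnion_null_iff]
    intro n
    by_contra h0
    have : (n : ℝ) ∈ S := one_le _ measurableSet_Iic h0
    simp [hcon] at this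
  have hbdd : BddBelow S := by
    have hem : (⋂ n : ℕ, Set.Iic (-(n : ℝ))) = ∅ := by
      ext x
      simp only [Set.mem_iInter, Set.mem_Iic, Set.mem_empty_iff_false, iff_false, not_forall,
        not_le]
      obtain ⟨n, hn⟩ := exists_nat_gt (-x)
      exact ⟨n, by linarith⟩
    have htend : Tendsto (fun n : ℕ => μ (Set.Iic (-(n : ℝ)))) atTop (nhds 0) := by
      have := tendsto_measure_iInter_atTop (μ := μ) (s := fun n : ℕ => Set.Iic (-(n : ℝ)))
        (fun n => measurableSet_Iic.nullMeasurableSet)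
        (fun m n hmn => Set.Iic_subset_Iic.2 (neg_le_neg (by exact_mod_cast hmn)))
        ⟨0, measure_ne_top _ _⟩
      rwa [hem, measure_empty] at this
    obtain ⟨n, hy⟩ := ((tendsto_order.1 htend).2 1 one_pos).exists
    set y : ℝ := -(n : ℝ)
    refine ⟨y, fun x hx => ?_⟩
    by_contra hlt
    exact absurd (hx.trans (measure_mono (Set.Iic_subset_Iic.2 (not_le.1 hlt).le))) (not_le.2 hy)
  set a := sInf S with ha
  have hge : 1 ≤ μ (Set.Iic a) := by
    have e : Set.Iic a = ⋂ n : ℕ, Set.Iic (a + 1 / ((n : ℝ) + 1)) := by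
      ext x
      simp only [Set.mem_Iic, Set.mem_iInter]
      refine ⟨fun hx n => hx.trans (by have : (0:ℝ) < 1 / ((n:ℝ)+1) := by positivity
                                       linarith), fun hx => ?_⟩
      refine le_of_forall_pos_le_add fun ε hε => ?_
      obtain ⟨n, hn⟩ := exists_nat_one_div_lt hε
      exact (hx n).trans (by linarith)
    rw [e, Antitone.measure_iInter]
    · refine le_iInf fun n => ?_
      have : a < a + 1 / ((n : ℝ) + 1) := by
        have : (0:ℝ) < 1 / ((n:ℝ)+1) := by positivity
        linarith
      obtain ⟨x, hx, hlt⟩ := exists_lt_of_csInf_lt hne this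
      exact le_trans hx (measure_mono (Set.Iic_subset_Iic.2 hlt.le))
    · intro m n hmn
      refine Set.Iic_subset_Iic.2 (add_le_add le_rfl ?_)
      exact one_div_le_one_div_of_le (by positivity) (by exact_mod_cast Nat.succ_le_succ hmn)
    · exact fun n => measurableSet_Iic.nullMeasurableSet
    · exact ⟨0, measure_ne_top _ _⟩
  have hlt : μ (Set.Iio a) = 0 := by
    have e : Set.Iio a = ⋃ n : ℕ, Set.Iic (a - 1 / ((n : ℝ) + 1)) := by
      ext x
      simp only [Set.mem_Iio, Set.mem_iUnion, Set.mem_Iic]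
      constructor
      · intro hx
        obtain ⟨n, hn⟩ := exists_nat_one_div_lt (sub_pos.2 hx)
        exact ⟨n, by linarith⟩
      · rintro ⟨n, hn⟩
        have : (0:ℝ) < 1 / ((n:ℝ)+1) := by positivity
        linarith
    rw [e, measure_iUnion_null_iff]
    intro n
    by_contra h0
    have h1 : a - 1 / ((n : ℝ) + 1) ∈ S := one_le _ measurableSet_Iic h0
    have h2 := csInf_le hbdd h1
    have : (0:ℝ) < 1 / ((n:ℝ)+1) := by positivity
    linarith
  refine ⟨a, ?_⟩
  have : Set.Iic a = Set.Iio a ∪ {a} := by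
    ext x; simp [le_iff_lt_or_eq]
  calc 1 ≤ μ (Set.Iic a) := hge
    _ ≤ μ (Set.Iio a) + μ {a} := by rw [this]; exact measure_union_le _ _
    _ = μ {a} := by rw [hlt, zero_add]

/-- Induction on a bound for the total mass: restricting to the complement of an atom keeps the
values natural and lowers the mass by at least one. -/
theorem exists_sum_dirac_of_natValued (n : ℕ) : ∀ μ : Measure ℝ,
    (∀ B, MeasurableSet B → ∃ k : ℕ, μ B = k) → μ Set.univ ≤ n →
    ∃ (m : ℕ) (x : Fin m → ℝ), μ = Measure.sum fun i => Measure.dirac (x i) := by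
  induction n with
  | zero =>
    intro μ _ h0
    refine ⟨0, Fin.elim0, ?_⟩
    rw [Measure.sum_of_isEmpty]
    exact Measure.measure_univ_eq_zero.1 (by simpa using h0)
  | succ n ih =>
    intro μ h hn
    by_cases hμ : μ = 0
    · exact ⟨0, Fin.elim0, by rw [Measure.sum_of_isEmpty, hμ]⟩
    obtain ⟨a, ha⟩ := exists_atom_of_natValued h hμ
    have hsplit := measure_add_measure_compl (μ := μ) (measurableSet_singleton a)
    obtain ⟨k, hk⟩ := h {a} (measurableSet_singleton a)
    obtain ⟨l, hl⟩ := h {a}ᶜ (measurableSet_singleton a).compl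
    obtain ⟨m, x, hx⟩ := ih (μ.restrict {a}ᶜ)
      (fun B hB => by
        rw [Measure.restrict_apply hB]
        exact h _ (hB.inter (measurableSet_singleton a).compl))
      (by
        rw [Measure.restrict_apply_univ]
        rw [hk] at ha hsplit
        rw [hl] at hsplit ⊢
        rw [← hsplit] at hn
        norm_cast at ha hn ⊢
        omega)
    refine ⟨k + m, Fin.append (fun _ => a) x, ?_⟩
    have e1 : μ = μ.restrict {a} + μ.restrict {a}ᶜ :=
      (Measure.restrict_add_restrict_compl (measurableSet_singleton a)).symm
    conv_lhs => rw [e1]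
    rw [hx, Measure.restrict_singleton, hk]
    ext B hB
    rw [Measure.add_apply, Measure.sum_apply _ hB, Measure.sum_apply _ hB, tsum_fintype,
      tsum_fintype, Fin.sum_univ_add]
    simp

/-- This reduces statements about arbitrary configurations to labeled ones, for which
`factorialMeasure_iota` is available. -/
theorem exists_eq_iota (μ : Config) : ∃ (ι : Type) (_ : Countable ι) (x : ι → ℝ), iota x = μ := by
  obtain ⟨m, hm, hμ⟩ := μ.2
  have : ∀ i, ∃ (n : ℕ) (x : Fin n → ℝ), m i = Measure.sum fun j => Measure.dirac (x j) := by
    intro i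
    obtain ⟨k, hk⟩ := hm i _ MeasurableSet.univ
    exact exists_sum_dirac_of_natValued k _ (hm i) hk.le
  choose n x hx using this
  refine ⟨Σ i, Fin (n i), inferInstance, fun p => x p.1 p.2, Subtype.ext ?_⟩
  change Measure.sum _ = _
  rw [hμ]
  ext B hB
  rw [Measure.sum_apply _ hB, Measure.sum_apply _ hB, ENNReal.tsum_sigma']
  refine tsum_congr fun i => ?_
  rw [hx i, Measure.sum_apply _ hB]

theorem iota_apply {ι : Type} [Countable ι] (x : ι → ℝ) {B : Set ℝ} (hB : MeasurableSet B) :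
    (iota x).1 B = (ENat.card {i // x i ∈ B} : ℕ∞) := by
  have h1 : (iota x).1 B = ∑' i, ({i | x i ∈ B} : Set ι).indicator 1 i := by
    change Measure.sum _ _ = _
    rw [Measure.sum_apply _ hB]
    refine tsum_congr fun i => ?_
    rw [Measure.dirac_apply' _ hB]
    by_cases hx : x i ∈ B <;> simp [hx]
  rw [h1, ← tsum_subtype]
  simp only [Pi.one_apply]
  rw [ENNReal.tsum_one]
  rfl

theorem iota_comp_equiv {ι ι' : Type} [Countable ι] [Countable ι'] (x : ι → ℝ) (e : ι' ≃ ι) :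
    iota (fun i => x (e i)) = iota x := by
  refine Subtype.ext ?_
  change Measure.sum _ = Measure.sum _
  ext B hB
  rw [Measure.sum_apply _ hB, Measure.sum_apply _ hB]
  exact e.tsum_eq fun i => Measure.dirac (x i) B

theorem iota_univ (n : ℕ) (x : Fin n → ℝ) : (iota x).1 Set.univ = n := by
  rw [iota_apply x MeasurableSet.univ]
  simp

theorem exists_iota_fin {μ : Config} {n : ℕ} (h : μ.1 Set.univ = n) :
    ∃ x : Fin n → ℝ, iota x = μ := by
  obtain ⟨ι, _, x, rfl⟩ := exists_eq_iota μ
  rw [iota_apply x MeasurableSet.univ] at h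
  have h' : ENat.card ι = n := by
    have : ENat.card {i // x i ∈ Set.univ} = ENat.card ι :=
      ENat.card_congr (Equiv.subtypeUnivEquiv fun _ => Set.mem_univ _)
    rw [this] at h
    exact_mod_cast h
  obtain ⟨e⟩ := nonempty_equiv_of_encard (α := Fin n) (β := ι) (by simp [h'])
  exact ⟨fun i => x (e i), iota_comp_equiv x e⟩

theorem range_iota (n : ℕ) :
    Set.range (iota : (Fin n → ℝ) → Config) = {μ : Config | μ.1 Set.univ = n} := by
  ext μ
  exact ⟨by rintro ⟨x, rfl⟩; exact iota_univ n x, fun h => exists_iota_fin h⟩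

theorem measurable_config_eval {B : Set ℝ} (hB : MeasurableSet B) :
    Measurable fun μ : Config => μ.1 B :=
  (Measure.measurable_coe hB).comp measurable_subtype_coe

theorem measurableSet_range_iota (n : ℕ) :
    MeasurableSet (Set.range (iota : (Fin n → ℝ) → Config)) := by
  rw [range_iota]
  exact measurable_config_eval MeasurableSet.univ (measurableSet_singleton _)

/-- The `n`-th factorial measure of `iota x` charges the point `x`. Computed from `y`, it lives on
the rearrangements of `y`, because an injection of `Fin n` into itself is a permutation. -/
theorem exists_perm_of_iota_eq {n : ℕ} {x y : Fin n → ℝ} (h : iota x = iota y) :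
    ∃ s : Equiv.Perm (Fin n), (fun i => y (s i)) = x := by
  have h1 := factorialMeasure_iota x n
  rw [h, factorialMeasure_iota y n] at h1
  have h2 := congrArg (fun m => m {x}) h1
  simp only [Measure.sum_apply _ (measurableSet_singleton x)] at h2
  by_contra hcon
  push Not at hcon
  have h3 : ∀ e : Fin n ↪ Fin n, Measure.dirac (fun j => y (e j)) {x} = 0 := by
    intro e
    rw [Measure.dirac_apply' _ (measurableSet_singleton x), Set.indicator_of_notMem]
    intro he
    exact hcon (Equiv.ofBijective e (Finite.injective_iff_bijective.1 e.injective)) he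
  simp only [h3, tsum_zero] at h2
  have h4 := ENNReal.tsum_eq_zero.1 h2.symm (Function.Embedding.refl _)
  simp at h4

/-- Finite measures on the line are determined by their total mass and their values on rational
half-lines. This separation property is what the descent of measurability along `iota` requires. -/
instance countablySeparated_range_iota (n : ℕ) :
    MeasurableSpace.CountablySeparated (Set.range (iota : (Fin n → ℝ) → Config)) := by
  let g : Set.range (iota : (Fin n → ℝ) → Config) → ℚ → ℝ≥0∞ :=
    fun μ q => μ.1.1 (Set.Iic (q : ℝ))
  have hg : Measurable g := measurable_pi_lambda _ fun q =>
    (measurable_config_eval measurableSet_Iic).comp measurable_subtype_coe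
  have hinj : Function.Injective g := by
    rintro ⟨_, x, rfl⟩ ⟨_, y, rfl⟩ h
    refine Subtype.ext (Subtype.ext ?_)
    have hx : IsFiniteMeasure (iota x).1 := ⟨by rw [iota_univ]; exact ENNReal.natCast_lt_top n⟩
    refine ext_of_generate_finite _ Real.borel_eq_generateFrom_Iic_rat
      Real.isPiSystem_Iic_rat ?_ (by rw [iota_univ, iota_univ])
    intro s hs
    simp only [Set.mem_iUnion, Set.mem_singleton_iff] at hs
    obtain ⟨q, rfl⟩ := hs
    exact congrFun h q
  obtain ⟨f, hf, hfi⟩ := MeasurableSpace.measurable_injection_nat_bool_of_countablySeparated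
    (ℚ → ℝ≥0∞)
  have := MeasurableSpace.countablySeparated_def (α := Set.range (iota : (Fin n → ℝ) → Config))
  rw [this]
  have h2 : MeasurableSpace.CountablySeparated (ℚ → ℝ≥0∞) := inferInstance
  rw [MeasurableSpace.countablySeparated_def] at h2
  obtain ⟨S, hSc, hSm, hS⟩ := h2
  refine ⟨(fun s => g ⁻¹' s) '' S, hSc.image _, ?_, ?_⟩
  · rintro _ ⟨s, hs, rfl⟩
    exact hg (hSm s hs)
  · intro μ _ ν _ h
    exact hinj (hS _ (Set.mem_univ _) _ (Set.mem_univ _) fun s hs => h _ ⟨s, hs, rfl⟩)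

/-- A function on configurations is measurable on the `n`-particle configurations if its
composition with `ι_n` is measurable, and it may be replaced by zero elsewhere. -/
theorem measurable_indicator_range_iota {β : Type*} [MeasurableSpace β] [Zero β] {n : ℕ}
    {g : Config → β} (hg : Measurable fun x : Fin n → ℝ => g (iota x)) :
    Measurable ((Set.range (iota : (Fin n → ℝ) → Config)).indicator g) := by
  refine measurable_of_restrict_of_restrict_compl (measurableSet_range_iota n) ?_ ?_
  · have : (Set.range (iota : (Fin n → ℝ) → Config)).domRestrict
        ((Set.range (iota : (Fin n → ℝ) → Config)).indicator g) =
        fun μ => g μ.1 := by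
      ext μ; simp
    rw [this]
    intro s hs
    have h1 : Measurable (Set.rangeFactorization (iota : (Fin n → ℝ) → Config)) :=
      measurable_iota.subtype_mk
    -- A measurable surjection from a standard Borel space onto a countably separated space detects
    -- measurability: a set is measurable as soon as its preimage is.
    refine (h1.measurableSet_preimage_iff_of_surjective
      Set.rangeFactorization_surjective).1 ?_
    exact hg hs
  · have : (Set.range (iota : (Fin n → ℝ) → Config))ᶜ.domRestrict
        ((Set.range (iota : (Fin n → ℝ) → Config)).indicator g) = fun _ => 0 := by
      ext μ
      simp only [Set.domRestrict_apply]
      exact Set.indicator_of_notMem μ.2 _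
    rw [this]
    exact measurable_const

/-! ### Functions of `n`-particle configurations -/

theorem unlabel_iota {n : ℕ} {f : (Fin n → ℝ) → ℝ} (hf : IsSymm f) (x : Fin n → ℝ) :
    unlabel f (iota x) = f x := by
  have h : ∃ y : Fin n → ℝ, iota y = iota x := ⟨x, rfl⟩
  rw [unlabel, dif_pos h]
  obtain ⟨s, hs⟩ := exists_perm_of_iota_eq h.choose_spec
  rw [← hs, hf s x]

theorem measurable_unlabel {n : ℕ} {f : (Fin n → ℝ) → ℝ} (hf : IsSymm f) (hm : Measurable f) :
    Measurable (unlabel f) := by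
  have : unlabel f = (Set.range (iota : (Fin n → ℝ) → Config)).indicator (unlabel f) := by
    ext μ
    by_cases h : μ ∈ Set.range (iota : (Fin n → ℝ) → Config)
    · rw [Set.indicator_of_mem h]
    · rw [Set.indicator_of_notMem h, unlabel, dif_neg (by exact h)]
  rw [this]
  exact measurable_indicator_range_iota (by simpa only [unlabel_iota hf] using hm)

/-- The function `μ ↦ E_μ[F(η_t)]` is only known to be measurable along `iota`. This lemma replaces
it by a measurable function on `Config` with the same values on `n`-particle configurations. -/
theorem exists_measurable_comp_iota {n : ℕ} {h : (Fin n → ℝ) → ℝ≥0∞} (hm : Measurable h)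
    (hs : ∀ (s : Equiv.Perm (Fin n)) x, h (fun i => x (s i)) = h x) :
    ∃ F : Config → ℝ≥0∞, Measurable F ∧ ∀ x, F (iota x) = h x := by
  classical
  let g : Config → ℝ≥0∞ := fun μ =>
    if H : ∃ x : Fin n → ℝ, iota x = μ then h H.choose else 0
  have hg : ∀ x, g (iota x) = h x := by
    intro x
    have H : ∃ y : Fin n → ℝ, iota y = iota x := ⟨x, rfl⟩
    simp only [g, dif_pos H]
    obtain ⟨s, hs'⟩ := exists_perm_of_iota_eq H.choose_spec
    rw [← hs', hs s x]
  refine ⟨_, measurable_indicator_range_iota (g := g) (n := n) (by simpa only [hg] using hm),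
    fun x => ?_⟩
  rw [Set.indicator_of_mem (Set.mem_range_self x), hg]

/-- Measurability of `h` along `iota` suffices, since the image measure is concentrated on the
measurable range of `iota`. -/
theorem lintegral_map_iota {n : ℕ} (ν : Measure (Fin n → ℝ)) {h : Config → ℝ≥0∞}
    (hh : Measurable fun x : Fin n → ℝ => h (iota x)) :
    ∫⁻ μ, h μ ∂(ν.map iota) = ∫⁻ x, h (iota x) ∂ν := by
  have hm := measurable_indicator_range_iota hh
  have h1 : h =ᵐ[ν.map iota] (Set.range (iota : (Fin n → ℝ) → Config)).indicator h := by
    have : ∀ᵐ μ ∂(ν.map iota), μ ∈ Set.range (iota : (Fin n → ℝ) → Config) := by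
      exact (ae_map_iff measurable_iota.aemeasurable (measurableSet_range_iota n)).2
        (Eventually.of_forall fun x => ⟨x, rfl⟩)
    filter_upwards [this] with μ hμ
    rw [Set.indicator_of_mem hμ]
  rw [lintegral_congr_ae h1, lintegral_map hm measurable_iota]
  refine lintegral_congr fun x => ?_
  rw [Set.indicator_of_mem (Set.mem_range_self x)]

/-! ### The transition operators -/

variable {Ω : Type*} [MeasurableSpace Ω]

namespace MarkovFamily

instance (X : MarkovFamily Ω) (μ : Config) : IsProbabilityMeasure (X.P μ) :=
  X.isProbabilityMeasure_P μ

/-- The transition operator `P_t F(μ) = E_μ[F(η_t)]`. -/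
def trans (X : MarkovFamily Ω) (t : ℝ≥0) (F : Config → ℝ≥0∞) (μ : Config) : ℝ≥0∞ :=
  ∫⁻ ω, F (X.η t ω) ∂(X.P μ)

/-- The transition kernel of `n` labeled particles. -/
def transKernel (X : MarkovFamily Ω) (t : ℝ≥0) (n : ℕ) : Kernel (Fin n → ℝ) Config where
  toFun x := (X.P (iota x)).map (X.η t)
  measurable' := Measure.measurable_of_measurable_coe _ fun s hs => by
    simp only [Measure.map_apply (X.measurable_η t) hs]
    exact X.measurable_finite n t s hs

theorem transKernel_apply (X : MarkovFamily Ω) (t : ℝ≥0) (n : ℕ) (x : Fin n → ℝ) :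
    X.transKernel t n x = (X.P (iota x)).map (X.η t) := rfl

instance (X : MarkovFamily Ω) (t : ℝ≥0) (n : ℕ) : IsMarkovKernel (X.transKernel t n) :=
  ⟨fun x => by
    rw [transKernel_apply]
    exact Measure.isProbabilityMeasure_map (X.measurable_η t).aemeasurable⟩

variable (X : MarkovFamily Ω)

theorem measurable_trans_iota (t : ℝ≥0) (n : ℕ) {F : Config → ℝ≥0∞} (hF : Measurable F) :
    Measurable fun x : Fin n → ℝ => X.trans t F (iota x) := by
  have : (fun x : Fin n → ℝ => X.trans t F (iota x)) =
      fun x => ∫⁻ μ, F μ ∂(X.transKernel t n x) := by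
    ext x
    rw [transKernel_apply, lintegral_map hF (X.measurable_η t), trans]
  rw [this]
  exact hF.lintegral_kernel

theorem ae_mem_range_iota (hX : X.IsConservative) (t : ℝ≥0) (n : ℕ) (x : Fin n → ℝ) :
    ∀ᵐ ω ∂(X.P (iota x)), X.η t ω ∈ Set.range (iota : (Fin n → ℝ) → Config) := by
  filter_upwards [hX (iota x) t] with ω hω
  rw [range_iota]
  exact hω.trans (iota_univ n x)

theorem trans_iota_zero (hX : X.IsConservative) (t : ℝ≥0) (F : Config → ℝ≥0∞)
    (x : Fin 0 → ℝ) : X.trans t F (iota x) = F (iota x) := by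
  have : ∀ᵐ ω ∂(X.P (iota x)), F (X.η t ω) = F (iota x) := by
    filter_upwards [X.ae_mem_range_iota hX t 0 x] with ω hω
    obtain ⟨y, hy⟩ := hω
    rw [← hy, Subsingleton.elim y x]
  rw [trans, lintegral_congr_ae this, lintegral_const, measure_univ, mul_one]

/-- Reversibility is assumed for `n ≥ 1` only. With no particles, conservation makes the transition
operator the identity at the empty configuration, so the relation also holds for `n = 0`. -/
theorem lintegral_trans_mul (hX : X.IsConservative) {n : ℕ} (ν : Measure (Fin n → ℝ))
    (hν : 1 ≤ n → X.IsReversible (ν.map iota)) (t : ℝ≥0) {F G : Config → ℝ≥0∞}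
    (hF : Measurable F) (hG : Measurable G) :
    ∫⁻ x, X.trans t F (iota x) * G (iota x) ∂ν = ∫⁻ x, F (iota x) * X.trans t G (iota x) ∂ν := by
  rcases Nat.eq_zero_or_pos n with rfl | hn
  · simp only [X.trans_iota_zero hX]
  · have := hν hn t F G hF hG
    rw [lintegral_map_iota, lintegral_map_iota] at this
    · exact this
    · exact (hF.comp measurable_iota).mul (X.measurable_trans_iota t n hG)
    · exact (X.measurable_trans_iota t n hF).mul (hG.comp measurable_iota)

theorem lintegral_trans (hX : X.IsConservative) {n : ℕ} (ν : Measure (Fin n → ℝ))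
    (hν : 1 ≤ n → X.IsReversible (ν.map iota)) (t : ℝ≥0) {F : Config → ℝ≥0∞}
    (hF : Measurable F) :
    ∫⁻ x, X.trans t F (iota x) ∂ν = ∫⁻ x, F (iota x) ∂ν := by
  have := X.lintegral_trans_mul hX ν hν t hF (G := fun _ => 1) measurable_const
  simpa [trans] using this

end MarkovFamily

/-! ### Measures on `ℝ^J` and cells -/

/-- A finite family of pairwise disjoint bounded measurable sets. -/
structure IsCell {ι : Type} (B : ι → Set ℝ) : Prop where
  meas : ∀ i, MeasurableSet (B i)
  bdd : ∀ i, Bornology.IsBounded (B i)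
  disj : Pairwise fun i j => Disjoint (B i) (B j)

/-- The product of the sets `B (φ j)`. -/
def box {ι J : Type} (B : ι → Set ℝ) (φ : J → ι) : Set (J → ℝ) :=
  Set.univ.pi fun j => B (φ j)

theorem mem_box {ι J : Type} {B : ι → Set ℝ} {φ : J → ι} {x : J → ℝ} :
    x ∈ box B φ ↔ ∀ j, x j ∈ B (φ j) := by simp [box]

theorem IsCell.measurableSet_box {ι J : Type} [Countable J] {B : ι → Set ℝ} (hB : IsCell B)
    (φ : J → ι) : MeasurableSet (box B φ) :=
  MeasurableSet.univ_pi fun j => hB.meas (φ j)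

theorem IsCell.eq_of_mem {ι : Type} {B : ι → Set ℝ} (hB : IsCell B) {i j : ι} {x : ℝ}
    (hi : x ∈ B i) (hj : x ∈ B j) : i = j := by
  by_contra h
  exact Set.disjoint_left.1 (hB.disj h) hi hj

theorem IsCell.disjoint_box {ι J : Type} {B : ι → Set ℝ} (hB : IsCell B) {φ ψ : J → ι}
    (h : φ ≠ ψ) : Disjoint (box B φ) (box B ψ) := by
  rw [Set.disjoint_left]
  intro x hx hy
  exact h (funext fun j => hB.eq_of_mem (mem_box.1 hx j) (mem_box.1 hy j))

/-- The sets `[-R, R]^J`. -/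
def cube (J : Type) (R : ℕ) : Set (J → ℝ) := Set.univ.pi fun _ => Set.Icc (-(R : ℝ)) R

theorem measurableSet_cube (J : Type) [Countable J] (R : ℕ) : MeasurableSet (cube J R) :=
  MeasurableSet.univ_pi fun _ => measurableSet_Icc

theorem cube_mono (J : Type) : Monotone (cube J) := by
  intro m n h
  refine Set.pi_mono fun _ _ => Set.Icc_subset_Icc ?_ ?_
  · exact neg_le_neg (by exact_mod_cast h)
  · exact_mod_cast h

theorem exists_mem_cube {J : Type} [Fintype J] (x : J → ℝ) : ∃ R, x ∈ cube J R := by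
  obtain ⟨R, hR⟩ := exists_nat_ge (∑ j, |x j|)
  refine ⟨R, fun j _ => ?_⟩
  have : |x j| ≤ R := (Finset.single_le_sum (f := fun j => |x j|) (fun _ _ => abs_nonneg _)
    (Finset.mem_univ j)).trans hR
  exact ⟨(abs_le.1 this).1, (abs_le.1 this).2⟩

theorem iUnion_cube (J : Type) [Fintype J] : ⋃ R, cube J R = Set.univ :=
  Set.eq_univ_of_forall fun x => Set.mem_iUnion.2 (exists_mem_cube x)

theorem exists_subset_cube {J : Type} [Fintype J] {s : Set (J → ℝ)}
    (hs : Bornology.IsBounded s) : ∃ R, s ⊆ cube J R := by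
  obtain ⟨C, hC⟩ := hs.exists_norm_le
  obtain ⟨R, hR⟩ := exists_nat_ge C
  refine ⟨R, fun x hx j _ => ?_⟩
  have : |x j| ≤ R := (norm_le_pi_norm x j).trans ((hC x hx).trans hR)
  exact ⟨(abs_le.1 this).1, (abs_le.1 this).2⟩

/-- The atoms of the algebra of sets generated by a finite family of sets. -/
def atom {J : Type} (A : J → Set ℝ) (T : {T : Finset J // T.Nonempty}) : Set ℝ :=
  {x | ∀ j, x ∈ A j ↔ j ∈ T.1}

theorem isCell_atom {J : Type} [Fintype J] {A : J → Set ℝ} (hA : ∀ j, MeasurableSet (A j))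
    (hb : ∀ j, Bornology.IsBounded (A j)) : IsCell (atom A) where
  meas T := by
    have : atom A T = ⋂ j, {x | x ∈ A j ↔ j ∈ T.1} := by ext x; simp [atom]
    rw [this]
    refine MeasurableSet.iInter fun j => ?_
    by_cases h : j ∈ T.1
    · simpa [h] using hA j
    · simp only [h, iff_false]
      exact (hA j).compl
  bdd T := by
    obtain ⟨j, hj⟩ := T.2
    exact (hb j).subset fun x hx => (hx j).2 hj
  disj S T h := by
    refine Set.disjoint_left.2 ?_
    intro x hx hy
    exact h (Subtype.ext (Finset.ext fun j => (hx j).symm.trans (hy j)))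

open Classical in
-- The sides of a general box may overlap, whereas the explicit formulas below need disjoint sides.
-- Each coordinate lies in exactly one atom of the algebra generated by the sides, which cuts the
-- box into disjoint boxes over atoms.
theorem measure_pi_eq_sum_box {J : Type} [Fintype J] {A : J → Set ℝ}
    (hA : ∀ j, MeasurableSet (A j)) (hb : ∀ j, Bornology.IsBounded (A j))
    (m : Measure (J → ℝ)) :
    m (Set.univ.pi A) = ∑ φ : J → {T : Finset J // T.Nonempty},
      if ∀ j, j ∈ (φ j).1 then m (box (atom A) φ) else 0 := by
  have hc := isCell_atom hA hb
  have : Set.univ.pi A = ⋃ φ ∈ Finset.univ.filter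
      (fun φ : J → {T : Finset J // T.Nonempty} => ∀ j, j ∈ (φ j).1), box (atom A) φ := by
    ext x
    simp only [Set.mem_univ_pi, Finset.mem_filter, Finset.mem_univ, true_and, Set.mem_iUnion,
      mem_box, exists_prop]
    constructor
    · intro h
      refine ⟨fun j => ⟨Finset.univ.filter fun i => x j ∈ A i, j, by simpa using h j⟩,
        fun j => by simpa using h j, fun j i => by simp⟩
    · rintro ⟨φ, hφ, hx⟩ j
      exact (hx j j).2 (hφ j)
  rw [this, measure_biUnion_finset (fun φ _ ψ _ h => hc.disjoint_box h)
    fun φ _ => hc.measurableSet_box φ, Finset.sum_filter]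

/-- The products of bounded measurable sets. -/
def boxSystem (J : Type) : Set (Set (J → ℝ)) :=
  Set.univ.pi '' Set.univ.pi fun _ => {A : Set ℝ | MeasurableSet A ∧ Bornology.IsBounded A}

theorem isPiSystem_boxSystem (J : Type) : IsPiSystem (boxSystem J) :=
  IsPiSystem.pi fun _ _ hs _ ht _ => ⟨hs.1.inter ht.1, hs.2.subset Set.inter_subset_left⟩

theorem cube_mem_boxSystem (J : Type) (R : ℕ) : cube J R ∈ boxSystem J :=
  ⟨_, fun _ _ => ⟨measurableSet_Icc, Metric.isBounded_Icc _ _⟩, rfl⟩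

theorem iUnion_Icc_nat : ⋃ R : ℕ, Set.Icc (-(R : ℝ)) R = Set.univ := by
  refine Set.eq_univ_of_forall fun x => Set.mem_iUnion.2 ?_
  obtain ⟨R, hR⟩ := exists_nat_ge |x|
  exact ⟨R, (abs_le.1 hR).1, (abs_le.1 hR).2⟩

theorem generateFrom_boxSystem (J : Type) [Fintype J] :
    MeasurableSpace.generateFrom (boxSystem J) = MeasurableSpace.pi := by
  refine generateFrom_eq_pi (fun _ => ?_) fun _ => ?_
  · refine le_antisymm (MeasurableSpace.generateFrom_le fun s hs => hs.1) fun s hs => ?_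
    have : s = ⋃ R : ℕ, s ∩ Set.Icc (-(R : ℝ)) R := by
      rw [← Set.inter_iUnion, iUnion_Icc_nat, Set.inter_univ]
    rw [this]
    refine MeasurableSet.iUnion fun R => MeasurableSpace.measurableSet_generateFrom ?_
    exact ⟨hs.inter measurableSet_Icc, (Metric.isBounded_Icc _ _).subset Set.inter_subset_right⟩
  · exact ⟨fun R : ℕ => Set.Icc (-(R : ℝ)) R,
      fun R => ⟨measurableSet_Icc, Metric.isBounded_Icc _ _⟩, iUnion_Icc_nat⟩

theorem measure_boxSystem_lt_top {J : Type} [Fintype J] {m : Measure (J → ℝ)}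
    (hfin : ∀ (ι : Type) [Fintype ι] (B : ι → Set ℝ), IsCell B → ∀ φ : J → ι, m (box B φ) < ∞)
    {s : Set (J → ℝ)} (hs : s ∈ boxSystem J) : m s < ∞ := by
  classical
  obtain ⟨A, hA, rfl⟩ := hs
  have hA' : ∀ j, MeasurableSet (A j) ∧ Bornology.IsBounded (A j) := fun j => hA j trivial
  rw [measure_pi_eq_sum_box (fun j => (hA' j).1) (fun j => (hA' j).2)]
  refine ENNReal.sum_lt_top.2 fun φ _ => ?_
  split_ifs
  · exact hfin _ _ (isCell_atom (fun j => (hA' j).1) fun j => (hA' j).2) φ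
  · exact ENNReal.zero_lt_top

/-- Two measures on `ℝ^J` are equal if they agree (and are finite) on the products of cells. -/
theorem ext_of_box {J : Type} [Fintype J] {m m' : Measure (J → ℝ)}
    (h : ∀ (ι : Type) [Fintype ι] (B : ι → Set ℝ), IsCell B → ∀ φ : J → ι,
      m (box B φ) = m' (box B φ))
    (hfin : ∀ (ι : Type) [Fintype ι] (B : ι → Set ℝ), IsCell B → ∀ φ : J → ι,
      m (box B φ) < ∞) : m = m' := by
  classical
  refine Measure.ext_of_generateFrom_of_iUnion (boxSystem J) (cube J)
    (generateFrom_boxSystem J).symm (isPiSystem_boxSystem J) (iUnion_cube J)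
    (fun R => cube_mem_boxSystem J R)
    (fun R => (measure_boxSystem_lt_top hfin (cube_mem_boxSystem J R)).ne) ?_
  rintro _ ⟨A, hA, rfl⟩
  have hA' : ∀ j, MeasurableSet (A j) ∧ Bornology.IsBounded (A j) := fun j => hA j trivial
  rw [measure_pi_eq_sum_box (fun j => (hA' j).1) (fun j => (hA' j).2),
    measure_pi_eq_sum_box (fun j => (hA' j).1) (fun j => (hA' j).2)]
  refine Finset.sum_congr rfl fun φ _ => ?_
  rw [h _ _ (isCell_atom (fun j => (hA' j).1) fun j => (hA' j).2) φ]

/-- A family of measures on `ℝ^J` is measurable if it is so on the products of cells. -/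
theorem measurable_of_box {Y : Type*} {J : Type} [MeasurableSpace Y] [Fintype J]
    {m : Y → Measure (J → ℝ)}
    (h : ∀ (ι : Type) [Fintype ι] (B : ι → Set ℝ), IsCell B → ∀ φ : J → ι,
      Measurable fun y => m y (box B φ))
    (hfin : ∀ y (ι : Type) [Fintype ι] (B : ι → Set ℝ), IsCell B → ∀ φ : J → ι,
      m y (box B φ) < ∞) : Measurable m := by
  classical
  have hbox : ∀ s ∈ boxSystem J, Measurable fun y => m y s := by
    rintro _ ⟨A, hA, rfl⟩
    have hA' : ∀ j, MeasurableSet (A j) ∧ Bornology.IsBounded (A j) := fun j => hA j trivial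
    simp only [measure_pi_eq_sum_box (fun j => (hA' j).1) (fun j => (hA' j).2)]
    refine Finset.measurable_sum _ fun φ _ => ?_
    split_ifs
    · exact h _ _ (isCell_atom (fun j => (hA' j).1) fun j => (hA' j).2) φ
    · exact measurable_const
  have hR : ∀ R, Measurable fun y => (m y).restrict (cube J R) := by
    intro R
    have : ∀ y, IsFiniteMeasure ((m y).restrict (cube J R)) := fun y =>
      ⟨by rw [Measure.restrict_apply_univ]
          exact measure_boxSystem_lt_top (hfin y) (cube_mem_boxSystem J R)⟩
    refine Measurable.measure_of_isPiSystem (generateFrom_boxSystem J).symm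
      (isPiSystem_boxSystem J) (fun s hs => ?_) ?_
    · have hms : MeasurableSet s := by
        rw [← generateFrom_boxSystem J]; exact MeasurableSpace.measurableSet_generateFrom hs
      simp only [Measure.restrict_apply hms]
      rcases Set.eq_empty_or_nonempty (s ∩ cube J R) with he | hne
      · simp only [he, measure_empty, measurable_const]
      · exact hbox _ (isPiSystem_boxSystem J _ hs _ (cube_mem_boxSystem J R) hne)
    · simp only [Measure.restrict_apply_univ]
      exact hbox _ (cube_mem_boxSystem J R)
  refine Measure.measurable_of_measurable_coe _ fun s hs => ?_
  have : (fun y => m y s) = fun y => ⨆ R, (m y).restrict (cube J R) s := by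
    ext y
    simp only [Measure.restrict_apply hs]
    rw [← Monotone.measure_iUnion
      (fun i j hij => Set.inter_subset_inter_right _ (cube_mono J hij)),
      ← Set.inter_iUnion, iUnion_cube, Set.inter_univ]
  rw [this]
  exact Measurable.iSup fun R => (Measure.measurable_coe hs).comp (hR R)

/-- A kernel with values in the locally finite measures is s-finite. -/
theorem isSFiniteKernel_of_cube {Y : Type*} {J : Type} [MeasurableSpace Y] [Fintype J]
    (κ : Kernel Y (J → ℝ)) (h : ∀ y R, κ y (cube J R) < ∞) : IsSFiniteKernel κ := by
  classical
  let D : ℕ → Set (J → ℝ) := disjointed (cube J)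
  have hD : ∀ R, MeasurableSet (D R) := fun R =>
    MeasurableSet.disjointed (measurableSet_cube J) R
  have hDfin : ∀ y R, κ y (D R) < ∞ := fun y R =>
    (measure_mono (disjointed_subset _ _)).trans_lt (h y R)
  -- On each shell `D R` the mass is finite for every `y`, but not uniformly in `y`. Sorting the `y`
  -- by the integer part of the mass gives pieces bounded by `k + 1`.
  let E : ℕ → ℕ → Set Y := fun R k => {y | ⌊(κ y (D R)).toReal⌋₊ = k}
  have hE : ∀ R k, MeasurableSet (E R k) := fun R k =>
    (Nat.measurable_floor.comp (κ.measurable_coe (hD R)).ennreal_toReal)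
      (measurableSet_singleton k)
  let κ' : ℕ × ℕ → Kernel Y (J → ℝ) := fun p =>
    Kernel.piecewise (hE p.1 p.2) (κ.restrict (hD p.1)) 0
  have hfin : ∀ p, IsFiniteKernel (κ' p) := by
    rintro ⟨R, k⟩
    refine ⟨⟨(k : ℝ≥0∞) + 1, by simp, fun y => ?_⟩⟩
    simp only [κ', Kernel.piecewise_apply]
    split_ifs with hy
    · rw [Kernel.restrict_apply, Measure.restrict_apply_univ]
      have h1 : (κ y (D R)).toReal < k + 1 := by
        have : ⌊(κ y (D R)).toReal⌋₊ = k := hy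
        rw [← this]; exact Nat.lt_floor_add_one _
      rw [← ENNReal.ofReal_toReal (hDfin y R).ne]
      refine (ENNReal.ofReal_le_ofReal h1.le).trans ?_
      rw [ENNReal.ofReal_add (by positivity) (by positivity)]
      simp
    · simp
  have : κ = Kernel.sum κ' := by
    ext y s hs
    rw [Kernel.sum_apply' _ _ hs, ENNReal.tsum_prod']
    have h1 : ∀ R, ∑' k, κ' (R, k) y s = κ y (s ∩ D R) := by
      intro R
      rw [tsum_eq_single ⌊(κ y (D R)).toReal⌋₊]
      · simp only [κ', Kernel.piecewise_apply]
        rw [if_pos (by rfl), Kernel.restrict_apply, Measure.restrict_apply hs]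
      · intro k hk
        simp only [κ', Kernel.piecewise_apply]
        rw [if_neg (show y ∉ E R k from fun hy => hk (Eq.symm hy))]
        simp
    simp only [h1]
    rw [← measure_iUnion, ← Set.inter_iUnion, iUnion_disjointed, iUnion_cube, Set.inter_univ]
    · exact fun i j hij => ((disjoint_disjointed (cube J)) hij).mono Set.inter_subset_right
        Set.inter_subset_right
    · exact fun R => hs.inter (hD R)
  rw [this]
  exact Kernel.isSFiniteKernel_sum

/-! ### Particle counts and factorial measures -/

/-- The number of particles in `B`. -/
def cnt (B : Set ℝ) (μ : Config) : ℕ := ⌊(μ.1 B).toReal⌋₊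

theorem measurable_cnt {B : Set ℝ} (hB : MeasurableSet B) : Measurable (cnt B) :=
  Nat.measurable_floor.comp (measurable_config_eval hB).ennreal_toReal

theorem cnt_iota {ι : Type} [Countable ι] (x : ι → ℝ) {B : Set ℝ} (hB : MeasurableSet B) :
    cnt B (iota x) = Nat.card {i // x i ∈ B} := by
  rw [cnt, iota_apply x hB]
  rcases finite_or_infinite {i // x i ∈ B} with h | h
  · rw [ENat.card_eq_coe_natCard]; simp
  · rw [ENat.card_eq_top.2 h]; simp

theorem natCast_cnt {B : Set ℝ} (hB : MeasurableSet B) {μ : Config} (h : μ.1 B < ∞) :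
    (cnt B μ : ℝ≥0∞) = μ.1 B := by
  obtain ⟨ι, _, x, rfl⟩ := exists_eq_iota μ
  rw [cnt_iota x hB]
  rw [iota_apply x hB] at h ⊢
  have hf : Finite {i // x i ∈ B} := by
    rw [← ENat.card_lt_top]
    exact_mod_cast h
  rw [ENat.card_eq_coe_natCard]; simp

/-- Configurations with finitely many particles in each bounded set. -/
def IsLocFin (μ : Config) : Prop := ∀ R : ℕ, μ.1 (Set.Icc (-(R : ℝ)) R) < ∞

theorem measurableSet_isLocFin : MeasurableSet {μ : Config | IsLocFin μ} := by
  have : {μ : Config | IsLocFin μ} = ⋂ R : ℕ, {μ | μ.1 (Set.Icc (-(R : ℝ)) R) < ∞} := by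
    ext μ; simp [IsLocFin]
  rw [this]
  exact MeasurableSet.iInter fun R =>
    measurableSet_lt (measurable_config_eval measurableSet_Icc) measurable_const

theorem IsLocFin.lt_top {μ : Config} (h : IsLocFin μ) {B : Set ℝ} (hB : Bornology.IsBounded B) :
    μ.1 B < ∞ := by
  obtain ⟨C, hC⟩ := hB.exists_norm_le
  obtain ⟨R, hR⟩ := exists_nat_ge C
  refine (measure_mono fun x hx => ?_).trans_lt (h R)
  exact abs_le.1 ((hC x hx).trans hR)

theorem isLocFin_iota {n : ℕ} (x : Fin n → ℝ) : IsLocFin (iota x) := fun R =>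
  (measure_mono (Set.subset_univ _)).trans_lt (by
    rw [iota_univ]; exact ENNReal.natCast_lt_top n)

open Classical in
/-- The number of indices that are mapped to `i`. -/
def fib {ι J : Type} [Fintype J] (φ : J → ι) (i : ι) : ℕ :=
  (Finset.univ.filter fun j => φ j = i).card

/-- The classes are disjoint, so an injection that respects them is an independent choice of one
injection for each fiber of `φ`. The number of choices for a fiber is a falling factorial. -/
theorem card_embedding_fiberwise {ι J U : Type} [Fintype ι] [Fintype J] (φ : J → ι)
    (c : U → ι → Prop) (hc : ∀ u i j, c u i → c u j → i = j) (hfin : ∀ i, Finite {u // c u i}) :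
    ENat.card {e : J ↪ U // ∀ j, c (e j) (φ j)} =
      (∏ i, (Nat.card {u // c u i}).descFactorial (fib φ i) : ℕ) := by
  classical
  have := fun i => Fintype.ofFinite {u // c u i}
  let E : {e : J ↪ U // ∀ j, c (e j) (φ j)} ≃ (∀ i, {j // φ j = i} ↪ {u // c u i}) :=
    { toFun := fun e i => ⟨fun j => ⟨e.1 j.1, by have := e.2 j.1; rwa [j.2] at this⟩,
        fun j j' h => Subtype.ext (e.1.injective (congrArg Subtype.val h))⟩
      invFun := fun g => ⟨⟨fun j => (g (φ j) ⟨j, rfl⟩).1, fun j j' h => by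
          have h' : (g (φ j) ⟨j, rfl⟩).1 = (g (φ j') ⟨j', rfl⟩).1 := h
          have h1 : φ j = φ j' := hc _ _ _ (g (φ j) ⟨j, rfl⟩).2 (by
            rw [h']; exact (g (φ j') ⟨j', rfl⟩).2)
          have aux : ∀ i (hi : φ j' = i), (g (φ j') ⟨j', rfl⟩).1 = (g i ⟨j', hi⟩).1 := by
            rintro _ rfl; rfl
          rw [aux _ h1.symm] at h'
          exact congrArg Subtype.val ((g (φ j)).injective (Subtype.ext h'))⟩,
        fun j => (g (φ j) ⟨j, rfl⟩).2⟩
      left_inv := fun e => by ext; rfl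
      right_inv := fun g => by
        funext i
        ext ⟨j, hj⟩
        subst hj
        rfl }
  rw [ENat.card_congr E, ENat.card_eq_coe_fintype_card, Fintype.card_pi]
  simp only [Fintype.card_embedding_eq, Nat.card_eq_fintype_card]
  congr 1
  refine Finset.prod_congr rfl fun i _ => ?_
  have : fib φ i = Fintype.card {j // φ j = i} := by rw [fib, Fintype.card_subtype]
  rw [this]

theorem factorialMeasure_box {ι : Type} [Fintype ι] {B : ι → Set ℝ} (hB : IsCell B) {n : ℕ}
    (φ : Fin n → ι) {μ : Config} (hμ : IsLocFin μ) :
    factorialMeasure n μ.1 (box B φ) =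
      ∏ i, (((cnt (B i) μ).descFactorial (fib φ i) : ℕ) : ℝ≥0∞) := by
  classical
  obtain ⟨U, _, x, rfl⟩ := exists_eq_iota μ
  have hfin : ∀ i, Finite {u // x u ∈ B i} := by
    intro i
    have := hμ.lt_top (hB.bdd i)
    rw [iota_apply x (hB.meas i)] at this
    rw [← ENat.card_lt_top]
    exact_mod_cast this
  have h1 : factorialMeasure n (iota x).1 (box B φ) =
      ∑' e : Fin n ↪ U, ({e : Fin n ↪ U | ∀ j, x (e j) ∈ B (φ j)}).indicator 1 e := by
    rw [factorialMeasure_iota, Measure.sum_apply _ (hB.measurableSet_box φ)]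
    refine tsum_congr fun e => ?_
    rw [Measure.dirac_apply' _ (hB.measurableSet_box φ)]
    by_cases h : ∀ j, x (e j) ∈ B (φ j)
    · rw [Set.indicator_of_mem (mem_box.2 h), Set.indicator_of_mem (by exact h)]; rfl
    · rw [Set.indicator_of_notMem (mem_box.not.2 h), Set.indicator_of_notMem (by exact h)]
  rw [h1, ← tsum_subtype]
  simp only [Pi.one_apply]
  rw [ENNReal.tsum_one]
  have h2 := card_embedding_fiberwise φ (fun u i => x u ∈ B i)
    (fun u i j hi hj => hB.eq_of_mem hi hj) hfin
  change ((ENat.card {e : Fin n ↪ U // ∀ j, x (e j) ∈ B (φ j)} : ℕ∞) : ℝ≥0∞) = _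
  rw [h2, ENat.toENNReal_coe, Nat.cast_prod]
  simp only [cnt_iota x (hB.meas _)]

open Classical in
/-- The kernel `μ ↦ μ^(n)`, restricted to the locally finite configurations. -/
def factKernel (n : ℕ) : Kernel Config (Fin n → ℝ) where
  toFun μ := if IsLocFin μ then factorialMeasure n μ.1 else 0
  measurable' := by
    have key : ∀ (ι : Type) [Fintype ι] (B : ι → Set ℝ), IsCell B → ∀ (φ : Fin n → ι) (μ : Config),
        (if IsLocFin μ then factorialMeasure n μ.1 else 0) (box B φ) =
        {μ | IsLocFin μ}.indicator
          (fun μ => ∏ i, (((cnt (B i) μ).descFactorial (fib φ i) : ℕ) : ℝ≥0∞)) μ := by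
      intro ι _ B hB φ μ
      by_cases h : IsLocFin μ
      · rw [if_pos h, factorialMeasure_box hB φ h, Set.indicator_of_mem (by exact h)]
      · rw [if_neg h, Set.indicator_of_notMem (by exact h)]; rfl
    refine measurable_of_box (fun ι _ B hB φ => ?_) fun μ ι _ B hB φ => ?_
    · simp only [key ι B hB φ]
      refine Measurable.indicator ?_ measurableSet_isLocFin
      refine Finset.measurable_prod _ fun i _ => ?_
      exact (measurable_from_nat (f := fun k => ((k.descFactorial (fib φ i) : ℕ) : ℝ≥0∞))).comp
        (measurable_cnt (hB.meas i))
    · rw [key ι B hB φ]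
      refine lt_of_le_of_lt (Set.indicator_le_self' (fun _ _ => zero_le) _) ?_
      exact ENNReal.prod_lt_top fun i _ => ENNReal.natCast_lt_top _

theorem factKernel_apply (n : ℕ) {μ : Config} (h : IsLocFin μ) :
    factKernel n μ = factorialMeasure n μ.1 := by
  unfold factKernel
  change (@ite _ _ (Classical.propDecidable _) _ _) = _
  rw [if_pos h]

theorem factKernel_box {ι : Type} [Fintype ι] {B : ι → Set ℝ} (hB : IsCell B) {n : ℕ}
    (φ : Fin n → ι) {μ : Config} (hμ : IsLocFin μ) :
    factKernel n μ (box B φ) = ∏ i, (((cnt (B i) μ).descFactorial (fib φ i) : ℕ) : ℝ≥0∞) := by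
  rw [factKernel_apply n hμ, factorialMeasure_box hB φ hμ]

theorem factKernel_of_not {n : ℕ} {μ : Config} (h : ¬ IsLocFin μ) : factKernel n μ = 0 := by
  unfold factKernel
  change (@ite _ _ (Classical.propDecidable _) _ _) = _
  rw [if_neg h]

theorem lintegral_factorialMeasure_iota {n k : ℕ} (x : Fin n → ℝ) {f : (Fin k → ℝ) → ℝ≥0∞}
    (hf : Measurable f) :
    ∫⁻ y, f y ∂(factorialMeasure k (iota x).1) = ∑ e : Fin k ↪ Fin n, f fun j => x (e j) := by
  rw [factorialMeasure_iota, lintegral_sum_measure, tsum_fintype]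
  simp only [lintegral_dirac' _ hf]

/-! ### Rising factorials and ensembles -/

/-- The product `a (a + c) ⋯ (a + (m - 1) c)`. -/
def rise {R : Type*} [CommSemiring R] (c : ℕ) (a : R) (m : ℕ) : R :=
  ∏ i ∈ Finset.range m, (a + c * i)

theorem rise_zero {R : Type*} [CommSemiring R] (c : ℕ) (a : R) : rise c a 0 = 1 := by
  simp [rise]

theorem rise_succ {R : Type*} [CommSemiring R] (c : ℕ) (a : R) (m : ℕ) :
    rise c a (m + 1) = rise c a m * (a + c * m) := Finset.prod_range_succ _ _

theorem rise_add {R : Type*} [CommSemiring R] (c : ℕ) (a : R) (l m : ℕ) :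
    rise c a (l + m) = rise c a l * rise c (a + c * l) m := by
  rw [rise, Finset.prod_range_add]
  congr 1
  refine Finset.prod_congr rfl fun i _ => ?_
  push_cast; ring

theorem rise_map {R S : Type*} [CommSemiring R] [CommSemiring S] (g : R →+* S) (c : ℕ) (a : R)
    (m : ℕ) : g (rise c a m) = rise c (g a) m := by
  simp [rise, map_prod]

theorem rise_lt_top {c : ℕ} {a : ℝ≥0∞} (ha : a < ∞) (m : ℕ) : rise c a m < ∞ :=
  ENNReal.prod_lt_top fun _ _ => ENNReal.add_lt_top.2
    ⟨ha, ENNReal.mul_lt_top (ENNReal.natCast_lt_top _) (ENNReal.natCast_lt_top _)⟩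

open Classical in
/-- The number of coordinates of `x` in `B`. -/
def cntVec {k : ℕ} (B : Set ℝ) (x : Fin k → ℝ) : ℕ :=
  (Finset.univ.filter fun j => x j ∈ B).card

theorem cntVec_of_mem_box {ι : Type} {B : ι → Set ℝ} (hB : IsCell B) {k : ℕ} {φ : Fin k → ι}
    {x : Fin k → ℝ} (hx : x ∈ box B φ) (i : ι) : cntVec (B i) x = fib φ i := by
  classical
  rw [cntVec, fib]
  congr 1
  ext j
  simp only [Finset.mem_filter, Finset.mem_univ, true_and]
  exact ⟨fun h => hB.eq_of_mem (mem_box.1 hx j) h, fun h => h ▸ mem_box.1 hx j⟩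

theorem fib_eq_sum {ι J : Type} [Fintype J] [DecidableEq ι] (φ : J → ι) (i : ι) :
    fib φ i = ∑ j, if φ j = i then 1 else 0 := by
  rw [fib, Finset.card_filter]
  exact Finset.sum_congr rfl fun j _ => by congr

theorem fib_comp_equiv {ι J J' : Type} [Fintype J] [Fintype J'] (φ : J → ι) (e : J' ≃ J) (i : ι) :
    fib (fun j => φ (e j)) i = fib φ i := by
  classical
  rw [fib_eq_sum, fib_eq_sum]
  exact Equiv.sum_comp e fun j => if φ j = i then 1 else 0

theorem sum_fib {ι J : Type} [Fintype ι] [Fintype J] (φ : J → ι) :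
    ∑ i, fib φ i = Fintype.card J := by
  classical
  simp only [fib_eq_sum]
  rw [Finset.sum_comm]
  simp

/-- The first `k` coordinates. -/
def headIdx {ι : Type} {n k : ℕ} (hk : k ≤ n) (φ : Fin n → ι) : Fin k → ι :=
  fun j => φ (Fin.castLE hk j)

/-- The last `n - k` coordinates. -/
def tailIdx {ι : Type} {n k : ℕ} (hk : k ≤ n) (φ : Fin n → ι) : Fin (n - k) → ι :=
  fun j => φ ⟨k + j, by omega⟩

theorem fib_head_add_tail {ι : Type} {n k : ℕ} (hk : k ≤ n) (φ : Fin n → ι) (i : ι) :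
    fib (headIdx hk φ) i + fib (tailIdx hk φ) i = fib φ i := by
  classical
  let e : Fin k ⊕ Fin (n - k) ≃ Fin n := finSumFinEquiv.trans (finCongr (by omega))
  rw [← fib_comp_equiv φ e, fib_eq_sum, fib_eq_sum, fib_eq_sum, Fintype.sum_sum_type]
  rfl

theorem glue_mem_box {ι : Type} {B : ι → Set ℝ} {n k : ℕ} (hk : k ≤ n) (φ : Fin n → ι)
    (x : Fin k → ℝ) (y : Fin (n - k) → ℝ) :
    glue x y ∈ box B φ ↔ x ∈ box B (headIdx hk φ) ∧ y ∈ box B (tailIdx hk φ) := by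
  simp only [mem_box, glue, headIdx, tailIdx]
  constructor
  · intro h
    refine ⟨fun j => ?_, fun j => ?_⟩
    · have := h (Fin.castLE hk j)
      rwa [dif_pos (by simp)] at this
    · have := h ⟨k + j, by omega⟩
      rw [dif_neg (by simp)] at this
      convert this using 2
      ext; simp
  · rintro ⟨h1, h2⟩ j
    split_ifs with hj
    · exact h1 ⟨j, hj⟩
    · have := h2 ⟨j - k, by omega⟩
      convert this using 3
      ext; simp; omega

theorem measurable_glue_right {n k : ℕ} (x : Fin k → ℝ) :
    Measurable (glue x : (Fin (n - k) → ℝ) → Fin n → ℝ) := by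
  refine measurable_pi_lambda _ fun i => ?_
  unfold glue
  split_ifs
  · exact measurable_const
  · exact measurable_pi_apply _

/-- The common structure of the Poisson process (`c = 0`) and of the Pascal process (`c = 1`). -/
structure Ensemble (c : ℕ) (b : ℝ≥0) (α : Measure ℝ)
    (κ : (k m : ℕ) → (Fin k → ℝ) → Measure (Fin m → ℝ)) (ν : (n : ℕ) → Measure (Fin n → ℝ))
    (π : Measure Config) : Prop where
  prob : IsProbabilityMeasure π
  fin : ∀ B : Set ℝ, Bornology.IsBounded B → α B < ∞
  κ_box : ∀ (k m : ℕ) (x : Fin k → ℝ) (ι : Type) [Fintype ι] (B : ι → Set ℝ), IsCell B →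
    ∀ ψ : Fin m → ι, κ k m x (box B ψ) = ∏ i, rise c (α (B i) + c * cntVec (B i) x) (fib ψ i)
  ν_box : ∀ (n : ℕ) (ι : Type) [Fintype ι] (B : ι → Set ℝ), IsCell B →
    ∀ φ : Fin n → ι, ν n (box B φ) = ∏ i, rise c (α (B i)) (fib φ i)
  locFin : ∀ᵐ μ ∂π, IsLocFin μ
  indep : ∀ (ι : Type) [Fintype ι] (B : ι → Set ℝ), IsCell B → iIndepFun (fun i => cnt (B i)) π
  fact : ∀ B : Set ℝ, MeasurableSet B → Bornology.IsBounded B → ∀ k : ℕ,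
    ∫⁻ μ, ((cnt B μ).descFactorial k : ℝ≥0∞) ∂π = b ^ k * rise c (α B) k

namespace Ensemble

variable {c : ℕ} {b : ℝ≥0} {α : Measure ℝ}
  {κ : (k m : ℕ) → (Fin k → ℝ) → Measure (Fin m → ℝ)} {ν : (n : ℕ) → Measure (Fin n → ℝ)}
  {π : Measure Config} (E : Ensemble c b α κ ν π)

include E in
theorem glue_box {n k : ℕ} (hk : k ≤ n) (x : Fin k → ℝ) {ι : Type} [Fintype ι] {B : ι → Set ℝ}
    (hB : IsCell B) (φ : Fin n → ι) :
    (κ k (n - k) x).map (glue x) (box B φ) = (box B (headIdx hk φ)).indicator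
      (fun _ => ∏ i, rise c (α (B i) + c * fib (headIdx hk φ) i) (fib (tailIdx hk φ) i)) x := by
  rw [Measure.map_apply (measurable_glue_right x) (hB.measurableSet_box φ)]
  by_cases hx : x ∈ box B (headIdx hk φ)
  · rw [Set.indicator_of_mem hx]
    have : glue x ⁻¹' box B φ = box B (tailIdx hk φ) := by
      ext y
      rw [Set.mem_preimage, glue_mem_box hk]
      exact and_iff_right hx
    rw [this, E.κ_box k (n - k) x ι B hB]
    simp only [cntVec_of_mem_box hB hx]
  · rw [Set.indicator_of_notMem hx]
    have : glue x ⁻¹' box B φ = ∅ := by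
      ext y
      rw [Set.mem_preimage, glue_mem_box hk]
      simp [hx]
    rw [this, measure_empty]

/-- The kernel that adds `n - k` coordinates to the vector `x ∈ ℝ^k`. -/
def ext {n k : ℕ} (hk : k ≤ n) : Kernel (Fin k → ℝ) (Fin n → ℝ) where
  toFun x := (κ k (n - k) x).map (glue x)
  measurable' := by
    refine measurable_of_box (fun ι _ B hB φ => ?_) fun x ι _ B hB φ => ?_
    · simp only [E.glue_box hk _ hB φ]
      exact measurable_const.indicator (hB.measurableSet_box _)
    · rw [E.glue_box hk _ hB φ]
      refine (Set.indicator_le_self' (fun _ _ => zero_le) _).trans_lt ?_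
      exact ENNReal.prod_lt_top fun i _ => rise_lt_top (ENNReal.add_lt_top.2 ⟨E.fin _ (hB.bdd i),
        ENNReal.mul_lt_top (ENNReal.natCast_lt_top _) (ENNReal.natCast_lt_top _)⟩) _

theorem ext_apply {n k : ℕ} (hk : k ≤ n) (x : Fin k → ℝ) :
    E.ext hk x = (κ k (n - k) x).map (glue x) := rfl

theorem ext_box {n k : ℕ} (hk : k ≤ n) (x : Fin k → ℝ) {ι : Type} [Fintype ι] {B : ι → Set ℝ}
    (hB : IsCell B) (φ : Fin n → ι) :
    E.ext hk x (box B φ) = (box B (headIdx hk φ)).indicator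
      (fun _ => ∏ i, rise c (α (B i) + c * fib (headIdx hk φ) i) (fib (tailIdx hk φ) i)) x :=
  E.glue_box hk x hB φ

theorem lintegral_ext {n k : ℕ} (hk : k ≤ n) (x : Fin k → ℝ) {f : (Fin n → ℝ) → ℝ≥0∞}
    (hf : Measurable f) : ∫⁻ z, f z ∂(E.ext hk x) = ∫⁻ y, f (glue x y) ∂(κ k (n - k) x) := by
  rw [ext_apply, lintegral_map hf (measurable_glue_right x)]

/-- Integrating `f` with respect to the last `n - k` variables, and then with respect to `μ^(k)`. -/
def tau {n k : ℕ} (hk : k ≤ n) : Kernel Config (Fin n → ℝ) := (E.ext hk).comp (factKernel k)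

theorem lintegral_tau {n k : ℕ} (hk : k ≤ n) (μ : Config) {f : (Fin n → ℝ) → ℝ≥0∞}
    (hf : Measurable f) :
    ∫⁻ z, f z ∂(E.tau hk μ) = ∫⁻ x, ∫⁻ z, f z ∂(E.ext hk x) ∂(factKernel k μ) :=
  Kernel.lintegral_comp _ _ _ hf

theorem lintegral_ext_box {n k : ℕ} (hk : k ≤ n) {ι : Type} [Fintype ι] {B : ι → Set ℝ}
    (hB : IsCell B) (φ : Fin n → ι) (m : Measure (Fin k → ℝ)) :
    ∫⁻ x, E.ext hk x (box B φ) ∂m = m (box B (headIdx hk φ)) *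
      ∏ i, rise c (α (B i) + c * fib (headIdx hk φ) i) (fib (tailIdx hk φ) i) := by
  simp only [E.ext_box hk _ hB φ]
  rw [lintegral_indicator (hB.measurableSet_box _), setLIntegral_const, mul_comm]

theorem tau_box {n k : ℕ} (hk : k ≤ n) {μ : Config} (hμ : IsLocFin μ) {ι : Type} [Fintype ι]
    {B : ι → Set ℝ} (hB : IsCell B) (φ : Fin n → ι) :
    E.tau hk μ (box B φ) = ∏ i, (((cnt (B i) μ).descFactorial (fib (headIdx hk φ) i) : ℕ) *
      rise c (α (B i) + c * fib (headIdx hk φ) i) (fib (tailIdx hk φ) i)) := by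
  rw [tau, Kernel.comp_apply' _ _ _ (hB.measurableSet_box φ), E.lintegral_ext_box hk hB,
    factKernel_box hB _ hμ, Finset.prod_mul_distrib]

include E in
theorem rise_lt_top {B : Set ℝ} (hB : Bornology.IsBounded B) (l m : ℕ) :
    rise c (α B + c * l) m < ∞ :=
  Intertwining.rise_lt_top (ENNReal.add_lt_top.2 ⟨E.fin _ hB,
    ENNReal.mul_lt_top (ENNReal.natCast_lt_top _) (ENNReal.natCast_lt_top _)⟩) m

include E in
theorem ν_box_lt_top (n : ℕ) {ι : Type} [Fintype ι] {B : ι → Set ℝ} (hB : IsCell B)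
    (φ : Fin n → ι) : ν n (box B φ) < ∞ := by
  rw [E.ν_box n ι B hB φ]
  exact ENNReal.prod_lt_top fun i _ => Intertwining.rise_lt_top (E.fin _ (hB.bdd i)) _

include E in
-- On a box the factorial measure is a product of falling factorials of counts in different cells.
-- Independence factorizes its mean, and the factors are the factorial moments; their powers of `b`
-- multiply to `b ^ n` because the fibers of `φ` have `n` elements in total.
theorem bind_factKernel (n : ℕ) : π.bind (factKernel n) = (b : ℝ≥0∞) ^ n • ν n := by
  refine Eq.symm (ext_of_box (fun ι _ B hB φ => ?_) fun ι _ B hB φ => ?_)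
  · rw [Measure.bind_apply (hB.measurableSet_box φ) (factKernel n).measurable.aemeasurable,
      Measure.smul_apply, E.ν_box n ι B hB φ, smul_eq_mul]
    have h1 : ∫⁻ μ, factKernel n μ (box B φ) ∂π =
        ∫⁻ μ, ∏ i, ((cnt (B i) μ).descFactorial (fib φ i) : ℝ≥0∞) ∂π := by
      refine lintegral_congr_ae ?_
      filter_upwards [E.locFin] with μ hμ
      exact factKernel_box hB φ hμ
    have h2 := iIndepFun.comp (E.indep ι B hB)
      (fun i k => ((k.descFactorial (fib φ i) : ℕ) : ℝ≥0∞)) (fun _ => measurable_from_nat)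
    rw [h1]
    have h3 := lintegral_prod_eq_prod_lintegral_of_indepFun Finset.univ _ h2
      (fun i => measurable_from_nat.comp (measurable_cnt (hB.meas i)))
    simp only [Function.comp_apply] at h3
    rw [h3]
    simp only [E.fact _ (hB.meas _) (hB.bdd _)]
    rw [Finset.prod_mul_distrib, Finset.prod_pow_eq_pow_sum, sum_fib, Fintype.card_fin]
  · exact ENNReal.mul_lt_top (ENNReal.pow_lt_top ENNReal.coe_lt_top) (E.ν_box_lt_top n hB φ)

/-- A rising factorial of length `l + m` is one of length `l` times one of length `m` started at `a
+ c l`; the latter is the weight that `κ` gives after `l` coordinates have fallen into the cell. -/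
theorem bind_ext {n k : ℕ} (hk : k ≤ n) : (ν k).bind (E.ext hk) = ν n := by
  refine Eq.symm (ext_of_box (fun ι _ B hB φ => ?_) fun ι _ B hB φ => E.ν_box_lt_top n hB φ)
  rw [Measure.bind_apply (hB.measurableSet_box φ) (E.ext hk).measurable.aemeasurable,
    E.lintegral_ext_box hk hB, E.ν_box n ι B hB φ, E.ν_box k ι B hB, ← Finset.prod_mul_distrib]
  refine Finset.prod_congr rfl fun i _ => ?_
  rw [← rise_add, fib_head_add_tail]

theorem lintegral_lintegral_tau {n k : ℕ} (hk : k ≤ n) {f : (Fin n → ℝ) → ℝ≥0∞}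
    (hf : Measurable f) :
    ∫⁻ μ, ∫⁻ z, f z ∂(E.tau hk μ) ∂π = (b : ℝ≥0∞) ^ k * ∫⁻ z, f z ∂(ν n) := by
  have hm : Measurable fun x => ∫⁻ z, f z ∂(E.ext hk x) := hf.lintegral_kernel
  simp only [E.lintegral_tau hk _ hf]
  rw [← Measure.lintegral_bind (factKernel k).measurable.aemeasurable hm.aemeasurable,
    E.bind_factKernel k, lintegral_smul_measure, smul_eq_mul,
    ← Measure.lintegral_bind (E.ext hk).measurable.aemeasurable hf.aemeasurable, E.bind_ext hk]

include E in
theorem map_perm (n : ℕ) (s : Equiv.Perm (Fin n)) : (ν n).map (fun x i => x (s i)) = ν n := by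
  have hs : Measurable fun (x : Fin n → ℝ) i => x (s i) :=
    measurable_pi_lambda _ fun i => measurable_pi_apply _
  refine Eq.symm (ext_of_box (fun ι _ B hB φ => ?_) fun ι _ B hB φ => E.ν_box_lt_top n hB φ)
  rw [Measure.map_apply hs (hB.measurableSet_box φ)]
  have : (fun (x : Fin n → ℝ) i => x (s i)) ⁻¹' box B φ = box B fun i => φ (s.symm i) := by
    ext x
    simp only [Set.mem_preimage, mem_box]
    exact ⟨fun h i => by simpa using h (s.symm i), fun h i => by simpa using h (s i)⟩
  rw [this, E.ν_box n ι B hB, E.ν_box n ι B hB]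
  simp only [fib_comp_equiv φ s.symm]

end Ensemble

/-! ### Consistency for locally finite configurations -/

theorem factorialMeasure_zero (μ : Config) :
    factorialMeasure 0 μ.1 = Measure.dirac fun j => j.elim0 := by
  obtain ⟨ι, _, x, rfl⟩ := exists_eq_iota μ
  rw [factorialMeasure_iota]
  ext s hs
  rw [Measure.sum_apply _ hs, tsum_fintype, Fintype.sum_unique]
  congr 2
  exact Subsingleton.elim _ _

theorem lintegral_factorialMeasure_one (μ : Config) {B : Set ℝ} (hB : MeasurableSet B) :
    ∫⁻ x : Fin 1 → ℝ, (cnt B (iota x) : ℝ≥0∞) ∂(factorialMeasure 1 μ.1) = μ.1 B := by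
  have hm : Measurable fun x : Fin 1 → ℝ => (cnt B (iota x) : ℝ≥0∞) :=
    measurable_from_nat.comp ((measurable_cnt hB).comp measurable_iota)
  have h1 : ∀ x : Fin 1 → ℝ, (cnt B (iota x) : ℝ≥0∞) = B.indicator 1 (x 0) := by
    intro x
    rw [natCast_cnt hB ((measure_mono (Set.subset_univ _)).trans_lt (by
      rw [iota_univ]; exact ENNReal.natCast_lt_top _))]
    change Measure.sum _ B = _
    rw [Measure.sum_apply _ hB, tsum_fintype, Fin.sum_univ_one, Measure.dirac_apply' _ hB]
  obtain ⟨ι, _, x, rfl⟩ := exists_eq_iota μ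
  rw [factorialMeasure_iota, lintegral_sum_measure]
  simp only [lintegral_dirac' _ hm]
  simp only [h1]
  change _ = Measure.sum _ B
  rw [Measure.sum_apply _ hB]
  simp only [Measure.dirac_apply' _ hB]
  let e : (Fin 1 ↪ ι) ≃ ι :=
    { toFun := fun e => e 0
      invFun := fun i => ⟨fun _ => i, fun a b _ => Subsingleton.elim a b⟩
      left_inv := fun e => by ext j; rw [Subsingleton.elim j 0]; rfl
      right_inv := fun i => rfl }
  exact e.tsum_eq fun i => B.indicator (1 : ℝ → ℝ≥0∞) (x i)

variable {Ω : Type*} [MeasurableSpace Ω]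

namespace MarkovFamily

variable (X : MarkovFamily Ω)

/-- Consistency is given for finite-valued `F` and `n ≥ 1`. Monotone approximation admits infinite
values, and conservation gives `n = 0`. Local finiteness at both times is needed because
`factKernel` vanishes on all other configurations. -/
theorem lintegral_factKernel (hX : X.IsConservative) (hc : X.IsConsistent) (n : ℕ) (t : ℝ≥0)
    {μ : Config} (hμ : IsLocFin μ) (hμt : ∀ᵐ ω ∂(X.P μ), IsLocFin (X.η t ω))
    {F : Config → ℝ≥0∞} (hF : Measurable F) :
    ∫⁻ ω, ∫⁻ x, F (iota x) ∂(factKernel n (X.η t ω)) ∂(X.P μ) =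
      ∫⁻ x, X.trans t F (iota x) ∂(factKernel n μ) := by
  rcases Nat.eq_zero_or_pos n with rfl | hn
  · have hFi : Measurable fun x : Fin 0 → ℝ => F (iota x) := hF.comp measurable_iota
    have h1 : ∀ᵐ ω ∂(X.P μ), ∫⁻ x : Fin 0 → ℝ, F (iota x) ∂(factKernel 0 (X.η t ω)) =
        F (iota (fun j : Fin 0 => (j.elim0 : ℝ))) := by
      filter_upwards [hμt] with ω hω
      rw [factKernel_apply _ hω, factorialMeasure_zero, lintegral_dirac' _ hFi]
    rw [lintegral_congr_ae h1, lintegral_const, measure_univ, mul_one, factKernel_apply _ hμ,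
      factorialMeasure_zero, lintegral_dirac' _ (X.measurable_trans_iota t 0 hF),
      X.trans_iota_zero hX]
  let Fm : ℕ → Config → ℝ≥0 := fun m μ => (SimpleFunc.eapprox F m μ).toNNReal
  have hFm : ∀ m, Measurable (Fm m) := fun m => (SimpleFunc.measurable _).ennreal_toNNReal
  have hcoe : ∀ m μ, (Fm m μ : ℝ≥0∞) = SimpleFunc.eapprox F m μ := fun m μ =>
    ENNReal.coe_toNNReal (SimpleFunc.eapprox_lt_top F m μ).ne
  have hmono : Monotone fun m (μ : Config) => (Fm m μ : ℝ≥0∞) := by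
    intro m m' h μ
    simp only [hcoe]
    exact SimpleFunc.monotone_eapprox F h μ
  have hsup : ∀ μ, F μ = ⨆ m, (Fm m μ : ℝ≥0∞) := fun μ => by
    simp only [hcoe]
    exact (SimpleFunc.iSup_eapprox_apply hF μ).symm
  have hFm' : ∀ m, Measurable fun μ => (Fm m μ : ℝ≥0∞) := fun m => (hFm m).coe_nnreal_ennreal
  have htrans : ∀ ν, X.trans t F ν = ⨆ m, X.trans t (fun μ => (Fm m μ : ℝ≥0∞)) ν := by
    intro ν
    simp only [trans, hsup]
    exact lintegral_iSup (fun m => (hFm' m).comp (X.measurable_η t))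
      (fun m m' h ω => hmono h (X.η t ω))
  have hinner : ∀ ν : Config, ∫⁻ x, F (iota x) ∂(factKernel n ν) =
      ⨆ m, ∫⁻ x, (Fm m (iota x) : ℝ≥0∞) ∂(factKernel n ν) := by
    intro ν
    simp only [hsup]
    exact lintegral_iSup (fun m => (hFm' m).comp measurable_iota)
      (fun m m' h x => hmono h (iota x))
  have hmeas : ∀ m, Measurable fun ν : Config =>
      ∫⁻ x, (Fm m (iota x) : ℝ≥0∞) ∂(factKernel n ν) := fun m =>
    ((hFm' m).comp measurable_iota).lintegral_kernel
  have hmeas' : ∀ m, Measurable fun ω =>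
      ∫⁻ x, (Fm m (iota x) : ℝ≥0∞) ∂(factKernel n (X.η t ω)) := fun m =>
    (hmeas m).comp (X.measurable_η t)
  simp only [hinner, htrans]
  rw [lintegral_iSup hmeas'
    (fun m m' h ω => lintegral_mono fun x => hmono h (iota x)),
    lintegral_iSup (fun m => X.measurable_trans_iota t n (hFm' m))
    (fun m m' h x => lintegral_mono fun ω => hmono h _)]
  refine iSup_congr fun m => ?_
  rw [factKernel_apply _ hμ]
  refine Eq.trans ?_ (hc μ t (Fm m) n (hFm m) hn)
  refine lintegral_congr_ae ?_
  filter_upwards [hμt] with ω hω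
  rw [factKernel_apply _ hω]

theorem ae_isLocFin_iota (hX : X.IsConservative) (t : ℝ≥0) {n : ℕ} (x : Fin n → ℝ) :
    ∀ᵐ ω ∂(X.P (iota x)), IsLocFin (X.η t ω) := by
  filter_upwards [X.ae_mem_range_iota hX t n x] with ω hω
  obtain ⟨y, hy⟩ := hω
  rw [← hy]
  exact isLocFin_iota y

end MarkovFamily

/-! ### Commutation of the `k`- and `n`-particle dynamics -/

theorem iota_glue {n k : ℕ} (hk : k ≤ n) (x : Fin k → ℝ) (y : Fin (n - k) → ℝ) :
    iota (glue x y : Fin n → ℝ) = iota (Sum.elim x y) := by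
  let e : Fin k ⊕ Fin (n - k) ≃ Fin n := finSumFinEquiv.trans (finCongr (by omega))
  rw [← iota_comp_equiv (glue x y : Fin n → ℝ) e]
  congr 1
  ext j
  rcases j with j | j
  · simp [e, glue]
  · simp [e, glue]

theorem glue_castLE {n k : ℕ} (hk : k ≤ n) (x : Fin k → ℝ) (y : Fin (n - k) → ℝ) :
    (fun j : Fin k => (glue x y : Fin n → ℝ) (Fin.castLE hk j)) = x := by
  ext j
  simp [glue]

theorem exists_perm_castLE {n k : ℕ} (hk : k ≤ n) (e : Fin k ↪ Fin n) :
    ∃ s : Equiv.Perm (Fin n), ∀ j, s (Fin.castLE hk j) = e j := by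
  classical
  let f : {i : Fin n // i ∈ Set.range (Fin.castLE hk)} ≃ {i : Fin n // i ∈ Set.range e} :=
    (Equiv.ofInjective _ (Fin.castLE_injective hk)).symm.trans (Equiv.ofInjective _ e.injective)
  refine ⟨f.extendSubtype, fun j => ?_⟩
  rw [Equiv.extendSubtype_apply_of_mem f _ ⟨j, rfl⟩]
  have : (Equiv.ofInjective _ (Fin.castLE_injective hk)).symm ⟨Fin.castLE hk j, j, rfl⟩ = j := by
    rw [Equiv.symm_apply_eq]; rfl
  simp [f, this]

namespace Ensemble

variable {c : ℕ} {b : ℝ≥0} {α : Measure ℝ}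
  {κ : (k m : ℕ) → (Fin k → ℝ) → Measure (Fin m → ℝ)} {ν : (n : ℕ) → Measure (Fin n → ℝ)}
  {π : Measure Config} (E : Ensemble c b α κ ν π)

theorem κ_perm (E : Ensemble c b α κ ν π) (k m : ℕ) (x : Fin k → ℝ) (s : Equiv.Perm (Fin k)) :
    κ k m (fun i => x (s i)) = κ k m x := by
  have h : ∀ B : Set ℝ, cntVec B (fun i => x (s i)) = cntVec B x := by
    classical
    intro B
    simp only [cntVec, Finset.card_filter]
    exact Equiv.sum_comp s fun i => if x i ∈ B then 1 else 0
  refine ext_of_box (fun ι _ B hB φ => ?_) fun ι _ B hB φ => ?_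
  · rw [E.κ_box k m _ ι B hB, E.κ_box k m _ ι B hB]
    simp only [h]
  · rw [E.κ_box k m _ ι B hB]
    exact ENNReal.prod_lt_top fun i _ => E.rise_lt_top (hB.bdd i) _ _

theorem exists_measurable_lintegral_ext {n k : ℕ} (hk : k ≤ n) {F : Config → ℝ≥0∞}
    (hF : Measurable F) : ∃ H : Config → ℝ≥0∞, Measurable H ∧
      ∀ x : Fin k → ℝ, H (iota x) = ∫⁻ z, F (iota z) ∂(E.ext hk x) := by
  have hFi : Measurable fun z : Fin n → ℝ => F (iota z) := hF.comp measurable_iota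
  refine exists_measurable_comp_iota hFi.lintegral_kernel fun s x => ?_
  rw [E.lintegral_ext hk _ hFi, E.lintegral_ext hk _ hFi, E.κ_perm]
  refine lintegral_congr fun y => ?_
  rw [iota_glue hk, iota_glue hk,
    ← iota_comp_equiv (Sum.elim x y) (Equiv.sumCongr s (Equiv.refl _))]
  congr 2
  ext j
  rcases j with j | j <;> simp

/-- The exhausting sets are the configurations inside `[-R, R]`, enlarged by the null set of
configurations outside the range of `iota`. It is needed to deduce almost everywhere equality from
equality of integrals in `trans_ext`. -/
theorem sigmaFinite_map_iota (E : Ensemble c b α κ ν π) (n : ℕ) :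
    SigmaFinite ((ν n).map iota) := by
  refine ⟨⟨⟨fun R => {μ : Config | μ.1 (Set.Icc (-(R : ℝ)) R)ᶜ = 0} ∪
    (Set.range (iota : (Fin n → ℝ) → Config))ᶜ, fun _ => trivial, fun R => ?_, ?_⟩⟩⟩
  · have hm : MeasurableSet ({μ : Config | μ.1 (Set.Icc (-(R : ℝ)) R)ᶜ = 0} ∪
        (Set.range (iota : (Fin n → ℝ) → Config))ᶜ) :=
      (measurable_config_eval measurableSet_Icc.compl (measurableSet_singleton 0)).union
        (measurableSet_range_iota n).compl
    rw [Measure.map_apply measurable_iota hm]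
    refine (measure_mono ?_).trans_lt (measure_boxSystem_lt_top
      (fun ι _ B hB φ => E.ν_box_lt_top n hB φ) (cube_mem_boxSystem (Fin n) R))
    intro x hx
    rcases hx with hx | hx
    · intro j _
      by_contra hj
      have h1 : (iota x).1 (Set.Icc (-(R : ℝ)) R)ᶜ = 0 := hx
      change Measure.sum _ _ = 0 at h1
      rw [Measure.sum_apply _ measurableSet_Icc.compl, ENNReal.tsum_eq_zero] at h1
      have := h1 j
      rw [Measure.dirac_apply' _ measurableSet_Icc.compl, Set.indicator_of_mem (by exact hj)]
        at this
      simp at this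
    · exact absurd ⟨x, rfl⟩ hx
  · refine Set.eq_univ_of_forall fun μ => Set.mem_iUnion.2 ?_
    by_cases hμ : μ ∈ Set.range (iota : (Fin n → ℝ) → Config)
    · obtain ⟨x, rfl⟩ := hμ
      obtain ⟨R, hR⟩ := exists_mem_cube x
      refine ⟨R, Or.inl ?_⟩
      change Measure.sum _ _ = 0
      rw [Measure.sum_apply _ measurableSet_Icc.compl, ENNReal.tsum_eq_zero]
      intro j
      rw [Measure.dirac_apply' _ measurableSet_Icc.compl, Set.indicator_of_notMem]
      exact fun h => h (hR j trivial)
    · exact ⟨0, Or.inr hμ⟩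

/-- Both `ν n` and `W ∘ iota` are invariant under permutations, so every choice of `k` coordinates
gives the same integral as the first `k`. -/
theorem lintegral_embedding (E : Ensemble c b α κ ν π) {n k : ℕ} (hk : k ≤ n)
    {W : Config → ℝ≥0∞} {V : (Fin k → ℝ) → ℝ≥0∞} (hW : Measurable fun z : Fin n → ℝ => W (iota z))
    (hV : Measurable V) (e : Fin k ↪ Fin n) :
    ∫⁻ z, W (iota z) * V (fun j => z (e j)) ∂(ν n) =
      ∫⁻ z, W (iota z) * V (fun j => z (Fin.castLE hk j)) ∂(ν n) := by
  obtain ⟨s, hs⟩ := exists_perm_castLE hk e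
  have hsm : Measurable fun (x : Fin n → ℝ) i => x (s i) :=
    measurable_pi_lambda _ fun i => measurable_pi_apply _
  have hm : Measurable fun z : Fin n → ℝ => W (iota z) * V fun j => z (Fin.castLE hk j) :=
    hW.mul (hV.comp (measurable_pi_lambda _ fun j => measurable_pi_apply _))
  conv_rhs => rw [← E.map_perm n s]
  rw [lintegral_map hm hsm]
  refine lintegral_congr fun z => ?_
  simp only [hs]
  rw [iota_comp_equiv z s]

/-- This is the disintegration of `ν n` over its first `k` coordinates; the added coordinates do not
affect `V`. -/
theorem lintegral_mul_ext {n k : ℕ} (hk : k ≤ n) {f : (Fin n → ℝ) → ℝ≥0∞}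
    {V : (Fin k → ℝ) → ℝ≥0∞} (hf : Measurable f) (hV : Measurable V) :
    ∫⁻ x, (∫⁻ z, f z ∂(E.ext hk x)) * V x ∂(ν k) =
      ∫⁻ z, f z * V (fun j => z (Fin.castLE hk j)) ∂(ν n) := by
  have hV' : Measurable fun z : Fin n → ℝ => V fun j => z (Fin.castLE hk j) :=
    hV.comp (measurable_pi_lambda _ fun j => measurable_pi_apply _)
  have hm : Measurable fun z : Fin n → ℝ => f z * V fun j => z (Fin.castLE hk j) := hf.mul hV'
  rw [← E.bind_ext hk, Measure.lintegral_bind (E.ext hk).measurable.aemeasurable hm.aemeasurable]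
  refine lintegral_congr fun x => ?_
  have hg : Measurable fun y => f (glue x y) := hf.comp (measurable_glue_right x)
  rw [E.lintegral_ext hk _ hf, ← lintegral_mul_const _ hg,
    E.lintegral_ext hk _ hm]
  simp only [glue_castLE hk x]

variable (X : MarkovFamily Ω)

/-- Both sides are tested against a function `G` of the first `k` particles. On the left,
reversibility of `ν k` puts the semigroup on `G`; then both integrals are integrals with respect to
`ν n`, one with `F` and `P_t G`, the other with `P_t F` and `G`. They agree by reversibility of `ν
n`, since consistency says that evolving `n` particles and then choosing `k` of them is the same as
evolving `k` chosen ones. -/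
theorem trans_ext (hX : X.IsConservative) (hc : X.IsConsistent)
    (hrev : ∀ n, 1 ≤ n → X.IsReversible ((ν n).map iota)) {n k : ℕ} (hk : k ≤ n) (t : ℝ≥0)
    {F H : Config → ℝ≥0∞} (hF : Measurable F) (hH : Measurable H)
    (hHF : ∀ x : Fin k → ℝ, H (iota x) = ∫⁻ z, F (iota z) ∂(E.ext hk x)) :
    ∀ᵐ x ∂(ν k), X.trans t H (iota x) = ∫⁻ z, X.trans t F (iota z) ∂(E.ext hk x) := by
  have hFi : Measurable fun z : Fin n → ℝ => F (iota z) := hF.comp measurable_iota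
  have htF := X.measurable_trans_iota t n hF
  obtain ⟨F', hF', hFF'⟩ := exists_measurable_comp_iota htF fun s x => by
    rw [iota_comp_equiv x s]
  obtain ⟨U, hU, hUH⟩ := exists_measurable_comp_iota (X.measurable_trans_iota t k hH)
    fun s x => by rw [iota_comp_equiv x s]
  obtain ⟨V, hV, hVF⟩ := E.exists_measurable_lintegral_ext hk hF'
  simp only [hFF'] at hVF
  have key : ∀ G : Config → ℝ≥0∞, Measurable G →
      ∫⁻ x, U (iota x) * G (iota x) ∂(ν k) = ∫⁻ x, V (iota x) * G (iota x) ∂(ν k) := by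
    intro G hG
    have hGi : Measurable fun x : Fin k → ℝ => G (iota x) := hG.comp measurable_iota
    have htG := X.measurable_trans_iota t k hG
    have h1 : ∫⁻ x, U (iota x) * G (iota x) ∂(ν k) =
        ∫⁻ z, F (iota z) * X.trans t G (iota fun j => z (Fin.castLE hk j)) ∂(ν n) := by
      simp only [hUH]
      rw [X.lintegral_trans_mul hX (ν k) (hrev k) t hH hG]
      simp only [hHF]
      exact E.lintegral_mul_ext hk hFi htG
    have h2 : ∫⁻ x, V (iota x) * G (iota x) ∂(ν k) =
        ∫⁻ z, X.trans t F (iota z) * G (iota fun j => z (Fin.castLE hk j)) ∂(ν n) := by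
      simp only [hVF]
      exact E.lintegral_mul_ext hk htF hGi
    rw [h1, h2]
    -- Reversibility for `n` particles only accepts functions of the unlabeled configuration, so `G`
    -- is summed over all ordered choices of `k` particles. By symmetry all summands have equal
    -- integrals, and their number, which is finite and nonzero, is cancelled at the end.
    let G' : Config → ℝ≥0∞ := fun μ => ∫⁻ x, G (iota x) ∂(factKernel k μ)
    have hG' : Measurable G' := hGi.lintegral_kernel
    have hG'i : ∀ z : Fin n → ℝ, G' (iota z) = ∑ e : Fin k ↪ Fin n, G (iota fun j => z (e j)) := by
      intro z
      simp only [G']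
      rw [factKernel_apply _ (isLocFin_iota z), lintegral_factorialMeasure_iota z hGi]
    have htG'i : ∀ z : Fin n → ℝ, X.trans t G' (iota z) =
        ∑ e : Fin k ↪ Fin n, X.trans t G (iota fun j => z (e j)) := by
      intro z
      refine (X.lintegral_factKernel hX hc k t (isLocFin_iota z)
        (X.ae_isLocFin_iota hX t z) hG).trans ?_
      rw [factKernel_apply _ (isLocFin_iota z), lintegral_factorialMeasure_iota z htG]
    have h3 := X.lintegral_trans_mul hX (ν n) (hrev n) t hF hG'
    simp only [hG'i, htG'i, Finset.mul_sum] at h3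
    have hme : ∀ e : Fin k ↪ Fin n, Measurable fun (z : Fin n → ℝ) (j : Fin k) => z (e j) :=
      fun e => measurable_pi_lambda _ fun j => measurable_pi_apply _
    have hm1 : ∀ e : Fin k ↪ Fin n, Measurable fun z : Fin n → ℝ =>
        X.trans t F (iota z) * G (iota fun j => z (e j)) := fun e => htF.mul (hGi.comp (hme e))
    have hm2 : ∀ e : Fin k ↪ Fin n, Measurable fun z : Fin n → ℝ =>
        F (iota z) * X.trans t G (iota fun j => z (e j)) := fun e => hFi.mul (htG.comp (hme e))
    rw [lintegral_finsetSum _ fun e _ => hm1 e, lintegral_finsetSum _ fun e _ => hm2 e] at h3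
    simp only [E.lintegral_embedding hk htF hGi, E.lintegral_embedding hk hFi htG,
      Finset.sum_const, nsmul_eq_mul] at h3
    have hne : ((Finset.univ : Finset (Fin k ↪ Fin n)).card : ℝ≥0∞) ≠ 0 := by
      rw [Finset.card_univ, Fintype.card_embedding_eq, Fintype.card_fin, Fintype.card_fin]
      exact_mod_cast (Nat.descFactorial_pos.2 hk).ne'
    exact ((ENNReal.mul_right_inj hne (ENNReal.natCast_ne_top _)).1 h3).symm
  have := E.sigmaFinite_map_iota k
  have hae : U =ᵐ[(ν k).map iota] V := by
    refine ae_eq_of_forall_setLIntegral_eq_of_sigmaFinite hU hV fun s hs _ => ?_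
    rw [← lintegral_indicator hs, ← lintegral_indicator hs,
      lintegral_map (hU.indicator hs) measurable_iota,
      lintegral_map (hV.indicator hs) measurable_iota]
    have h1 : ∀ (W : Config → ℝ≥0∞) x, s.indicator W x = W x * s.indicator (fun _ => 1) x := by
      intro W x
      by_cases hx : x ∈ s <;> simp [hx]
    rw [lintegral_congr fun x => h1 U (iota x), lintegral_congr fun x => h1 V (iota x)]
    exact key _ (measurable_const.indicator hs)
  have := ae_of_ae_map measurable_iota.aemeasurable hae
  filter_upwards [this] with x hx
  rw [← hUH, hx, hVF]

/-- By consistency and invariance for a single particle, the mean number of particles in `[-R, R]`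
at time `t`, averaged over the initial law, is `b` times the `ν 1`-mass of the interval, hence
finite. -/
theorem ae_isLocFin (E : Ensemble c b α κ ν π) (hX : X.IsConservative) (hc : X.IsConsistent)
    (hrev : ∀ n, 1 ≤ n → X.IsReversible ((ν n).map iota)) (t : ℝ≥0) :
    ∀ᵐ μ ∂π, IsLocFin μ ∧ ∀ᵐ ω ∂(X.P μ), IsLocFin (X.η t ω) := by
  have key : ∀ R : ℕ, ∀ᵐ μ ∂π, IsLocFin μ ∧
      ∀ᵐ ω ∂(X.P μ), (X.η t ω).1 (Set.Icc (-(R : ℝ)) R) < ∞ := by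
    intro R
    set B := Set.Icc (-(R : ℝ)) R
    have hB : MeasurableSet B := measurableSet_Icc
    let F : Config → ℝ≥0 := fun μ => (cnt B μ : ℝ≥0)
    have hF : Measurable F := measurable_from_nat.comp (measurable_cnt hB)
    have hF' : Measurable fun μ => (F μ : ℝ≥0∞) := hF.coe_nnreal_ennreal
    have htF := X.measurable_trans_iota t 1 hF'
    have h1 : ∫⁻ μ, ∫⁻ x, X.trans t (fun μ => (F μ : ℝ≥0∞)) (iota x) ∂(factKernel 1 μ) ∂π < ∞ := by
      rw [← Measure.lintegral_bind (factKernel 1).measurable.aemeasurable htF.aemeasurable,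
        E.bind_factKernel 1, lintegral_smul_measure, X.lintegral_trans hX (ν 1) (hrev 1) t hF',
        smul_eq_mul]
      refine ENNReal.mul_lt_top (ENNReal.pow_lt_top ENNReal.coe_lt_top) ?_
      have h2 := E.bind_factKernel 1
      have h3 : ∫⁻ x : Fin 1 → ℝ, (F (iota x) : ℝ≥0∞) ∂(ν 1) = ν 1 (cube (Fin 1) R) := by
        rw [← lintegral_indicator_one (measurableSet_cube _ R)]
        refine lintegral_congr fun x => ?_
        have := lintegral_factorialMeasure_one (iota x) hB
        rw [lintegral_factorialMeasure_iota] at this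
        · have h4 : (cnt B (iota x) : ℝ≥0∞) = (iota x).1 B := natCast_cnt hB
            ((isLocFin_iota x) R)
          simp only [F, ENNReal.coe_natCast]
          rw [h4]
          change Measure.sum _ B = _
          rw [Measure.sum_apply _ hB, tsum_fintype, Fin.sum_univ_one, Measure.dirac_apply' _ hB]
          by_cases hx : x 0 ∈ B
          · rw [Set.indicator_of_mem hx, Set.indicator_of_mem]
            · rfl
            · intro j _; rw [Subsingleton.elim j 0]; exact hx
          · rw [Set.indicator_of_notMem hx, Set.indicator_of_notMem]
            exact fun h => hx (h 0 trivial)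
        · exact measurable_from_nat.comp ((measurable_cnt hB).comp measurable_iota)
      rw [h3]
      exact measure_boxSystem_lt_top (fun ι _ B hB φ => E.ν_box_lt_top 1 hB φ)
        (cube_mem_boxSystem _ R)
    filter_upwards [E.locFin, ae_lt_top htF.lintegral_kernel h1.ne] with μ hμ hfin
    refine ⟨hμ, ?_⟩
    have h5 := hc μ t F 1 hF le_rfl
    rw [← factKernel_apply 1 hμ] at h5
    have h6 : ∫⁻ ω, (X.η t ω).1 B ∂(X.P μ) < ∞ := by
      refine lt_of_eq_of_lt ?_ hfin
      rw [← lintegral_congr fun ω => lintegral_factorialMeasure_one (X.η t ω) hB]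
      simpa [F, MarkovFamily.trans] using h5
    exact ae_lt_top ((measurable_config_eval hB).comp (X.measurable_η t)) h6.ne
  filter_upwards [E.locFin, ae_all_iff.2 key] with μ hμ h
  exact ⟨hμ, by filter_upwards [ae_all_iff.2 fun R => (h R).2] with ω hω using hω⟩

/-- Consistency moves the semigroup inside the integral over `μ^(k)`, and `trans_ext` moves it
through the added coordinates. The exceptional `ν k`-null set in `trans_ext` is harmless: the mean
of `μ^(k)` under `π` is `b ^ k ν k`, so the set is `μ^(k)`-null for almost every `μ`. -/
theorem lintegral_trans_tau (hX : X.IsConservative) (hc : X.IsConsistent)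
    (hrev : ∀ n, 1 ≤ n → X.IsReversible ((ν n).map iota)) {n k : ℕ} (hk : k ≤ n) (t : ℝ≥0)
    {F : Config → ℝ≥0∞} (hF : Measurable F) :
    ∀ᵐ μ ∂π, ∫⁻ ω, ∫⁻ z, F (iota z) ∂(E.tau hk (X.η t ω)) ∂(X.P μ) =
      ∫⁻ z, X.trans t F (iota z) ∂(E.tau hk μ) := by
  obtain ⟨H, hH, hHF⟩ := E.exists_measurable_lintegral_ext hk hF
  have h1 := E.trans_ext X hX hc hrev hk t hF hH hHF
  have h2 : ∀ᵐ x ∂(π.bind (factKernel k)),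
      X.trans t H (iota x) = ∫⁻ z, X.trans t F (iota z) ∂(E.ext hk x) := by
    rw [E.bind_factKernel k]
    exact Measure.ae_smul_measure h1 _
  have hFi : Measurable fun z : Fin n → ℝ => F (iota z) := hF.comp measurable_iota
  filter_upwards [Measure.ae_ae_of_ae_comp h2, E.ae_isLocFin X hX hc hrev t] with μ hμ hlf
  rw [E.lintegral_tau hk μ (X.measurable_trans_iota t n hF), ← lintegral_congr_ae hμ,
    ← X.lintegral_factKernel hX hc k t hlf.1 hlf.2 hH]
  simp only [E.lintegral_tau hk _ hFi, hHF]

end Ensemble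

/-! ### Point processes that are determined by their factorial moments -/

/-- The weighted number of particles in the cells. -/
def wcnt {ι : Type} [Fintype ι] (a : ι → ℝ≥0) (B : ι → Set ℝ) (μ : Config) : ℝ≥0 :=
  ∑ i, a i * cnt (B i) μ

theorem measurable_wcnt {ι : Type} [Fintype ι] (a : ι → ℝ≥0) {B : ι → Set ℝ} (hB : IsCell B) :
    Measurable (wcnt a B) :=
  Finset.measurable_sum _ fun i _ =>
    measurable_const.mul (measurable_from_nat.comp (measurable_cnt (hB.meas i)))

/-- The product of the falling factorials of the numbers of particles in the cells. -/
def fallCnt {ι : Type} [Fintype ι] (B : ι → Set ℝ) (k : ι → ℕ) (μ : Config) : ℝ≥0∞ :=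
  ∏ i, ((cnt (B i) μ).descFactorial (k i) : ℝ≥0∞)

theorem measurable_fallCnt {ι : Type} [Fintype ι] {B : ι → Set ℝ} (hB : IsCell B) (k : ι → ℕ) :
    Measurable (fallCnt B k) :=
  Finset.measurable_prod _ fun i _ =>
    (measurable_from_nat (f := fun m => ((m.descFactorial (k i) : ℕ) : ℝ≥0∞))).comp
      (measurable_cnt (hB.meas i))

theorem fib_cons {ι : Type} [DecidableEq ι] {n : ℕ} (φ : Fin n → ι) (i : ι) :
    fib (Fin.cons i φ : Fin (n + 1) → ι) = Function.update (fib φ) i (fib φ i + 1) := by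
  ext j
  rw [fib_eq_sum, Fin.sum_univ_succ]
  simp only [Fin.cons_zero, Fin.cons_succ]
  rw [← fib_eq_sum]
  by_cases h : j = i
  · subst h; simp [add_comm]
  · rw [Function.update_of_ne h, if_neg (Ne.symm h), zero_add]

theorem cnt_mul_fallCnt {ι : Type} [Fintype ι] [DecidableEq ι] (B : ι → Set ℝ) (k : ι → ℕ) (i : ι)
    (μ : Config) : (cnt (B i) μ : ℝ≥0∞) * fallCnt B k μ =
      fallCnt B (Function.update k i (k i + 1)) μ + k i * fallCnt B k μ := by
  have h1 : ∀ l : ℕ, fallCnt B (Function.update k i l) μ =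
      ((cnt (B i) μ).descFactorial l : ℝ≥0∞) *
        ∏ j ∈ Finset.univ.erase i, ((cnt (B j) μ).descFactorial (k j) : ℝ≥0∞) := by
    intro l
    rw [fallCnt, ← Finset.mul_prod_erase _ _ (Finset.mem_univ i), Function.update_self]
    congr 1
    refine Finset.prod_congr rfl fun j hj => ?_
    rw [Function.update_of_ne (Finset.ne_of_mem_erase hj)]
  have h2 : fallCnt B k μ = fallCnt B (Function.update k i (k i)) μ := by
    rw [Function.update_eq_self]
  rw [h2, h1, h1, ← mul_assoc, ← mul_assoc, ← add_mul]
  congr 1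
  have h3 : ∀ N l : ℕ, N * N.descFactorial l = N.descFactorial (l + 1) + l * N.descFactorial l := by
    intro N l
    rw [Nat.descFactorial_succ, ← add_mul]
    rcases le_or_gt l N with h | h
    · rw [Nat.sub_add_cancel h]
    · rw [Nat.descFactorial_eq_zero_iff_lt.2 h]; simp
  exact_mod_cast h3 _ _

/-- Power moments are expanded into factorial moments: by `N (N)_l = (N)_{l+1} + l (N)_l`, one more
factor `wcnt` becomes a combination of falling factorials in which one exponent is raised by at most
one. Carrying along an arbitrary `fallCnt` factor makes the induction close. -/
theorem lintegral_wcnt_pow_mul {Q Q' : Measure Config} {ι : Type} [Fintype ι] {B : ι → Set ℝ}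
    (hB : IsCell B)
    (h : ∀ (n : ℕ) (φ : Fin n → ι), ∫⁻ μ, fallCnt B (fib φ) μ ∂Q = ∫⁻ μ, fallCnt B (fib φ) μ ∂Q')
    (a : ι → ℝ≥0) (m : ℕ) : ∀ (n : ℕ) (φ : Fin n → ι),
      ∫⁻ μ, (wcnt a B μ : ℝ≥0∞) ^ m * fallCnt B (fib φ) μ ∂Q =
        ∫⁻ μ, (wcnt a B μ : ℝ≥0∞) ^ m * fallCnt B (fib φ) μ ∂Q' := by
  classical
  induction m with
  | zero => simpa using h
  | succ m ih =>
    intro n φ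
    have hw : Measurable fun μ => (wcnt a B μ : ℝ≥0∞) ^ m :=
      (measurable_wcnt a hB).coe_nnreal_ennreal.pow_const m
    have key : ∀ P : Measure Config,
        ∫⁻ μ, (wcnt a B μ : ℝ≥0∞) ^ (m + 1) * fallCnt B (fib φ) μ ∂P =
        ∑ i, a i * (∫⁻ μ, (wcnt a B μ : ℝ≥0∞) ^ m *
            fallCnt B (fib (Fin.cons i φ : Fin (n + 1) → ι)) μ ∂P +
          fib φ i * ∫⁻ μ, (wcnt a B μ : ℝ≥0∞) ^ m * fallCnt B (fib φ) μ ∂P) := by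
      intro P
      have h1 : ∀ μ, (wcnt a B μ : ℝ≥0∞) ^ (m + 1) * fallCnt B (fib φ) μ =
          ∑ i, a i * ((wcnt a B μ : ℝ≥0∞) ^ m *
            fallCnt B (fib (Fin.cons i φ : Fin (n + 1) → ι)) μ +
          fib φ i * ((wcnt a B μ : ℝ≥0∞) ^ m * fallCnt B (fib φ) μ)) := by
        intro μ
        have : (wcnt a B μ : ℝ≥0∞) = ∑ i, a i * (cnt (B i) μ : ℝ≥0∞) := by
          simp [wcnt]
        rw [pow_succ, mul_assoc, this, Finset.sum_mul, Finset.mul_sum]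
        refine Finset.sum_congr rfl fun i _ => ?_
        rw [mul_assoc, cnt_mul_fallCnt, fib_cons]
        ring
      simp only [h1]
      have hm1 : ∀ i, Measurable fun μ => (wcnt a B μ : ℝ≥0∞) ^ m *
            fallCnt B (fib (Fin.cons i φ : Fin (n + 1) → ι)) μ := fun i =>
        hw.mul (measurable_fallCnt hB _)
      have hm2 : Measurable fun μ => (wcnt a B μ : ℝ≥0∞) ^ m * fallCnt B (fib φ) μ :=
        hw.mul (measurable_fallCnt hB _)
      have hm3 : ∀ i, Measurable fun μ => (wcnt a B μ : ℝ≥0∞) ^ m *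
            fallCnt B (fib (Fin.cons i φ : Fin (n + 1) → ι)) μ +
          fib φ i * ((wcnt a B μ : ℝ≥0∞) ^ m * fallCnt B (fib φ) μ) := fun i =>
        (hm1 i).add (hm2.const_mul _)
      rw [lintegral_finsetSum _ fun i _ => (hm3 i).const_mul _]
      refine Finset.sum_congr rfl fun i _ => ?_
      rw [lintegral_const_mul _ (hm3 i), lintegral_add_left (hm1 i),
        lintegral_const_mul _ hm2]
    rw [key, key]
    simp only [ih]

theorem lintegral_exp_wcnt {Q Q' : Measure Config} {ι : Type} [Fintype ι] {B : ι → Set ℝ}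
    (hB : IsCell B)
    (h : ∀ (n : ℕ) (φ : Fin n → ι), ∫⁻ μ, fallCnt B (fib φ) μ ∂Q = ∫⁻ μ, fallCnt B (fib φ) μ ∂Q')
    (a : ι → ℝ≥0) {t : ℝ} (ht : 0 ≤ t) :
    ∫⁻ μ, ENNReal.ofReal (Real.exp (t * wcnt a B μ)) ∂Q =
      ∫⁻ μ, ENNReal.ofReal (Real.exp (t * wcnt a B μ)) ∂Q' := by
  have hw : ∀ m : ℕ, Measurable fun μ => (wcnt a B μ : ℝ≥0∞) ^ m := fun m =>
    (measurable_wcnt a hB).coe_nnreal_ennreal.pow_const m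
  have key : ∀ P : Measure Config, ∫⁻ μ, ENNReal.ofReal (Real.exp (t * wcnt a B μ)) ∂P =
      ∑' m : ℕ, ENNReal.ofReal (t ^ m / m.factorial) * ∫⁻ μ, (wcnt a B μ : ℝ≥0∞) ^ m ∂P := by
    intro P
    have h1 : ∀ μ, ENNReal.ofReal (Real.exp (t * wcnt a B μ)) =
        ∑' m : ℕ, ENNReal.ofReal (t ^ m / m.factorial) * (wcnt a B μ : ℝ≥0∞) ^ m := by
      intro μ
      have hs := NormedSpace.expSeries_div_hasSum_exp (𝔸 := ℝ) (t * wcnt a B μ)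
      rw [← Real.exp_eq_exp_ℝ] at hs
      rw [← hs.tsum_eq, ENNReal.ofReal_tsum_of_nonneg (fun m => by positivity) hs.summable]
      refine tsum_congr fun m => ?_
      have : ((wcnt a B μ : ℝ≥0) : ℝ≥0∞) = ENNReal.ofReal (wcnt a B μ : ℝ) :=
        (ENNReal.ofReal_coe_nnreal).symm
      rw [this, ← ENNReal.ofReal_pow (by positivity), ← ENNReal.ofReal_mul (by positivity)]
      congr 1
      ring
    simp only [h1]
    rw [lintegral_tsum fun m => ((hw m).const_mul _).aemeasurable]
    refine tsum_congr fun m => ?_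
    rw [lintegral_const_mul _ (hw m)]
  rw [key, key]
  refine tsum_congr fun m => ?_
  have := lintegral_wcnt_pow_mul hB h a m 0 Fin.elim0
  have h0 : ∀ μ, fallCnt B (fib (Fin.elim0 : Fin 0 → ι)) μ = 1 := by
    intro μ
    simp [fallCnt, fib]
  simp only [h0, mul_one] at this
  rw [this]

/-- The moment generating functions agree for nonnegative arguments. The variable is nonnegative
with a finite exponential moment at `t`, so both complex moment generating functions are analytic
for `Re z < t`. They coincide on real points near `t / 2`, hence on the half-plane, and in
particular on the imaginary axis, where they are the characteristic functions. -/
theorem map_wcnt_eq {Q Q' : Measure Config} [IsProbabilityMeasure Q] [IsProbabilityMeasure Q']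
    {ι : Type} [Fintype ι] {B : ι → Set ℝ} (hB : IsCell B)
    (h : ∀ (n : ℕ) (φ : Fin n → ι), ∫⁻ μ, fallCnt B (fib φ) μ ∂Q = ∫⁻ μ, fallCnt B (fib φ) μ ∂Q')
    (a : ι → ℝ≥0)
    (hexp : ∃ t : ℝ, 0 < t ∧ ∫⁻ μ, ENNReal.ofReal (Real.exp (t * wcnt a B μ)) ∂Q' < ∞) :
    Q.map (fun μ => (wcnt a B μ : ℝ)) = Q'.map (fun μ => (wcnt a B μ : ℝ)) := by
  obtain ⟨t, ht, hfin⟩ := hexp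
  set Y : Config → ℝ := fun μ => (wcnt a B μ : ℝ) with hY
  have hYm : Measurable Y := (measurable_wcnt a hB).coe_nnreal_real
  have hY0 : ∀ μ, 0 ≤ Y μ := fun μ => NNReal.coe_nonneg _
  have hint : ∀ P : Measure Config, [IsProbabilityMeasure P] →
      ∫⁻ μ, ENNReal.ofReal (Real.exp (t * Y μ)) ∂P < ∞ → ∀ s < t, s ∈ integrableExpSet Y P := by
    intro P _ hP s hs
    have hme : ∀ s : ℝ, AEStronglyMeasurable (fun μ => Real.exp (s * Y μ)) P := fun s =>
      (Real.measurable_exp.comp (hYm.const_mul s)).aestronglyMeasurable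
    have h1 : Integrable (fun μ => Real.exp (t * Y μ)) P := by
      refine ⟨hme t, ?_⟩
      rw [hasFiniteIntegral_iff_ofReal (Eventually.of_forall fun μ => (Real.exp_pos _).le)]
      exact hP
    refine Integrable.mono' h1 (hme s) (Eventually.of_forall fun μ => ?_)
    rw [Real.norm_eq_abs, abs_of_pos (Real.exp_pos _)]
    exact Real.exp_le_exp.2 (mul_le_mul_of_nonneg_right hs.le (hY0 μ))
  have hsub : ∀ P : Measure Config, [IsProbabilityMeasure P] →
      ∫⁻ μ, ENNReal.ofReal (Real.exp (t * Y μ)) ∂P < ∞ →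
      {z : ℂ | z.re < t} ⊆ {z | z.re ∈ interior (integrableExpSet Y P)} := by
    intro P _ hP z hz
    exact interior_maximal (fun s hs => hint P hP s hs) isOpen_Iio hz
  have hfinQ : ∫⁻ μ, ENNReal.ofReal (Real.exp (t * Y μ)) ∂Q < ∞ := by
    rw [lintegral_exp_wcnt hB h a ht.le]; exact hfin
  have hmgf : ∀ s, 0 ≤ s → mgf Y Q s = mgf Y Q' s := by
    intro s hs
    have hme : ∀ P : Measure Config, AEStronglyMeasurable (fun μ => Real.exp (s * Y μ)) P :=
      fun P => (Real.measurable_exp.comp (hYm.const_mul s)).aestronglyMeasurable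
    rw [mgf, mgf, integral_eq_lintegral_of_nonneg_ae
      (Eventually.of_forall fun μ => (Real.exp_pos _).le) (hme Q),
      integral_eq_lintegral_of_nonneg_ae
      (Eventually.of_forall fun μ => (Real.exp_pos _).le) (hme Q'),
      lintegral_exp_wcnt hB h a hs]
  have heq : Set.EqOn (complexMGF Y Q) (complexMGF Y Q') {z : ℂ | z.re < t} := by
    refine AnalyticOnNhd.eqOn_of_preconnected_of_frequently_eq
      (analyticOnNhd_complexMGF.mono (hsub Q hfinQ))
      (analyticOnNhd_complexMGF.mono (hsub Q' hfin))
      ((convex_Iio t).linear_preimage Complex.reLm).isPreconnected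
      (z₀ := ((t / 2 : ℝ) : ℂ)) (by simp [ht]) ?_
    have h_real : ∃ᶠ x : ℝ in nhdsWithin (t / 2) {t / 2}ᶜ,
        complexMGF Y Q x = complexMGF Y Q' x := by
      refine Eventually.frequently ?_
      filter_upwards [mem_nhdsWithin_of_mem_nhds (Ioi_mem_nhds (half_pos ht))] with x hx
      rw [complexMGF_ofReal, complexMGF_ofReal, hmgf x (le_of_lt hx)]
    rw [frequently_iff_seq_forall] at h_real ⊢
    obtain ⟨xs, hx, hxe⟩ := h_real
    refine ⟨fun n => xs n, ?_, fun n => hxe n⟩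
    rw [tendsto_nhdsWithin_iff] at hx ⊢
    refine ⟨(Complex.continuous_ofReal.tendsto _).comp hx.1, ?_⟩
    filter_upwards [hx.2] with n hn h0
    exact hn (Set.mem_singleton_iff.2 (Complex.ofReal_injective (Set.mem_singleton_iff.1 h0)))
  have := Measure.isProbabilityMeasure_map (μ := Q) hYm.aemeasurable
  have := Measure.isProbabilityMeasure_map (μ := Q') hYm.aemeasurable
  refine Measure.ext_of_charFun (funext fun s => ?_)
  rw [← complexMGF_mul_I hYm.aemeasurable, ← complexMGF_mul_I hYm.aemeasurable]
  exact heq (by simp [ht])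

/-- Logarithms of distinct primes serve as weights: the weighted sum is the logarithm of `∏ p_i ^
n_i`, and factorization into primes is unique. -/
theorem exists_weights (ι : Type) [Fintype ι] : ∃ a : ι → ℝ≥0,
    Function.Injective fun n : ι → ℕ => ∑ i, a i * (n i : ℝ≥0) := by
  classical
  let e := Fintype.equivFin ι
  let p : ι → ℕ := fun i => Nat.nth Nat.Prime (e i)
  have hp : ∀ i, (p i).Prime := fun i => Nat.prime_nth_prime _
  have hpi : Function.Injective p := fun i j h => e.injective (Fin.ext
    ((Nat.nth_injective Nat.infinite_setOfPred_prime) h))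
  refine ⟨fun i => Real.toNNReal (Real.log (p i)), fun n m h => ?_⟩
  have hlog : ∀ n : ι → ℕ, ((∑ i, Real.toNNReal (Real.log (p i)) * (n i : ℝ≥0) : ℝ≥0) : ℝ) =
      Real.log ((∏ i, p i ^ n i : ℕ) : ℝ) := by
    intro n
    push_cast
    rw [Real.log_prod fun i _ => by
      have := (hp i).pos
      positivity]
    refine Finset.sum_congr rfl fun i _ => ?_
    rw [Real.log_pow, Real.coe_toNNReal _ (Real.log_natCast_nonneg _), mul_comm]
  have h1 := congrArg (fun x : ℝ≥0 => (x : ℝ)) h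
  simp only [hlog] at h1
  have hpos : ∀ n : ι → ℕ, 0 < ∏ i, p i ^ n i := fun n =>
    Finset.prod_pos fun i _ => pow_pos (hp i).pos _
  have h2 : (∏ i, p i ^ n i) = ∏ i, p i ^ m i := by
    have := Real.log_injOn_pos (Set.mem_Ioi.2 (by exact_mod_cast hpos n))
      (Set.mem_Ioi.2 (by exact_mod_cast hpos m)) h1
    exact_mod_cast this
  have hf : ∀ (n : ι → ℕ) j, (∏ i, p i ^ n i).factorization (p j) = n j := by
    intro n j
    rw [Nat.factorization_prod fun i _ => (pow_pos (hp i).pos _).ne']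
    rw [Finsupp.finsetSum_apply, Finset.sum_eq_single j]
    · rw [(hp j).factorization_pow]; simp
    · intro i _ hij
      rw [(hp i).factorization_pow, Finsupp.single_apply, if_neg fun h => hij (hpi h)]
    · simp
  ext j
  rw [← hf n j, h2, hf m j]

/-- With injective weights a single real variable encodes the whole vector of counts, so the
one-dimensional moment problem suffices. -/
theorem map_cnt_eq {Q Q' : Measure Config} [IsProbabilityMeasure Q] [IsProbabilityMeasure Q']
    {ι : Type} [Fintype ι] {B : ι → Set ℝ} (hB : IsCell B)
    (h : ∀ (n : ℕ) (φ : Fin n → ι), ∫⁻ μ, fallCnt B (fib φ) μ ∂Q = ∫⁻ μ, fallCnt B (fib φ) μ ∂Q')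
    (hexp : ∀ a : ι → ℝ≥0,
      ∃ t : ℝ, 0 < t ∧ ∫⁻ μ, ENNReal.ofReal (Real.exp (t * wcnt a B μ)) ∂Q' < ∞) :
    Q.map (fun μ i => cnt (B i) μ) = Q'.map (fun μ i => cnt (B i) μ) := by
  obtain ⟨a, ha⟩ := exists_weights ι
  have hm : Measurable fun (μ : Config) i => cnt (B i) μ :=
    measurable_pi_lambda _ fun i => measurable_cnt (hB.meas i)
  have hw := map_wcnt_eq hB h a (hexp a)
  have hYm : Measurable fun μ => (wcnt a B μ : ℝ) := (measurable_wcnt a hB).coe_nnreal_real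
  refine Measure.ext_of_singleton fun n => ?_
  have hs : MeasurableSet ({n} : Set (ι → ℕ)) := measurableSet_singleton n
  rw [Measure.map_apply hm hs, Measure.map_apply hm hs]
  have : (fun (μ : Config) i => cnt (B i) μ) ⁻¹' {n} =
      (fun μ => (wcnt a B μ : ℝ)) ⁻¹' {((∑ i, a i * (n i : ℝ≥0) : ℝ≥0) : ℝ)} := by
    ext μ
    simp only [Set.mem_preimage, Set.mem_singleton_iff, NNReal.coe_inj, wcnt]
    exact ⟨fun h => by rw [← h], fun h => ha h⟩
  rw [this, ← Measure.map_apply hYm (measurableSet_singleton _), hw,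
    Measure.map_apply hYm (measurableSet_singleton _)]

/-- Laws of point processes are equal if the joint distributions of the particle counts are. -/
theorem config_ext {Q Q' : Measure Config} [IsProbabilityMeasure Q] [IsProbabilityMeasure Q']
    (hQ : ∀ᵐ μ ∂Q, IsLocFin μ) (hQ' : ∀ᵐ μ ∂Q', IsLocFin μ)
    (h : ∀ (ι : Type) [Fintype ι] (B : ι → Set ℝ), IsCell B →
      Q.map (fun μ i => cnt (B i) μ) = Q'.map (fun μ i => cnt (B i) μ)) : Q = Q' := by
  classical
  let S := {A : Set ℝ // MeasurableSet A ∧ Bornology.IsBounded A}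
  let Φ : Config → S → ℝ≥0∞ := fun μ A => μ.1 A.1
  have hΦ : Measurable Φ := measurable_pi_lambda _ fun A => measurable_config_eval A.2.1
  -- Almost surely, the masses of finitely many bounded sets are sums of counts of the disjoint
  -- atoms that these sets generate.
  have hmarg : ∀ I : Finset S, (Q.map Φ).map I.restrict = (Q'.map Φ).map I.restrict := by
    intro I
    let A : I → Set ℝ := fun i => i.1.1
    have hc : IsCell (atom A) := isCell_atom (fun i => i.1.2.1) fun i => i.1.2.2
    let g : ({T : Finset I // T.Nonempty} → ℕ) → I → ℝ≥0∞ := fun n i =>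
      ∑ T, if i ∈ T.1 then (n T : ℝ≥0∞) else 0
    have hg : Measurable g := Measurable.of_discrete
    have hm : Measurable fun (μ : Config) T => cnt (atom A T) μ :=
      measurable_pi_lambda _ fun T => measurable_cnt (hc.meas T)
    have key : ∀ μ, IsLocFin μ → (I.restrict ∘ Φ) μ = (g ∘ fun μ T => cnt (atom A T) μ) μ := by
      intro μ hμ
      ext i
      change μ.1 (A i) = ∑ T, if i ∈ T.1 then (cnt (atom A T) μ : ℝ≥0∞) else 0
      have hA : A i = ⋃ T ∈ Finset.univ.filter
          (fun T : {T : Finset I // T.Nonempty} => i ∈ T.1), atom A T := by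
        ext x
        simp only [Finset.mem_filter, Finset.mem_univ, true_and, Set.mem_iUnion, exists_prop]
        constructor
        · intro hx
          exact ⟨⟨Finset.univ.filter fun j => x ∈ A j, i, by simpa using hx⟩, by simpa using hx,
            fun j => by simp⟩
        · rintro ⟨T, hT, hx⟩
          exact (hx i).2 hT
      rw [hA, measure_biUnion_finset (fun T _ T' _ hne => hc.disj hne) fun T _ => hc.meas T,
        Finset.sum_filter]
      refine Finset.sum_congr rfl fun T _ => ?_
      rw [natCast_cnt (hc.meas T) (hμ.lt_top (hc.bdd T))]
    have hr : Measurable (I.restrict : (S → ℝ≥0∞) → I → ℝ≥0∞) :=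
      measurable_pi_lambda _ fun i => measurable_pi_apply _
    rw [Measure.map_map hr hΦ, Measure.map_map hr hΦ,
      Measure.map_congr (hQ.mono key), Measure.map_congr (hQ'.mono key),
      ← Measure.map_map hg hm, ← Measure.map_map hg hm, h _ _ hc]
  have hPhi : Q.map Φ = Q'.map Φ := by
    have : ∀ I : Finset S, IsFiniteMeasure ((Q.map Φ).map I.restrict) := fun I => inferInstance
    exact IsProjectiveLimit.unique (P := fun I : Finset S => (Q.map Φ).map I.restrict)
      (fun I => rfl) (fun I => (hmarg I).symm)
  -- Evaluations on bounded sets generate the full `σ`-algebra, because `μ s` is the supremum of `μ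
  -- (s ∩ [-R, R])`.
  have hle : (inferInstance : MeasurableSpace Config) ≤ MeasurableSpace.comap Φ inferInstance := by
    have hid : @Measurable Config Config (MeasurableSpace.comap Φ inferInstance) _ id := by
      refine @Measurable.subtype_mk _ _ (MeasurableSpace.comap Φ inferInstance) _ _ _ ?_ _
      refine @Measure.measurable_of_measurable_coe _ _ _ (MeasurableSpace.comap Φ inferInstance) _
        fun s hs => ?_
      have h1 : (fun μ : Config => μ.1 s) = fun μ : Config => ⨆ R : ℕ,
          Φ μ ⟨s ∩ Set.Icc (-(R : ℝ)) R, hs.inter measurableSet_Icc,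
            (Metric.isBounded_Icc _ _).subset Set.inter_subset_right⟩ := by
        ext μ
        simp only [Φ]
        rw [← Monotone.measure_iUnion, ← Set.inter_iUnion, iUnion_Icc_nat, Set.inter_univ]
        intro i j hij
        refine Set.inter_subset_inter_right _ (Set.Icc_subset_Icc ?_ ?_)
        · exact neg_le_neg (by exact_mod_cast hij)
        · exact_mod_cast hij
      change @Measurable _ _ (MeasurableSpace.comap Φ inferInstance) _ fun μ : Config => μ.1 s
      rw [h1]
      refine @Measurable.iSup _ _ _ _ _ (MeasurableSpace.comap Φ inferInstance) _ _ _ _ _ _ fun R => ?_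
      exact Measurable.comp (g := fun x : S → ℝ≥0∞ => x ⟨s ∩ Set.Icc (-(R : ℝ)) R,
        hs.inter measurableSet_Icc, (Metric.isBounded_Icc _ _).subset Set.inter_subset_right⟩)
        (measurable_pi_apply _) (comap_measurable Φ)
    intro s hs
    exact hid hs
  ext s hs
  obtain ⟨s', hs', rfl⟩ := hle s hs
  rw [← Measure.map_apply hΦ hs', hPhi, Measure.map_apply hΦ hs']

/-! ### Invariance of the law of the point process under the dynamics -/

theorem factKernel_perm (n : ℕ) {μ : Config} (hμ : IsLocFin μ) (s : Equiv.Perm (Fin n)) :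
    (factKernel n μ).map (fun x i => x (s i)) = factKernel n μ := by
  have hs : Measurable fun (x : Fin n → ℝ) i => x (s i) :=
    measurable_pi_lambda _ fun i => measurable_pi_apply _
  refine Eq.symm (ext_of_box (fun ι _ B hB φ => ?_) fun ι _ B hB φ => ?_)
  · rw [Measure.map_apply hs (hB.measurableSet_box φ)]
    have : (fun (x : Fin n → ℝ) i => x (s i)) ⁻¹' box B φ = box B fun i => φ (s.symm i) := by
      ext x
      simp only [Set.mem_preimage, mem_box]
      exact ⟨fun h i => by simpa using h (s.symm i), fun h i => by simpa using h (s i)⟩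
    rw [this, factKernel_box hB _ hμ, factKernel_box hB _ hμ]
    simp only [fib_comp_equiv φ s.symm]
  · rw [factKernel_box hB _ hμ]
    exact ENNReal.prod_lt_top fun i _ => ENNReal.natCast_lt_top _

/-- Choosing `n` particles out of `n` only reorders them, and `μ^(n)` is invariant under reordering.
Thus, up to a constant factor, integrals against `μ^(n)` take the form to which consistency applies,
even for nonsymmetric integrands. -/
theorem lintegral_factKernel_factKernel (n : ℕ) {μ : Config} (hμ : IsLocFin μ)
    {g : (Fin n → ℝ) → ℝ≥0∞} (hg : Measurable g) :
    ∫⁻ x, ∫⁻ y, g y ∂(factKernel n (iota x)) ∂(factKernel n μ) =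
      (Fintype.card (Fin n ↪ Fin n) : ℝ≥0∞) * ∫⁻ x, g x ∂(factKernel n μ) := by
  have hme : ∀ e : Fin n ↪ Fin n, Measurable fun (z : Fin n → ℝ) (j : Fin n) => z (e j) :=
    fun e => measurable_pi_lambda _ fun j => measurable_pi_apply _
  have hge : ∀ e : Fin n ↪ Fin n, Measurable fun z : Fin n → ℝ => g fun j => z (e j) :=
    fun e => hg.comp (hme e)
  have h1 : ∀ x : Fin n → ℝ, ∫⁻ y, g y ∂(factKernel n (iota x)) =
      ∑ e : Fin n ↪ Fin n, g fun j => x (e j) := fun x => by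
    rw [factKernel_apply _ (isLocFin_iota x), lintegral_factorialMeasure_iota x hg]
  simp only [h1]
  rw [lintegral_finsetSum _ fun e _ => hge e]
  have h2 : ∀ e : Fin n ↪ Fin n, ∫⁻ x, g (fun j => x (e j)) ∂(factKernel n μ) =
      ∫⁻ x, g x ∂(factKernel n μ) := by
    intro e
    let s : Equiv.Perm (Fin n) :=
      Equiv.ofBijective e (Finite.injective_iff_bijective.1 e.injective)
    conv_rhs => rw [← factKernel_perm n hμ s]
    exact (lintegral_map hg (hme e)).symm
  simp only [h2, Finset.sum_const, nsmul_eq_mul, Finset.card_univ]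

variable {Ω Ω' : Type*} [MeasurableSpace Ω] [MeasurableSpace Ω']

namespace MarkovFamily

/-- A Markov family is measurable only along labelings. Properness supplies measurable labels, and
the countably many values of the number of particles are treated one by one. -/
theorem measurable_P_of_isProper (X : MarkovFamily Ω) {ζ : Ω' → Config} (hζ : IsProper ζ)
    (t : ℝ≥0) {A : Set Config} (hA : MeasurableSet A) :
    Measurable fun ω => X.P (ζ ω) (X.η t ⁻¹' A) := by
  obtain ⟨K, Z, hK, hZ, h⟩ := hζ
  have hζ' : ∀ ω, ζ ω = iota fun k : {k : ℕ // (k : ℕ∞) < K ω} => Z k ω := fun ω =>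
    Subtype.ext (h ω)
  let g : Ω' × ℕ∞ → ℝ≥0∞ := fun p =>
    X.P (iota fun k : {k : ℕ // (k : ℕ∞) < p.2} => Z k p.1) (X.η t ⁻¹' A)
  have hg : Measurable g := by
    refine measurable_from_prod_countable_left fun k => ?_
    induction k using ENat.recTopCoe with
    | top =>
      have e : ℕ ≃ {j : ℕ // (j : ℕ∞) < ⊤} :=
        (Equiv.subtypeUnivEquiv fun j => ENat.natCast_lt_top j).symm
      have : ∀ ω, iota (fun k : {j : ℕ // (j : ℕ∞) < ⊤} => Z k ω) =
          iota fun j : ℕ => Z (e j) ω := fun ω => (iota_comp_equiv _ e).symm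
      simp only [g, this]
      exact (X.measurable_infinite t A hA).comp (measurable_pi_lambda _ fun j => hZ _)
    | coe n =>
      have e : Fin n ≃ {j : ℕ // (j : ℕ∞) < n} :=
        { toFun := fun j => ⟨j.1, by exact_mod_cast j.2⟩
          invFun := fun j => ⟨j.1, by exact_mod_cast j.2⟩
          left_inv := fun _ => rfl
          right_inv := fun _ => rfl }
      have : ∀ ω, iota (fun k : {j : ℕ // (j : ℕ∞) < n} => Z k ω) =
          iota fun j : Fin n => Z (e j) ω := fun ω => (iota_comp_equiv _ e).symm
      simp only [g, this]
      exact (X.measurable_finite n t A hA).comp (measurable_pi_lambda _ fun j => hZ _)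
  have := hg.comp (measurable_id.prodMk hK)
  simp only [hζ']
  exact this

/-- The conditional law of the configuration at time `t`, if the initial configuration is given
by a proper point process. -/
def initKernel (X : MarkovFamily Ω) {ζ : Ω' → Config} (hζ : IsProper ζ) (t : ℝ≥0) :
    Kernel Ω' Config where
  toFun ω := (X.P (ζ ω)).map (X.η t)
  measurable' := Measure.measurable_of_measurable_coe _ fun s hs => by
    simp only [Measure.map_apply (X.measurable_η t) hs]
    exact X.measurable_P_of_isProper hζ t hs

theorem initKernel_apply (X : MarkovFamily Ω) {ζ : Ω' → Config} (hζ : IsProper ζ) (t : ℝ≥0)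
    (ω : Ω') : X.initKernel hζ t ω = (X.P (ζ ω)).map (X.η t) := rfl

instance (X : MarkovFamily Ω) {ζ : Ω' → Config} (hζ : IsProper ζ) (t : ℝ≥0) :
    IsMarkovKernel (X.initKernel hζ t) :=
  ⟨fun ω => by
    rw [initKernel_apply]
    exact Measure.isProbabilityMeasure_map (X.measurable_η t).aemeasurable⟩

theorem lintegral_bind_initKernel (X : MarkovFamily Ω) {ζ : Ω' → Config} (hζ : IsProper ζ)
    (t : ℝ≥0) (Pr : Measure Ω') {F : Config → ℝ≥0∞} (hF : Measurable F) :
    ∫⁻ μ, F μ ∂(Pr.bind (X.initKernel hζ t)) = ∫⁻ ω, X.trans t F (ζ ω) ∂Pr := by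
  rw [Measure.lintegral_bind (X.initKernel hζ t).measurable.aemeasurable hF.aemeasurable]
  refine lintegral_congr fun ω => ?_
  rw [initKernel_apply, lintegral_map hF (X.measurable_η t), trans]

end MarkovFamily

namespace Ensemble

variable {c : ℕ} {b : ℝ≥0} {α : Measure ℝ}
  {κ : (k m : ℕ) → (Fin k → ℝ) → Measure (Fin m → ℝ)} {ν : (n : ℕ) → Measure (Fin n → ℝ)}
  {π : Measure Config} (E : Ensemble c b α κ ν π)

/-- The binomial series turns `(1 + v)^N` into `∑ v^k / k! (N)_k`. Since `a (a + c) ⋯ (a + (k - 1)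
c) ≤ (a + c)^k k!`, its mean is at most a geometric series with ratio `v b (a + c)`. -/
theorem exists_lintegral_pow_cnt (E : Ensemble c b α κ ν π) {B : Set ℝ} (hB : MeasurableSet B)
    (hb : Bornology.IsBounded B) :
    ∃ v : ℝ≥0, 0 < v ∧ ∫⁻ μ, (1 + v : ℝ≥0∞) ^ cnt B μ ∂π < ∞ := by
  set A : ℝ≥0 := (α B).toNNReal
  have hA : α B = A := (ENNReal.coe_toNNReal (E.fin B hb).ne).symm
  -- This makes the ratio at most `1 / 2`; the summand `1` prevents a division by zero.
  set v : ℝ≥0 := (2 * (b * (A + c) + 1))⁻¹ with hv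
  have hvb : v * (b * (A + c)) ≤ 2⁻¹ := by
    rw [hv, mul_inv, mul_assoc]
    refine mul_le_of_le_one_right zero_le ?_
    rw [← div_eq_inv_mul]
    exact div_le_one_of_le₀ (le_add_of_nonneg_right zero_le_one) zero_le
  refine ⟨v, by positivity, ?_⟩
  have hm : ∀ k : ℕ, Measurable fun μ : Config => ((cnt B μ).descFactorial k : ℝ≥0∞) := fun k =>
    (measurable_from_nat (f := fun m => ((m.descFactorial k : ℕ) : ℝ≥0∞))).comp (measurable_cnt hB)
  have h1 : ∀ N : ℕ, (1 + v : ℝ≥0∞) ^ N =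
      ∑' k : ℕ, ((v : ℝ≥0∞) ^ k * (k.factorial : ℝ≥0∞)⁻¹) * (N.descFactorial k : ℝ≥0∞) := by
    intro N
    rw [add_comm, add_pow, tsum_eq_sum (s := Finset.range (N + 1))]
    · refine Finset.sum_congr rfl fun k _ => ?_
      rw [one_pow, mul_one, mul_assoc, Nat.descFactorial_eq_factorial_mul_choose, Nat.cast_mul,
        ← mul_assoc _ (k.factorial : ℝ≥0∞), ENNReal.inv_mul_cancel
        (by exact_mod_cast k.factorial_ne_zero) (ENNReal.natCast_ne_top _), one_mul]
    · intro k hk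
      rw [Finset.mem_range, not_lt] at hk
      rw [Nat.descFactorial_eq_zero_iff_lt.2 (by omega)]; simp
  simp only [h1]
  rw [lintegral_tsum fun k => ((hm k).const_mul _).aemeasurable]
  have hle : ∀ k : ℕ, ∫⁻ μ, ((v : ℝ≥0∞) ^ k * (k.factorial : ℝ≥0∞)⁻¹) *
      ((cnt B μ).descFactorial k : ℝ≥0∞) ∂π ≤ (2⁻¹ : ℝ≥0∞) ^ k := by
    intro k
    rw [lintegral_const_mul _ (hm k), E.fact B hB hb, hA]
    have h2 : rise c A k ≤ (A + c) ^ k * k.factorial := by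
      rw [← Finset.prod_range_add_one_eq_factorial, Nat.cast_prod, ← Finset.card_range k,
        ← Finset.prod_const, Finset.card_range, ← Finset.prod_mul_distrib]
      refine Finset.prod_le_prod' fun i _ => ?_
      push_cast
      calc A + c * i ≤ A + c * i + (A * i + c) := le_add_of_nonneg_right zero_le
        _ = (A + c) * (i + 1) := by ring
    have h3 : v ^ k * (k.factorial : ℝ≥0)⁻¹ * (b ^ k * rise c A k) ≤ (2⁻¹ : ℝ≥0) ^ k := by
      calc v ^ k * (k.factorial : ℝ≥0)⁻¹ * (b ^ k * rise c A k)
          ≤ v ^ k * (k.factorial : ℝ≥0)⁻¹ * (b ^ k * ((A + c) ^ k * k.factorial)) := by gcongr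
        _ = (v * (b * (A + c))) ^ k := by
            have : (k.factorial : ℝ≥0) ≠ 0 := by exact_mod_cast k.factorial_ne_zero
            field_simp
            rw [mul_pow, mul_pow]
            ring
        _ ≤ (2⁻¹ : ℝ≥0) ^ k := by gcongr
    have h4 : rise c (A : ℝ≥0∞) k = ((rise c A k : ℝ≥0) : ℝ≥0∞) :=
      (rise_map ENNReal.ofNNRealHom c A k).symm
    rw [h4]
    have h5 : ((k.factorial : ℝ≥0∞))⁻¹ = (((k.factorial : ℝ≥0)⁻¹ : ℝ≥0) : ℝ≥0∞) := by
      rw [ENNReal.coe_inv (by exact_mod_cast k.factorial_ne_zero)]; simp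
    have h6 : (2⁻¹ : ℝ≥0∞) = ((2⁻¹ : ℝ≥0) : ℝ≥0∞) := by
      rw [ENNReal.coe_inv two_ne_zero]; simp
    rw [h5, h6]
    exact_mod_cast h3
  refine (ENNReal.tsum_le_tsum hle).trans_lt ?_
  rw [ENNReal.tsum_geometric]
  simp

theorem exists_lintegral_exp_wcnt (E : Ensemble c b α κ ν π) {ι : Type} [Fintype ι]
    {B : ι → Set ℝ} (hB : IsCell B) (a : ι → ℝ≥0) :
    ∃ t : ℝ, 0 < t ∧ ∫⁻ μ, ENNReal.ofReal (Real.exp (t * wcnt a B μ)) ∂π < ∞ := by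
  have hU : MeasurableSet (⋃ i, B i) := MeasurableSet.iUnion hB.meas
  have hUb : Bornology.IsBounded (⋃ i, B i) := Bornology.isBounded_iUnion.2 hB.bdd
  obtain ⟨v, hv, hfin⟩ := E.exists_lintegral_pow_cnt hU hUb
  set C : ℝ≥0 := ∑ i, a i
  have hlog : 0 < Real.log (1 + v) := Real.log_pos (by
    have : (0 : ℝ) < v := hv
    linarith)
  -- The weighted count is at most `C` times the count of the union of the cells. Using `C + 1`
  -- instead of `C` covers the case that all weights vanish.
  refine ⟨Real.log (1 + v) / (C + 1), by positivity, lt_of_le_of_lt (lintegral_mono_ae ?_) hfin⟩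
  filter_upwards [E.locFin] with μ hμ
  have h1 : wcnt a B μ ≤ C * cnt (⋃ i, B i) μ := by
    rw [wcnt, Finset.sum_mul]
    refine Finset.sum_le_sum fun i _ => ?_
    gcongr
    have : (cnt (B i) μ : ℝ≥0∞) ≤ cnt (⋃ i, B i) μ := by
      rw [natCast_cnt (hB.meas i) (hμ.lt_top (hB.bdd i)), natCast_cnt hU (hμ.lt_top hUb)]
      exact measure_mono (Set.subset_iUnion B i)
    exact_mod_cast this
  have h2 : Real.log (1 + v) / (C + 1) * wcnt a B μ ≤ Real.log (1 + v) * cnt (⋃ i, B i) μ := by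
    have h1' : (wcnt a B μ : ℝ) ≤ C * cnt (⋃ i, B i) μ := by exact_mod_cast h1
    calc Real.log (1 + v) / (C + 1) * wcnt a B μ
        ≤ Real.log (1 + v) / (C + 1) * ((C + 1) * cnt (⋃ i, B i) μ) := by
          gcongr
          exact h1'.trans (by gcongr; linarith)
      _ = Real.log (1 + v) * cnt (⋃ i, B i) μ := by
          have : (C : ℝ) + 1 ≠ 0 := by positivity
          field_simp
  calc ENNReal.ofReal (Real.exp (Real.log (1 + v) / (C + 1) * wcnt a B μ))
      ≤ ENNReal.ofReal (Real.exp (Real.log (1 + v) * cnt (⋃ i, B i) μ)) :=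
        ENNReal.ofReal_le_ofReal (Real.exp_le_exp.2 h2)
    _ = (1 + v : ℝ≥0∞) ^ cnt (⋃ i, B i) μ := by
        rw [mul_comm, Real.exp_nat_mul, Real.exp_log (by positivity),
          ENNReal.ofReal_pow (by positivity), ENNReal.ofReal_add zero_le_one (NNReal.coe_nonneg v),
          ENNReal.ofReal_one, ENNReal.ofReal_coe_nnreal]

variable (X : MarkovFamily Ω)

/-- Consistency expresses the factorial moments at time `t` through `∫ P_t F dν_n`, and `ν n` is
invariant, so they equal the initial ones. By the exponential moments of the initial law, the joint
factorial moments determine the law of the counts and hence of the configuration. -/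
theorem bind_initKernel {Pr : Measure Ω'} [IsProbabilityMeasure Pr] {ζ : Ω' → Config}
    (hζ : IsProper ζ) (hζm : Measurable ζ) (E : Ensemble c b α κ ν (Pr.map ζ))
    (hX : X.IsConservative) (hc : X.IsConsistent)
    (hrev : ∀ n, 1 ≤ n → X.IsReversible ((ν n).map iota)) (t : ℝ≥0) :
    Pr.bind (X.initKernel hζ t) = Pr.map ζ := by
  have := E.prob
  have hQp : IsProbabilityMeasure (Pr.bind (X.initKernel hζ t)) := inferInstance
  have hlf := ae_of_ae_map hζm.aemeasurable (E.ae_isLocFin X hX hc hrev t)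
  have hQ : ∀ᵐ μ ∂(Pr.bind (X.initKernel hζ t)), IsLocFin μ := by
    rw [ae_iff, ← Set.compl_ofPred, Measure.bind_apply measurableSet_isLocFin.compl
      (X.initKernel hζ t).measurable.aemeasurable, lintegral_eq_zero_iff
      ((X.initKernel hζ t).measurable_coe measurableSet_isLocFin.compl)]
    filter_upwards [hlf] with ω hω
    rw [X.initKernel_apply, Measure.map_apply (X.measurable_η t) measurableSet_isLocFin.compl]
    exact ae_iff.1 hω.2
  refine config_ext hQ E.locFin fun ι _ B hB => map_cnt_eq hB (fun n φ => ?_)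
    fun a => E.exists_lintegral_exp_wcnt hB a
  let F : Config → ℝ≥0∞ := fun μ => factKernel n μ (box B φ)
  have hF : Measurable F := (factKernel n).measurable_coe (hB.measurableSet_box φ)
  have hFi : Measurable fun x : Fin n → ℝ => F (iota x) := hF.comp measurable_iota
  let F' : Config → ℝ≥0∞ := fun μ => ∫⁻ x, F (iota x) ∂(factKernel n μ)
  have hF' : Measurable F' := hFi.lintegral_kernel
  have hfall : ∀ μ, IsLocFin μ → fallCnt B (fib φ) μ = F μ := fun μ hμ =>
    (factKernel_box hB φ hμ).symm
  have hFF' : ∀ μ, IsLocFin μ → F' μ = (Fintype.card (Fin n ↪ Fin n) : ℝ≥0∞) * F μ := by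
    intro μ hμ
    have := lintegral_factKernel_factKernel n hμ
      (measurable_one.indicator (hB.measurableSet_box φ))
    simpa only [lintegral_indicator_one (hB.measurableSet_box φ)] using this
  rw [lintegral_congr_ae (hQ.mono hfall), lintegral_congr_ae (E.locFin.mono hfall)]
  have hne : (Fintype.card (Fin n ↪ Fin n) : ℝ≥0∞) ≠ 0 := by
    rw [Fintype.card_embedding_eq, Fintype.card_fin]
    exact_mod_cast (Nat.descFactorial_pos.2 le_rfl).ne'
  refine (ENNReal.mul_right_inj hne (ENNReal.natCast_ne_top _)).1 ?_
  rw [← lintegral_const_mul _ hF, ← lintegral_const_mul _ hF,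
    ← lintegral_congr_ae (hQ.mono hFF'), ← lintegral_congr_ae (E.locFin.mono hFF'),
    X.lintegral_bind_initKernel hζ t Pr hF']
  have htF := X.measurable_trans_iota t n hF
  have h1 : ∫⁻ ω, X.trans t F' (ζ ω) ∂Pr =
      ∫⁻ ω, ∫⁻ x, X.trans t F (iota x) ∂(factKernel n (ζ ω)) ∂Pr := by
    refine lintegral_congr_ae ?_
    filter_upwards [hlf] with ω hω
    exact X.lintegral_factKernel hX hc n t hω.1 hω.2 hF
  have h2 : ∀ {f : (Fin n → ℝ) → ℝ≥0∞}, Measurable f →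
      ∫⁻ μ, ∫⁻ x, f x ∂(factKernel n μ) ∂(Pr.map ζ) = (b : ℝ≥0∞) ^ n * ∫⁻ x, f x ∂(ν n) := by
    intro f hf
    rw [← Measure.lintegral_bind (factKernel n).measurable.aemeasurable hf.aemeasurable,
      E.bind_factKernel n, lintegral_smul_measure, smul_eq_mul]
  have hmt : Measurable fun μ => ∫⁻ x, X.trans t F (iota x) ∂(factKernel n μ) :=
    htF.lintegral_kernel
  rw [h1, ← lintegral_map hmt hζm, h2 htF, X.lintegral_trans hX (ν n) (hrev n) t hF, ← h2 hFi]

end Ensemble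

/-! ### Charlier and Meixner polynomials -/

/-- The falling factorial `x (x - 1) ⋯ (x - k + 1)`. -/
def fall (x : ℝ) (k : ℕ) : ℝ := ∏ i ∈ Finset.range k, (x - i)

theorem fall_succ (x : ℝ) (k : ℕ) : fall x (k + 1) = fall x k * (x - k) :=
  Finset.prod_range_succ _ _

theorem natCast_descFactorial (N k : ℕ) : (N.descFactorial k : ℝ) = fall N k := by
  induction k with
  | zero => simp [fall]
  | succ k ih =>
    rw [fall_succ, ← ih, Nat.descFactorial_succ, Nat.cast_mul, mul_comm]
    rcases le_or_gt k N with h | h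
    · rw [Nat.cast_sub h]
    · rw [Nat.descFactorial_eq_zero_iff_lt.2 h]; simp

theorem sum_choose_succ (n : ℕ) (g : ℕ → ℝ) :
    ∑ i ∈ Finset.range (n + 2), ((n + 1).choose i : ℝ) * g i =
      ∑ i ∈ Finset.range (n + 1), (n.choose i : ℝ) * (g i + g (i + 1)) := by
  have := Finset.sum_choose_succ_mul (fun i _ => g i) n
  rw [this, ← Finset.sum_add_distrib]
  refine Finset.sum_congr rfl fun i _ => ?_
  ring

/-- Linearization of products, which reduces mixed moments to factorial moments. In the induction on
`k`, Pascal's rule pairs adjacent terms, and the new factor splits as `N - k = (N - (m + k - j)) +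
(m - j)`. -/
theorem fall_mul_fall (N : ℝ) (m k : ℕ) : fall N m * fall N k =
    ∑ j ∈ Finset.range (k + 1), (k.choose j : ℝ) * (fall m j * fall N (m + k - j)) := by
  induction k with
  | zero => simp [fall]
  | succ k ih =>
    rw [fall_succ, ← mul_assoc, ih, Finset.sum_mul, sum_choose_succ]
    refine Finset.sum_congr rfl fun j hj => ?_
    have hj' : j ≤ k := Nat.lt_succ_iff.1 (Finset.mem_range.1 hj)
    have h1 : m + (k + 1) - j = (m + k - j) + 1 := by omega
    have h2 : m + (k + 1) - (j + 1) = m + k - j := by omega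
    rw [h1, h2, fall_succ, fall_succ, Nat.cast_sub (by omega)]
    push_cast
    ring

theorem rise_succ' (c : ℕ) (a : ℝ) (m : ℕ) : rise c a (m + 1) = a * rise c (a + c) m := by
  rw [rise, Finset.prod_range_succ', rise, mul_comm]
  congr 1
  · simp
  · refine Finset.prod_congr rfl fun i _ => ?_
    push_cast; ring

/-- A Vandermonde identity. By Pascal's rule adjacent terms combine and release the factor `(γ + c
i) - (β + c i) = γ - β`; what remains is the same sum for `r` with `β` replaced by `β + c`, which is
why `β` is quantified inside the induction. -/
theorem sum_rise_mul_rise (c : ℕ) (γ : ℝ) (r : ℕ) : ∀ β : ℝ,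
    ∑ i ∈ Finset.range (r + 1), (r.choose i : ℝ) *
      ((-1) ^ (r - i) * rise c (β + c * i) (r - i) * rise c γ i) =
      ∏ i ∈ Finset.range r, (γ - β - c * i) := by
  induction r with
  | zero => intro β; simp [rise]
  | succ r ih =>
    intro β
    rw [sum_choose_succ, Finset.prod_range_succ', mul_comm]
    have h0 : ∏ i ∈ Finset.range r, (γ - β - c * ((i + 1 : ℕ) : ℝ)) =
        ∏ i ∈ Finset.range r, (γ - (β + c) - c * i) :=
      Finset.prod_congr rfl fun i _ => by push_cast; ring
    rw [h0, ← ih, Finset.mul_sum]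
    refine Finset.sum_congr rfl fun i hi => ?_
    have hi' : i ≤ r := Nat.lt_succ_iff.1 (Finset.mem_range.1 hi)
    have h1 : r + 1 - i = (r - i) + 1 := by omega
    have h2 : r + 1 - (i + 1) = r - i := by omega
    have h3 : β + c * ((i + 1 : ℕ) : ℝ) = β + c + c * i := by push_cast; ring
    have h4 : β + c * (i : ℝ) + c = β + c + c * i := by ring
    rw [h1, h2, h3, rise_succ', h4, rise_succ]
    push_cast
    ring

theorem fall_mul_prod (m : ℕ) (c : ℕ) {j n : ℕ} (hj : j ≤ n) (a : ℝ) :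
    fall m j * ∏ i ∈ Finset.range (n - j), ((a + c * m) - (a + c * j) - c * i) =
      c ^ (n - j) * fall m n := by
  have h1 : ∏ i ∈ Finset.range (n - j), ((a + c * m) - (a + c * j) - c * (i : ℝ)) =
      c ^ (n - j) * ∏ i ∈ Finset.range (n - j), ((m : ℝ) - ((j + i : ℕ) : ℝ)) := by
    rw [← Finset.card_range (n - j), ← Finset.prod_const, Finset.card_range,
      ← Finset.prod_mul_distrib]
    refine Finset.prod_congr rfl fun i _ => ?_
    push_cast; ring
  have h2 : fall m n = fall m (j + (n - j)) := by congr 1; omega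
  rw [h1, h2, fall, fall, Finset.prod_range_add]
  ring

/-- The monic orthogonal polynomials of the distributions with factorial moments
`b ^ k a (a + c) ⋯ (a + (k - 1) c)`: Charlier polynomials for `c = 0`, Meixner polynomials for
`c = 1`. -/
def orthPoly (c : ℕ) (b a : ℝ) (n : ℕ) (N : ℕ) : ℝ :=
  ∑ k ∈ Finset.range (n + 1), (n.choose k : ℝ) *
    ((-b) ^ (n - k) * rise c (a + c * k) (n - k) * fall N k)

/-- The left-hand side is the mean of `orthPoly n` times `(N)_m`, written with factorial moments.
After interchanging the sums, the inner alternating sum is `sum_rise_mul_rise`, and the binomial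
theorem sums the outer one to `(1 + c b)^n`. The factor `fall m n` vanishes for `m < n`, which is
the orthogonality. -/
theorem sum_orthPoly_fall (c : ℕ) (b a : ℝ) (n m : ℕ) :
    ∑ k ∈ Finset.range (n + 1), (n.choose k : ℝ) * ((-b) ^ (n - k) * rise c (a + c * k) (n - k) *
      ∑ j ∈ Finset.range (k + 1), (k.choose j : ℝ) *
        (fall m j * (b ^ (m + k - j) * rise c a (m + k - j)))) =
      b ^ m * rise c a m * (fall m n * (1 + c * b) ^ n) := by
  have h1 : ∀ k ∈ Finset.range (n + 1), (n.choose k : ℝ) * ((-b) ^ (n - k) *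
      rise c (a + c * k) (n - k) * ∑ j ∈ Finset.range (k + 1), (k.choose j : ℝ) *
        (fall m j * (b ^ (m + k - j) * rise c a (m + k - j)))) =
      ∑ j ∈ Finset.range (k + 1), (n.choose k : ℝ) * ((-b) ^ (n - k) *
      rise c (a + c * k) (n - k) * ((k.choose j : ℝ) *
        (fall m j * (b ^ (m + k - j) * rise c a (m + k - j))))) := by
    intro k _
    rw [Finset.mul_sum, Finset.mul_sum]
  rw [Finset.sum_congr rfl h1, Finset.sum_comm' (t' := Finset.range (n + 1))
    (s' := fun j => Finset.Ico j (n + 1)) (by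
      intro k j
      simp only [Finset.mem_range, Finset.mem_Ico]
      omega)]
  have h2 : ∀ j ∈ Finset.range (n + 1), ∑ k ∈ Finset.Ico j (n + 1), (n.choose k : ℝ) *
      ((-b) ^ (n - k) * rise c (a + c * k) (n - k) * ((k.choose j : ℝ) *
        (fall m j * (b ^ (m + k - j) * rise c a (m + k - j))))) =
      b ^ m * rise c a m * fall m n * ((c * b) ^ (n - j) * (n.choose j : ℝ)) := by
    intro j hj
    have hj' : j ≤ n := Nat.lt_succ_iff.1 (Finset.mem_range.1 hj)
    rw [Finset.sum_Ico_eq_sum_range, Nat.succ_sub hj']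
    have h3 : ∀ i ∈ Finset.range (n - j + 1), (n.choose (j + i) : ℝ) *
      ((-b) ^ (n - (j + i)) * rise c (a + c * ((j + i : ℕ) : ℝ)) (n - (j + i)) *
        (((j + i).choose j : ℝ) *
        (fall m j * (b ^ (m + (j + i) - j) * rise c a (m + (j + i) - j))))) =
      b ^ m * rise c a m * fall m j * b ^ (n - j) * (n.choose j : ℝ) *
        (((n - j).choose i : ℝ) *
      ((-1) ^ (n - j - i) * rise c ((a + c * j) + c * i) (n - j - i) *
        rise c (a + c * m) i)) := by
      intro i hi
      have hi' : i ≤ n - j := Nat.lt_succ_iff.1 (Finset.mem_range.1 hi)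
      have e1 : m + (j + i) - j = m + i := by omega
      have e2 : n - (j + i) = n - j - i := by omega
      have e3 : (n.choose (j + i) : ℝ) * ((j + i).choose j : ℝ) =
          (n.choose j : ℝ) * ((n - j).choose i : ℝ) := by
        have := Nat.choose_mul (n := n) (k := j + i) (s := j)
        rw [Nat.add_sub_cancel_left] at this
        exact_mod_cast this (Nat.le_add_right j i)
      have e4 : b ^ (n - j) = b ^ (n - j - i) * b ^ i := by
        rw [← pow_add]; congr 1; omega
      have e5 : (a + c * ((j + i : ℕ) : ℝ)) = (a + c * j) + c * i := by push_cast; ring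
      rw [e1, e2, e4, e5, rise_add c a m i, neg_pow b, pow_add]
      linear_combination ((-1) ^ (n - j - i) * b ^ (n - j - i) *
        rise c ((a + c * j) + c * i) (n - j - i) * fall m j * b ^ m * b ^ i * rise c a m *
        rise c (a + c * m) i) * e3
    rw [Finset.sum_congr rfl h3, ← Finset.mul_sum, sum_rise_mul_rise]
    have := fall_mul_prod m c hj' a
    rw [mul_pow]
    linear_combination (b ^ m * rise c a m * b ^ (n - j) * (n.choose j : ℝ)) * this
  rw [Finset.sum_congr rfl h2, ← Finset.mul_sum, add_pow]
  simp only [one_pow, one_mul]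
  ring

theorem fall_self (n : ℕ) : fall n n = n.factorial := by
  rw [← natCast_descFactorial, Nat.descFactorial_self]

theorem fall_of_lt {m n : ℕ} (h : m < n) : fall m n = 0 := by
  rw [← natCast_descFactorial, Nat.descFactorial_eq_zero_iff_lt.2 h, Nat.cast_zero]

section Integral

variable {Y : Type*} [MeasurableSpace Y] {P : Measure Y} {N : Y → ℕ} {c : ℕ} {b a : ℝ}

theorem integrable_fall_mul_fall (hi : ∀ k, Integrable (fun y => fall (N y) k) P) (m k : ℕ) :
    Integrable (fun y => fall (N y) m * fall (N y) k) P := by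
  simp only [fall_mul_fall]
  exact integrable_finsetSum _ fun j _ => ((hi _).const_mul _).const_mul _

theorem integral_fall_mul_fall (hi : ∀ k, Integrable (fun y => fall (N y) k) P)
    (hv : ∀ k, ∫ y, fall (N y) k ∂P = b ^ k * rise c a k) (m k : ℕ) :
    ∫ y, fall (N y) m * fall (N y) k ∂P = ∑ j ∈ Finset.range (k + 1), (k.choose j : ℝ) *
      (fall m j * (b ^ (m + k - j) * rise c a (m + k - j))) := by
  simp only [fall_mul_fall]
  rw [integral_finsetSum _ fun j _ => ((hi _).const_mul _).const_mul _]
  refine Finset.sum_congr rfl fun j _ => ?_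
  rw [integral_const_mul, integral_const_mul, hv]

theorem integrable_orthPoly_mul_fall (hi : ∀ k, Integrable (fun y => fall (N y) k) P) (n m : ℕ) :
    Integrable (fun y => orthPoly c b a n (N y) * fall (N y) m) P := by
  simp only [orthPoly, Finset.sum_mul]
  refine integrable_finsetSum _ fun k _ => ?_
  have := ((integrable_fall_mul_fall hi k m).const_mul
    ((-b) ^ (n - k) * rise c (a + c * k) (n - k))).const_mul (n.choose k : ℝ)
  refine this.congr (Eventually.of_forall fun y => ?_)
  simp only
  ring

theorem integral_orthPoly_mul_fall (hi : ∀ k, Integrable (fun y => fall (N y) k) P)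
    (hv : ∀ k, ∫ y, fall (N y) k ∂P = b ^ k * rise c a k) (n m : ℕ) :
    ∫ y, orthPoly c b a n (N y) * fall (N y) m ∂P =
      b ^ m * rise c a m * (fall m n * (1 + c * b) ^ n) := by
  rw [← sum_orthPoly_fall]
  have h : ∀ y, orthPoly c b a n (N y) * fall (N y) m = ∑ k ∈ Finset.range (n + 1),
      (n.choose k : ℝ) * ((-b) ^ (n - k) * rise c (a + c * k) (n - k)) *
        (fall (N y) m * fall (N y) k) := by
    intro y
    rw [orthPoly, Finset.sum_mul]
    refine Finset.sum_congr rfl fun k _ => ?_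
    ring
  simp only [h]
  rw [integral_finsetSum _ fun k _ => (integrable_fall_mul_fall hi m k).const_mul _]
  refine Finset.sum_congr rfl fun k _ => ?_
  rw [integral_const_mul, integral_fall_mul_fall hi hv]
  ring

/-- The polynomial of smaller degree is expanded in falling factorials; all of them of degree below
`n` are orthogonal to `orthPoly n`, so at most the leading term contributes. -/
theorem integral_orthPoly_mul_orthPoly (hi : ∀ k, Integrable (fun y => fall (N y) k) P)
    (hv : ∀ k, ∫ y, fall (N y) k ∂P = b ^ k * rise c a k) (n m : ℕ) :
    ∫ y, orthPoly c b a n (N y) * orthPoly c b a m (N y) ∂P =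
      if n = m then n.factorial * (b * (1 + c * b)) ^ n * rise c a n else 0 := by
  wlog hmn : m ≤ n generalizing n m
  · have := this m n (le_of_not_ge hmn)
    simp only [mul_comm (orthPoly c b a n _)]
    rw [this, if_neg (by omega), if_neg (by omega)]
  have h : ∀ y, orthPoly c b a n (N y) * orthPoly c b a m (N y) = ∑ k ∈ Finset.range (m + 1),
      (m.choose k : ℝ) * ((-b) ^ (m - k) * rise c (a + c * k) (m - k)) *
        (orthPoly c b a n (N y) * fall (N y) k) := by
    intro y
    rw [orthPoly.eq_def c b a m, Finset.mul_sum]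
    refine Finset.sum_congr rfl fun k _ => ?_
    ring
  simp only [h]
  rw [integral_finsetSum _ fun k _ => (integrable_orthPoly_mul_fall hi n k).const_mul _]
  simp only [integral_const_mul, integral_orthPoly_mul_fall hi hv]
  rw [Finset.sum_range_succ, Finset.sum_eq_zero]
  · split_ifs with hnm
    · subst hnm
      rw [fall_self]
      simp [rise_zero, mul_pow]
      ring
    · rw [fall_of_lt (by omega : m < n)]; simp
  · intro k hk
    rw [fall_of_lt (lt_of_lt_of_le (Finset.mem_range.1 hk) hmn)]
    simp

end Integral

/-! ### Orthogonality of the polynomials of the ensemble -/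

open Classical in
-- A subset of `J` amounts to a choice of a subset in every fiber of `φ`, and only the cardinalities
-- matter. In this way a sum over subsets of coordinates becomes a product over cells of
-- one-dimensional binomial sums.
theorem sum_finset_prod {ι J : Type} [Fintype ι] [Fintype J] [DecidableEq J] (φ : J → ι)
    (g : ι → ℕ → ℕ → ℝ) :
    ∑ S : Finset J, ∏ i, g i (S.filter fun j => φ j = i).card (Sᶜ.filter fun j => φ j = i).card =
      ∏ i, ∑ k ∈ Finset.range (fib φ i + 1), ((fib φ i).choose k : ℝ) * g i k (fib φ i - k) := by
  have h1 : ∀ i, ∑ k ∈ Finset.range (fib φ i + 1), ((fib φ i).choose k : ℝ) *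
      g i k (fib φ i - k) = ∑ A ∈ (Finset.univ.filter fun j => φ j = i).powerset,
        g i A.card (fib φ i - A.card) := by
    intro i
    rw [Finset.sum_powerset_apply_card (fun k => g i k (fib φ i - k))]
    simp only [nsmul_eq_mul]
    rfl
  simp only [h1]
  rw [Finset.prod_univ_sum]
  refine Finset.sum_bij' (fun S _ i => S.filter fun j => φ j = i)
    (fun p _ => Finset.univ.filter fun j => j ∈ p (φ j)) ?_ ?_ ?_ ?_ ?_
  · intro S _
    simp only [Fintype.mem_piFinset, Finset.mem_powerset]
    exact fun i => Finset.filter_subset_filter _ (Finset.subset_univ _)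
  · intro p _
    exact Finset.mem_univ _
  · intro S _
    ext j
    simp
  · intro p hp
    funext i
    ext j
    simp only [Fintype.mem_piFinset, Finset.mem_powerset] at hp
    have : j ∈ p i → j ∈ Finset.univ.filter fun j => φ j = i := fun h => hp i h
    simp only [Finset.mem_filter, Finset.mem_univ, true_and] at this ⊢
    constructor
    · rintro ⟨h1, rfl⟩
      exact h1
    · intro h
      have h2 := this h
      subst h2
      exact ⟨h, rfl⟩
  · intro S _
    refine Finset.prod_congr rfl fun i _ => ?_
    congr 1
    have : fib φ i = (S.filter fun j => φ j = i).card + (Sᶜ.filter fun j => φ j = i).card := by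
      rw [fib, ← Finset.card_union_of_disjoint, ← Finset.filter_union, Finset.union_compl]
      exact Finset.disjoint_filter_filter disjoint_compl_right
    rw [this, Nat.add_sub_cancel_left]

theorem exists_perm_val_lt {n : ℕ} (S : Finset (Fin n)) :
    ∃ s : Equiv.Perm (Fin n), ∀ j, (s j : ℕ) < S.card ↔ j ∈ S := by
  classical
  have hS : S.card ≤ n := by simpa using S.card_le_univ
  have h : Fintype.card {j // j ∈ S} = Fintype.card {j : Fin n // (j : ℕ) < S.card} := by
    rw [Fintype.card_coe, Fintype.card_subtype]
    rw [Fin.card_filter_val_lt, min_eq_right hS]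
  refine ⟨(Fintype.equivOfCardEq h).extendSubtype, fun j => ⟨fun hj => ?_, fun hj => ?_⟩⟩
  · by_contra hn
    exact (Fintype.equivOfCardEq h).extendSubtype_not_mem j hn hj
  · exact (Fintype.equivOfCardEq h).extendSubtype_mem j hj

/-- A permutation that puts the elements of `S` first. -/
def sortPerm {n : ℕ} (S : Finset (Fin n)) : Equiv.Perm (Fin n) := (exists_perm_val_lt S).choose

theorem sortPerm_lt {n : ℕ} (S : Finset (Fin n)) (j : Fin n) :
    (sortPerm S j : ℕ) < S.card ↔ j ∈ S := (exists_perm_val_lt S).choose_spec j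

theorem card_le_fin {n : ℕ} (S : Finset (Fin n)) : S.card ≤ n := by simpa using S.card_le_univ

theorem measurable_comp_perm {n : ℕ} (s : Equiv.Perm (Fin n)) :
    Measurable fun (x : Fin n → ℝ) i => x (s i) :=
  measurable_pi_lambda _ fun _ => measurable_pi_apply _

theorem box_preimage_perm {ι : Type} {n : ℕ} (B : ι → Set ℝ) (φ : Fin n → ι)
    (s : Equiv.Perm (Fin n)) :
    (fun (x : Fin n → ℝ) i => x (s i)) ⁻¹' box B φ = box B fun i => φ (s.symm i) := by
  ext x
  simp only [Set.mem_preimage, mem_box]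
  exact ⟨fun h i => by simpa using h (s.symm i), fun h i => by simpa using h (s i)⟩

open Classical in
theorem fib_head_sortPerm {ι : Type} {n : ℕ} (S : Finset (Fin n)) (φ : Fin n → ι) (i : ι) :
    fib (headIdx (card_le_fin S) fun j => φ ((sortPerm S).symm j)) i =
      (S.filter fun j => φ j = i).card := by
  rw [fib]
  refine Finset.card_bij (fun j _ => (sortPerm S).symm (Fin.castLE (card_le_fin S) j)) ?_ ?_ ?_
  · intro j hj
    refine Finset.mem_filter.2 ⟨?_, (Finset.mem_filter.1 hj).2⟩
    rw [← sortPerm_lt]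
    simp
  · intro j _ j' _ h
    simpa using h
  · intro j hj
    rw [Finset.mem_filter] at hj
    refine ⟨⟨sortPerm S j, (sortPerm_lt S j).2 hj.1⟩, ?_, ?_⟩
    · refine Finset.mem_filter.2 ⟨Finset.mem_univ _, ?_⟩
      simpa [headIdx] using hj.2
    · simp

open Classical in
theorem fib_tail_sortPerm {ι : Type} {n : ℕ} (S : Finset (Fin n)) (φ : Fin n → ι) (i : ι) :
    fib (tailIdx (card_le_fin S) fun j => φ ((sortPerm S).symm j)) i =
      (Sᶜ.filter fun j => φ j = i).card := by
  have h1 := fib_head_add_tail (card_le_fin S) (fun j => φ ((sortPerm S).symm j)) i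
  rw [fib_head_sortPerm, fib_comp_equiv φ] at h1
  have : fib φ i = (S.filter fun j => φ j = i).card + (Sᶜ.filter fun j => φ j = i).card := by
    rw [fib, ← Finset.card_union_of_disjoint, ← Finset.filter_union, Finset.union_compl]
    exact Finset.disjoint_filter_filter disjoint_compl_right
  omega

open Classical in
-- One such permutation exists by matching the fibers; the others differ from it by the stabilizer
-- of `φ`, which permutes each fiber freely.
theorem card_perm_comp_eq {ι : Type} [Fintype ι] {n : ℕ} (φ ψ : Fin n → ι)
    (h : ∀ i, fib φ i = fib ψ i) :
    (Finset.univ.filter fun s : Equiv.Perm (Fin n) => (fun j => φ (s j)) = ψ).card =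
      ∏ i, (fib φ i).factorial := by
  have h1 : ∀ i, Nonempty ({j // ψ j = i} ≃ {j // φ j = i}) := by
    intro i
    refine ⟨Fintype.equivOfCardEq ?_⟩
    rw [Fintype.card_subtype, Fintype.card_subtype]
    exact (h i).symm
  have e := fun i => (h1 i).some
  let s₀ : Equiv.Perm (Fin n) := (Equiv.sigmaFiberEquiv ψ).symm.trans
    ((Equiv.sigmaCongrRight e).trans (Equiv.sigmaFiberEquiv φ))
  have hs₀ : ∀ j, φ (s₀ j) = ψ j := fun j => (e (ψ j) ⟨j, rfl⟩).2
  have h2 : (Finset.univ.filter fun s : Equiv.Perm (Fin n) => (fun j => φ (s j)) = ψ).card =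
      Fintype.card {g : Equiv.Perm (Fin n) // φ ∘ g = φ} := by
    rw [← Fintype.card_subtype]
    refine Fintype.card_congr ⟨fun s => ⟨s₀.symm.trans s.1, ?_⟩, fun g => ⟨s₀.trans g.1, ?_⟩,
      ?_, ?_⟩
    · funext j
      have := congrFun s.2 (s₀.symm j)
      simp only [Function.comp_apply, Equiv.trans_apply]
      rw [this, ← hs₀]
      simp
    · funext j
      have := congrFun g.2 (s₀ j)
      simp only [Function.comp_apply] at this
      simp only [Equiv.trans_apply]
      rw [this, hs₀]
    · intro s
      ext j
      simp
    · intro g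
      ext j
      simp
  rw [h2, DomMulAct.stabilizer_card]
  refine Finset.prod_congr rfl fun i _ => ?_
  rw [Fintype.card_subtype]
  rfl

/-- An alternating real identity is restated with the odd terms moved to the other side. This allows
an identity between alternating sums of infinite measures to be formulated without signed measures.
-/
theorem sum_even_eq_iff {I : Type*} [Fintype I] (e : I → ℕ) (b K : ℝ≥0) {x : I → ℝ≥0∞}
    {d : ℝ≥0∞} (hx : ∀ i, x i ≠ ∞) (hd : d ≠ ∞) :
    ∑ i, (if Even (e i) then (b : ℝ≥0∞) ^ e i else 0) * x i =
        ∑ i, (if Even (e i) then 0 else (b : ℝ≥0∞) ^ e i) * x i + K * d ↔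
      ∑ i, (-(b : ℝ)) ^ e i * (x i).toReal = K * d.toReal := by
  have h1 : ∀ i, (if Even (e i) then (b : ℝ≥0∞) ^ e i else 0) * x i ≠ ∞ := by
    intro i
    split_ifs
    · exact ENNReal.mul_ne_top (ENNReal.pow_ne_top ENNReal.coe_ne_top) (hx i)
    · simp
  have h2 : ∀ i, (if Even (e i) then 0 else (b : ℝ≥0∞) ^ e i) * x i ≠ ∞ := by
    intro i
    split_ifs
    · simp
    · exact ENNReal.mul_ne_top (ENNReal.pow_ne_top ENNReal.coe_ne_top) (hx i)
  have h3 : (K : ℝ≥0∞) * d ≠ ∞ := ENNReal.mul_ne_top ENNReal.coe_ne_top hd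
  have h4 : ∑ i, (if Even (e i) then 0 else (b : ℝ≥0∞) ^ e i) * x i ≠ ∞ :=
    ENNReal.sum_ne_top.2 fun i _ => h2 i
  rw [← ENNReal.toReal_eq_toReal_iff' (ENNReal.sum_ne_top.2 fun i _ => h1 i)
    (ENNReal.add_ne_top.2 ⟨h4, h3⟩), ENNReal.toReal_add h4 h3,
    ENNReal.toReal_sum fun i _ => h1 i, ENNReal.toReal_sum fun i _ => h2 i, ← sub_eq_iff_eq_add',
    ← Finset.sum_sub_distrib, ENNReal.toReal_mul]
  have h5 : ∀ i, ((if Even (e i) then (b : ℝ≥0∞) ^ e i else 0) * x i).toReal -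
      ((if Even (e i) then 0 else (b : ℝ≥0∞) ^ e i) * x i).toReal =
      (-(b : ℝ)) ^ e i * (x i).toReal := by
    intro i
    split_ifs with h
    · simp [h.neg_pow, ENNReal.toReal_mul]
    · simp [(Nat.not_even_iff_odd.1 h).neg_pow, ENNReal.toReal_mul]
  simp only [h5, ENNReal.coe_toReal]

theorem toReal_rise (c : ℕ) {a : ℝ≥0∞} (ha : a ≠ ∞) (l m : ℕ) :
    (rise c (a + c * l) m).toReal = rise c (a.toReal + c * l) m := by
  rw [rise, rise, ENNReal.toReal_prod]
  refine Finset.prod_congr rfl fun i _ => ?_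
  have h : ∀ k : ℕ, (c : ℝ≥0∞) * k ≠ ∞ := fun k =>
    ENNReal.mul_ne_top (ENNReal.natCast_ne_top _) (ENNReal.natCast_ne_top _)
  rw [ENNReal.toReal_add (ENNReal.add_ne_top.2 ⟨ha, h l⟩) (h i), ENNReal.toReal_add ha (h l)]
  simp

theorem measurable_elim {n m : ℕ} :
    Measurable fun p : (Fin n → ℝ) × (Fin m → ℝ) => (Sum.elim p.1 p.2 : Fin n ⊕ Fin m → ℝ) := by
  refine measurable_pi_lambda _ fun j => ?_
  rcases j with j | j
  · exact (measurable_pi_apply j).comp measurable_fst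
  · exact (measurable_pi_apply j).comp measurable_snd

theorem preimage_elim_box {ι : Type} {n m : ℕ} (B : ι → Set ℝ) (φ : Fin n ⊕ Fin m → ι) :
    (fun p : (Fin n → ℝ) × (Fin m → ℝ) => (Sum.elim p.1 p.2 : Fin n ⊕ Fin m → ℝ)) ⁻¹' box B φ =
      box B (fun j => φ (Sum.inl j)) ×ˢ box B (fun j => φ (Sum.inr j)) := by
  ext p
  simp [mem_box]

namespace Ensemble

variable {c : ℕ} {b : ℝ≥0} {α : Measure ℝ}
  {κ : (k m : ℕ) → (Fin k → ℝ) → Measure (Fin m → ℝ)} {ν : (n : ℕ) → Measure (Fin n → ℝ)}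
  {π : Measure Config} (E : Ensemble c b α κ ν π)

theorem tau_of_not {n k : ℕ} (hk : k ≤ n) {μ : Config} (hμ : ¬ IsLocFin μ) : E.tau hk μ = 0 := by
  ext s hs
  rw [tau, Kernel.comp_apply' _ _ _ hs, factKernel_of_not hμ, lintegral_zero_measure,
    Measure.coe_zero, Pi.zero_apply]

theorem tau_box_lt_top {n k : ℕ} (hk : k ≤ n) (μ : Config) (ι : Type) [Fintype ι]
    (B : ι → Set ℝ) (hB : IsCell B) (φ : Fin n → ι) : E.tau hk μ (box B φ) < ∞ := by
  by_cases hμ : IsLocFin μ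
  · rw [E.tau_box hk hμ hB]
    exact ENNReal.prod_lt_top fun i _ => ENNReal.mul_lt_top (ENNReal.natCast_lt_top _)
      (E.rise_lt_top (hB.bdd i) _ _)
  · rw [E.tau_of_not hk hμ]; simp

theorem tau_cube_lt_top {n k : ℕ} (hk : k ≤ n) (μ : Config) (R : ℕ) :
    E.tau hk μ (cube (Fin n) R) < ∞ :=
  measure_boxSystem_lt_top (E.tau_box_lt_top hk μ) (cube_mem_boxSystem _ _)

instance isSFiniteKernel_tau {n k : ℕ} (hk : k ≤ n) : IsSFiniteKernel (E.tau hk) :=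
  isSFiniteKernel_of_cube _ (E.tau_cube_lt_top hk)

/-- The kernel `tau` with the coordinates outside of `S` integrated out. -/
def tauSub {n : ℕ} (S : Finset (Fin n)) : Kernel Config (Fin n → ℝ) :=
  (E.tau (card_le_fin S)).map fun x i => x (sortPerm S i)

instance isSFiniteKernel_tauSub {n : ℕ} (S : Finset (Fin n)) : IsSFiniteKernel (E.tauSub S) := by
  unfold tauSub; infer_instance

/-- For symmetric `f` it is irrelevant which coordinates are integrated out. The version indexed by
subsets is needed because boxes are not symmetric: summing over all `S` instead of using binomial
coefficients is what factorizes over the cells. -/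
theorem lintegral_tauSub {n : ℕ} (S : Finset (Fin n)) (μ : Config) {f : (Fin n → ℝ) → ℝ≥0∞}
    (hf : Measurable f) (hs : ∀ (s : Equiv.Perm (Fin n)) x, f (fun i => x (s i)) = f x) :
    ∫⁻ z, f z ∂(E.tauSub S μ) = ∫⁻ z, f z ∂(E.tau (card_le_fin S) μ) := by
  rw [tauSub, Kernel.lintegral_map _ (measurable_comp_perm _) _ hf]
  simp only [hs]

open Classical in
theorem tauSub_box {n : ℕ} (S : Finset (Fin n)) {μ : Config} (hμ : IsLocFin μ) {ι : Type}
    [Fintype ι] {B : ι → Set ℝ} (hB : IsCell B) (φ : Fin n → ι) :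
    E.tauSub S μ (box B φ) = ∏ i,
      (((cnt (B i) μ).descFactorial (S.filter fun j => φ j = i).card : ℕ) *
        rise c (α (B i) + c * (S.filter fun j => φ j = i).card)
          (Sᶜ.filter fun j => φ j = i).card) := by
  rw [tauSub, Kernel.map_apply' _ (measurable_comp_perm _) _ (hB.measurableSet_box φ),
    box_preimage_perm, E.tau_box _ hμ hB]
  simp only [fib_head_sortPerm, fib_tail_sortPerm]

/-- The measure `E[tauSub S ⊗ tauSub S']`. -/
def pair {n : ℕ} (S S' : Finset (Fin n)) : Measure (Fin n ⊕ Fin n → ℝ) :=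
  (π.bind (E.tauSub S ×ₖ E.tauSub S')).map fun p => Sum.elim p.1 p.2

theorem lintegral_pair {n : ℕ} (S S' : Finset (Fin n)) {f g : (Fin n → ℝ) → ℝ≥0∞}
    (hf : Measurable f) (hg : Measurable g) :
    ∫⁻ w, f (fun j => w (Sum.inl j)) * g (fun j => w (Sum.inr j)) ∂(E.pair S S') =
      ∫⁻ μ, (∫⁻ z, f z ∂(E.tauSub S μ)) * ∫⁻ z, g z ∂(E.tauSub S' μ) ∂π := by
  have h1 : Measurable fun w : Fin n ⊕ Fin n → ℝ =>
      f (fun j => w (Sum.inl j)) * g (fun j => w (Sum.inr j)) :=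
    (hf.comp (measurable_pi_lambda _ fun _ => measurable_pi_apply _)).mul
      (hg.comp (measurable_pi_lambda _ fun _ => measurable_pi_apply _))
  have h2 : Measurable fun p : (Fin n → ℝ) × (Fin n → ℝ) => f p.1 * g p.2 :=
    (hf.comp measurable_fst).mul (hg.comp measurable_snd)
  rw [pair, lintegral_map h1 measurable_elim]
  simp only [Sum.elim_inl, Sum.elim_inr]
  rw [Measure.lintegral_bind (Kernel.measurable _).aemeasurable h2.aemeasurable]
  refine lintegral_congr fun μ => ?_
  rw [Kernel.prod_apply, lintegral_prod_mul hf.aemeasurable hg.aemeasurable]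

theorem pair_box {n : ℕ} (S S' : Finset (Fin n)) {ι : Type} [Fintype ι] {B : ι → Set ℝ}
    (hB : IsCell B) (φ : Fin n ⊕ Fin n → ι) :
    E.pair S S' (box B φ) = ∫⁻ μ, E.tauSub S μ (box B fun j => φ (Sum.inl j)) *
      E.tauSub S' μ (box B fun j => φ (Sum.inr j)) ∂π := by
  rw [pair, Measure.map_apply measurable_elim (hB.measurableSet_box φ), preimage_elim_box,
    Measure.bind_apply ((hB.measurableSet_box _).prod (hB.measurableSet_box _))
      (Kernel.measurable _).aemeasurable]
  refine lintegral_congr fun μ => ?_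
  rw [Kernel.prod_apply, Measure.prod_prod]

include E in
theorem integral_fall {B : Set ℝ} (hB : MeasurableSet B) (hb : Bornology.IsBounded B) (k : ℕ) :
    Integrable (fun μ => fall (cnt B μ) k) π ∧
      ∫ μ, fall (cnt B μ) k ∂π = (b : ℝ) ^ k * rise c (α B).toReal k := by
  have h := E.fact B hB hb k
  have hm : Measurable fun μ : Config => (((cnt B μ).descFactorial k : ℕ) : ℝ≥0∞) :=
    (measurable_from_nat (f := fun N => ((N.descFactorial k : ℕ) : ℝ≥0∞))).comp
      (measurable_cnt hB)
  have hlt : ∫⁻ μ, (((cnt B μ).descFactorial k : ℕ) : ℝ≥0∞) ∂π ≠ ∞ := by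
    rw [h]
    exact ENNReal.mul_ne_top (ENNReal.pow_ne_top ENNReal.coe_ne_top)
      (Intertwining.rise_lt_top (E.fin B hb) k).ne
  have hi := integrable_toReal_of_lintegral_ne_top hm.aemeasurable hlt
  have hv := integral_toReal hm.aemeasurable (Eventually.of_forall fun μ =>
    ENNReal.natCast_lt_top ((cnt B μ).descFactorial k)) (μ := π)
  simp only [ENNReal.toReal_natCast, natCast_descFactorial] at hi hv
  refine ⟨hi, ?_⟩
  have := toReal_rise c (E.fin B hb).ne 0 k
  rw [hv, h, ENNReal.toReal_mul, ENNReal.toReal_pow, ENNReal.coe_toReal]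
  simp only [Nat.cast_zero, mul_zero, add_zero] at this
  rw [this]

include E in
theorem integrable_cnt_factor {B : Set ℝ} (hB : MeasurableSet B) (hb : Bornology.IsBounded B)
    (k l k' l' : ℕ) : Integrable (fun μ => (rise c ((α B).toReal + c * k) l * fall (cnt B μ) k) *
      (rise c ((α B).toReal + c * k') l' * fall (cnt B μ) k')) π := by
  have := (integrable_fall_mul_fall (fun k => (E.integral_fall hB hb k).1) k k').const_mul
    (rise c ((α B).toReal + c * k) l * rise c ((α B).toReal + c * k') l')
  refine this.congr (Eventually.of_forall fun μ => ?_)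
  simp only
  ring

open Classical in
theorem pair_box_toReal {n : ℕ} (S S' : Finset (Fin n)) {ι : Type} [Fintype ι] {B : ι → Set ℝ}
    (hB : IsCell B) (φ : Fin n ⊕ Fin n → ι) :
    E.pair S S' (box B φ) ≠ ∞ ∧ (E.pair S S' (box B φ)).toReal = ∏ i, ∫ μ,
      (rise c ((α (B i)).toReal + c * (S.filter fun j => φ (Sum.inl j) = i).card)
          (Sᶜ.filter fun j => φ (Sum.inl j) = i).card *
        fall (cnt (B i) μ) (S.filter fun j => φ (Sum.inl j) = i).card) *
      (rise c ((α (B i)).toReal + c * (S'.filter fun j => φ (Sum.inr j) = i).card)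
          (S'ᶜ.filter fun j => φ (Sum.inr j) = i).card *
        fall (cnt (B i) μ) (S'.filter fun j => φ (Sum.inr j) = i).card) ∂π := by
  set G : ι → ℕ → ℝ := fun i N =>
    (rise c ((α (B i)).toReal + c * (S.filter fun j => φ (Sum.inl j) = i).card)
          (Sᶜ.filter fun j => φ (Sum.inl j) = i).card *
        fall N (S.filter fun j => φ (Sum.inl j) = i).card) *
      (rise c ((α (B i)).toReal + c * (S'.filter fun j => φ (Sum.inr j) = i).card)
          (S'ᶜ.filter fun j => φ (Sum.inr j) = i).card *
        fall N (S'.filter fun j => φ (Sum.inr j) = i).card) with hG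
  have hG0 : ∀ i N, 0 ≤ G i N := by
    intro i N
    simp only [hG, ← natCast_descFactorial]
    have h0 : ∀ k l : ℕ, 0 ≤ rise c ((α (B i)).toReal + c * k) l := fun k l =>
      Finset.prod_nonneg fun _ _ => by positivity
    have h1 := h0 (S.filter fun j => φ (Sum.inl j) = i).card
      (Sᶜ.filter fun j => φ (Sum.inl j) = i).card
    have h2 := h0 (S'.filter fun j => φ (Sum.inr j) = i).card
      (S'ᶜ.filter fun j => φ (Sum.inr j) = i).card
    positivity
  have hGi : ∀ i, Integrable (fun μ => G i (cnt (B i) μ)) π := fun i =>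
    E.integrable_cnt_factor (hB.meas i) (hB.bdd i) _ _ _ _
  have h1 : E.pair S S' (box B φ) = ∫⁻ μ, ∏ i, ENNReal.ofReal (G i (cnt (B i) μ)) ∂π := by
    rw [E.pair_box S S' hB φ]
    refine lintegral_congr_ae ?_
    filter_upwards [E.locFin] with μ hμ
    rw [E.tauSub_box S hμ hB, E.tauSub_box S' hμ hB, ← Finset.prod_mul_distrib]
    refine Finset.prod_congr rfl fun i _ => ?_
    have hr : ∀ k l : ℕ, rise c (α (B i) + c * k) l ≠ ∞ := fun k l =>
      (E.rise_lt_top (hB.bdd i) k l).ne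
    rw [← ENNReal.ofReal_toReal (a := _ * _)]
    · congr 1
      simp only [hG, ENNReal.toReal_mul, ENNReal.toReal_natCast, natCast_descFactorial,
        toReal_rise c (E.fin _ (hB.bdd i)).ne]
      ring
    · exact ENNReal.mul_ne_top (ENNReal.mul_ne_top (ENNReal.natCast_ne_top _) (hr _ _))
        (ENNReal.mul_ne_top (ENNReal.natCast_ne_top _) (hr _ _))
  have h2 := iIndepFun.comp (E.indep ι B hB) (fun i N => ENNReal.ofReal (G i N))
    (fun _ => measurable_from_nat)
  have h3 := lintegral_prod_eq_prod_lintegral_of_indepFun Finset.univ _ h2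
    (fun i => measurable_from_nat.comp (measurable_cnt (hB.meas i)))
  simp only [Function.comp_apply] at h3
  have h4 : ∀ i, ∫⁻ μ, ENNReal.ofReal (G i (cnt (B i) μ)) ∂π =
      ENNReal.ofReal (∫ μ, G i (cnt (B i) μ) ∂π) := fun i =>
    (ofReal_integral_eq_lintegral_ofReal (hGi i) (Eventually.of_forall fun μ => hG0 i _)).symm
  rw [h1, h3]
  simp only [h4]
  refine ⟨ENNReal.prod_ne_top fun i _ => ENNReal.ofReal_ne_top, ?_⟩
  rw [ENNReal.toReal_prod]
  exact Finset.prod_congr rfl fun i _ =>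
    ENNReal.toReal_ofReal (integral_nonneg fun μ => hG0 i _)

/-- The measure on the union of the graphs of the permutations of the coordinates. -/
def diag (ν : (n : ℕ) → Measure (Fin n → ℝ)) (n : ℕ) : Measure (Fin n ⊕ Fin n → ℝ) :=
  ∑ s : Equiv.Perm (Fin n), (ν n).map fun x => Sum.elim (fun i => x (s.symm i)) x

theorem measurable_graph {n : ℕ} (s : Equiv.Perm (Fin n)) : Measurable fun x : Fin n → ℝ =>
    (Sum.elim (fun i => x (s.symm i)) x : Fin n ⊕ Fin n → ℝ) :=
  measurable_elim.comp ((measurable_comp_perm s.symm).prodMk measurable_id)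

theorem lintegral_diag {n : ℕ} {f : (Fin n → ℝ) → ℝ≥0∞} (hf : Measurable f)
    (hs : ∀ (s : Equiv.Perm (Fin n)) x, f (fun i => x (s i)) = f x) :
    ∫⁻ w, f (fun j => w (Sum.inl j)) * f (fun j => w (Sum.inr j)) ∂(diag ν n) =
      n.factorial * ∫⁻ x, f x * f x ∂(ν n) := by
  have h1 : Measurable fun w : Fin n ⊕ Fin n → ℝ =>
      f (fun j => w (Sum.inl j)) * f (fun j => w (Sum.inr j)) :=
    (hf.comp (measurable_pi_lambda _ fun _ => measurable_pi_apply _)).mul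
      (hf.comp (measurable_pi_lambda _ fun _ => measurable_pi_apply _))
  rw [diag, lintegral_finsetSum_measure]
  have h2 : ∀ s : Equiv.Perm (Fin n), ∫⁻ w, f (fun j => w (Sum.inl j)) *
      f (fun j => w (Sum.inr j)) ∂((ν n).map fun x => Sum.elim (fun i => x (s.symm i)) x) =
      ∫⁻ x, f x * f x ∂(ν n) := by
    intro s
    rw [lintegral_map h1 (measurable_graph s)]
    simp only [Sum.elim_inl, Sum.elim_inr, hs]
  simp only [h2]
  rw [Finset.sum_const, Finset.card_univ, Fintype.card_perm, Fintype.card_fin, nsmul_eq_mul]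

include E in
theorem diag_box {n : ℕ} {ι : Type} [Fintype ι] {B : ι → Set ℝ} (hB : IsCell B)
    (φ : Fin n ⊕ Fin n → ι) : diag ν n (box B φ) ≠ ∞ ∧ (diag ν n (box B φ)).toReal =
      ∏ i, if fib (fun j => φ (Sum.inl j)) i = fib (fun j => φ (Sum.inr j)) i then
        (fib (fun j => φ (Sum.inl j)) i).factorial *
          rise c (α (B i)).toReal (fib (fun j => φ (Sum.inl j)) i) else 0 := by
  classical
  set φ₁ : Fin n → ι := fun j => φ (Sum.inl j)
  set φ₂ : Fin n → ι := fun j => φ (Sum.inr j)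
  have h1 : ∀ s : Equiv.Perm (Fin n), (ν n).map (fun x => Sum.elim (fun i => x (s.symm i)) x)
      (box B φ) = if (fun j => φ₁ (s j)) = φ₂ then ν n (box B φ₂) else 0 := by
    intro s
    rw [Measure.map_apply (measurable_graph s) (hB.measurableSet_box φ)]
    have : (fun x : Fin n → ℝ => (Sum.elim (fun i => x (s.symm i)) x : Fin n ⊕ Fin n → ℝ)) ⁻¹'
        box B φ = box B (fun j => φ₁ (s j)) ∩ box B φ₂ := by
      have h := box_preimage_perm B φ₁ s.symm
      rw [Equiv.symm_symm] at h
      rw [← h]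
      ext x
      simp [mem_box, φ₁, φ₂]
    rw [this]
    split_ifs with hs
    · rw [hs, Set.inter_self]
    · rw [(hB.disjoint_box hs).inter_eq, measure_empty]
  have h2 : diag ν n (box B φ) = (Finset.univ.filter fun s : Equiv.Perm (Fin n) =>
      (fun j => φ₁ (s j)) = φ₂).card * ν n (box B φ₂) := by
    rw [diag, Measure.finsetSum_apply]
    simp only [h1]
    rw [← Finset.sum_filter, Finset.sum_const, nsmul_eq_mul]
  refine ⟨?_, ?_⟩
  · rw [h2]
    exact ENNReal.mul_ne_top (ENNReal.natCast_ne_top _) (E.ν_box_lt_top n hB φ₂).ne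
  rw [h2]
  by_cases h : ∀ i, fib φ₁ i = fib φ₂ i
  · rw [card_perm_comp_eq φ₁ φ₂ h, E.ν_box n ι B hB, ENNReal.toReal_mul, ENNReal.toReal_prod,
      ENNReal.toReal_natCast, Nat.cast_prod, ← Finset.prod_mul_distrib]
    refine Finset.prod_congr rfl fun i _ => ?_
    have := toReal_rise c (E.fin _ (hB.bdd i)).ne 0 (fib φ₂ i)
    simp only [Nat.cast_zero, mul_zero, add_zero] at this
    rw [if_pos (h i), this, h i]
  · push Not at h
    obtain ⟨i, hi⟩ := h
    rw [Finset.prod_eq_zero (Finset.mem_univ i) (if_neg hi), Finset.filter_false_of_mem]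
    · simp
    · rintro s - hs
      refine hi ?_
      rw [← hs, fib_comp_equiv φ₁ s]

/-- Independence makes each summand a product over cells. Summing over the two subsets produces in
each cell the integral of a product of two `orthPoly`, whose degrees are the numbers of coordinates
of either half in that cell. Orthogonality then leaves exactly the mass of the permutation graphs.
-/
theorem sum_pair_box {n : ℕ} {ι : Type} [Fintype ι] {B : ι → Set ℝ} (hB : IsCell B)
    (φ : Fin n ⊕ Fin n → ι) :
    ∑ q : Finset (Fin n) × Finset (Fin n), (-(b : ℝ)) ^ (q.1ᶜ.card + q.2ᶜ.card) *
      (E.pair q.1 q.2 (box B φ)).toReal =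
    (b * (1 + c * b) : ℝ) ^ n * (diag ν n (box B φ)).toReal := by
  classical
  set φ₁ : Fin n → ι := fun j => φ (Sum.inl j)
  set φ₂ : Fin n → ι := fun j => φ (Sum.inr j)
  have hi : ∀ i k, Integrable (fun μ => fall (cnt (B i) μ) k) π := fun i k =>
    (E.integral_fall (hB.meas i) (hB.bdd i) k).1
  have hv : ∀ i k, ∫ μ, fall (cnt (B i) μ) k ∂π = (b : ℝ) ^ k * rise c (α (B i)).toReal k :=
    fun i k => (E.integral_fall (hB.meas i) (hB.bdd i) k).2
  let h : ι → ℕ → ℕ → Config → ℝ := fun i k l μ =>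
    (-(b : ℝ)) ^ l * rise c ((α (B i)).toReal + c * k) l * fall (cnt (B i) μ) k
  have hh : ∀ i n μ, ∑ k ∈ Finset.range (n + 1), (n.choose k : ℝ) * h i k (n - k) μ =
      orthPoly c b (α (B i)).toReal n (cnt (B i) μ) := fun _ _ _ => rfl
  have hhi : ∀ i k l k' l', Integrable (fun μ => h i k l μ * h i k' l' μ) π := by
    intro i k l k' l'
    refine ((E.integrable_cnt_factor (hB.meas i) (hB.bdd i) k l k' l').const_mul
      ((-(b : ℝ)) ^ l * (-(b : ℝ)) ^ l')).congr (Eventually.of_forall fun μ => ?_)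
    simp only [h]
    ring
  have hsplit : ∀ (S : Finset (Fin n)) (ψ : Fin n → ι),
      (-(b : ℝ)) ^ S.card = ∏ i, (-(b : ℝ)) ^ (S.filter fun j => ψ j = i).card := by
    intro S ψ
    rw [Finset.prod_pow_eq_pow_sum]
    congr 1
    exact Finset.card_eq_sum_card_fiberwise fun _ _ => Finset.mem_coe.2 (Finset.mem_univ _)
  have h1 : ∀ q : Finset (Fin n) × Finset (Fin n), (-(b : ℝ)) ^ (q.1ᶜ.card + q.2ᶜ.card) *
      (E.pair q.1 q.2 (box B φ)).toReal = ∏ i, ∫ μ,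
        h i (q.1.filter fun j => φ₁ j = i).card (q.1ᶜ.filter fun j => φ₁ j = i).card μ *
        h i (q.2.filter fun j => φ₂ j = i).card (q.2ᶜ.filter fun j => φ₂ j = i).card μ ∂π := by
    intro q
    rw [pow_add, hsplit q.1ᶜ φ₁, hsplit q.2ᶜ φ₂, (E.pair_box_toReal q.1 q.2 hB φ).2,
      ← Finset.prod_mul_distrib, ← Finset.prod_mul_distrib]
    refine Finset.prod_congr rfl fun i _ => ?_
    rw [← integral_const_mul]
    refine integral_congr_ae (Eventually.of_forall fun μ => ?_)
    simp only [h]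
    ring
  simp only [h1]
  rw [Fintype.sum_prod_type]
  have h2 : ∀ S : Finset (Fin n), ∑ S' : Finset (Fin n), ∏ i, ∫ μ,
        h i (S.filter fun j => φ₁ j = i).card (Sᶜ.filter fun j => φ₁ j = i).card μ *
        h i (S'.filter fun j => φ₂ j = i).card (S'ᶜ.filter fun j => φ₂ j = i).card μ ∂π =
      ∏ i, ∫ μ, h i (S.filter fun j => φ₁ j = i).card (Sᶜ.filter fun j => φ₁ j = i).card μ *
        orthPoly c b (α (B i)).toReal (fib φ₂ i) (cnt (B i) μ) ∂π := by
    intro S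
    rw [sum_finset_prod φ₂ fun i k' l' => ∫ μ,
      h i (S.filter fun j => φ₁ j = i).card (Sᶜ.filter fun j => φ₁ j = i).card μ *
        h i k' l' μ ∂π]
    refine Finset.prod_congr rfl fun i _ => ?_
    simp only [← integral_const_mul]
    rw [← integral_finsetSum _ fun k _ => (hhi _ _ _ _ _).const_mul _]
    refine integral_congr_ae (Eventually.of_forall fun μ => ?_)
    simp only [← hh, Finset.mul_sum]
    exact Finset.sum_congr rfl fun k _ => by ring
  simp only [h2]
  rw [sum_finset_prod φ₁ fun i k l => ∫ μ,
      h i k l μ * orthPoly c b (α (B i)).toReal (fib φ₂ i) (cnt (B i) μ) ∂π]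
  rw [(E.diag_box hB φ).2]
  have hn : (b * (1 + c * b) : ℝ) ^ n = ∏ i, (b * (1 + c * b) : ℝ) ^ fib φ₁ i := by
    rw [Finset.prod_pow_eq_pow_sum, sum_fib, Fintype.card_fin]
  rw [hn, ← Finset.prod_mul_distrib]
  refine Finset.prod_congr rfl fun i _ => ?_
  have h3 : ∀ k l, Integrable (fun μ => h i k l μ *
      orthPoly c b (α (B i)).toReal (fib φ₂ i) (cnt (B i) μ)) π := by
    intro k l
    simp only [← hh, Finset.mul_sum]
    refine integrable_finsetSum _ fun k' _ => ?_
    refine ((hhi i k l k' (fib φ₂ i - k')).const_mul ((fib φ₂ i).choose k' : ℝ)).congr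
      (Eventually.of_forall fun μ => ?_)
    simp only
    ring
  have h4 : ∑ k ∈ Finset.range (fib φ₁ i + 1), ((fib φ₁ i).choose k : ℝ) * ∫ μ,
      h i k (fib φ₁ i - k) μ * orthPoly c b (α (B i)).toReal (fib φ₂ i) (cnt (B i) μ) ∂π =
      ∫ μ, orthPoly c b (α (B i)).toReal (fib φ₁ i) (cnt (B i) μ) *
        orthPoly c b (α (B i)).toReal (fib φ₂ i) (cnt (B i) μ) ∂π := by
    simp only [← integral_const_mul]
    rw [← integral_finsetSum _ fun k _ => (h3 _ _).const_mul _]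
    refine integral_congr_ae (Eventually.of_forall fun μ => ?_)
    simp only [← hh i (fib φ₁ i), Finset.sum_mul]
    exact Finset.sum_congr rfl fun k _ => by ring
  rw [h4, integral_orthPoly_mul_orthPoly (hi i) (hv i)]
  split_ifs
  · ring
  · simp

end Ensemble

/-! ### The polynomials of the ensemble and their isometry -/

namespace Ensemble

variable {c : ℕ} {b : ℝ≥0} {α : Measure ℝ}
  {κ : (k m : ℕ) → (Fin k → ℝ) → Measure (Fin m → ℝ)} {ν : (n : ℕ) → Measure (Fin n → ℝ)}
  {π : Measure Config} (E : Ensemble c b α κ ν π)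

/-- The box identity `sum_pair_box` is extended to all measurable sets. The terms of odd exponent
stand on the right, so that both sides are measures, finite on boxes. -/
theorem sum_pair (n : ℕ) :
    ∑ q : Finset (Fin n) × Finset (Fin n), (if Even (q.1ᶜ.card + q.2ᶜ.card) then
        (b : ℝ≥0∞) ^ (q.1ᶜ.card + q.2ᶜ.card) else 0) • E.pair q.1 q.2 =
      ∑ q : Finset (Fin n) × Finset (Fin n), (if Even (q.1ᶜ.card + q.2ᶜ.card) then 0 else
        (b : ℝ≥0∞) ^ (q.1ᶜ.card + q.2ᶜ.card)) • E.pair q.1 q.2 +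
        (((b * (1 + c * b)) ^ n : ℝ≥0) : ℝ≥0∞) • diag ν n := by
  refine ext_of_box (fun ι _ B hB φ => ?_) fun ι _ B hB φ => ?_
  · simp only [Measure.add_apply, Measure.finsetSum_apply, Measure.smul_apply, smul_eq_mul]
    have h := E.sum_pair_box hB φ
    have key := sum_even_eq_iff
      (fun q : Finset (Fin n) × Finset (Fin n) => q.1ᶜ.card + q.2ᶜ.card) b
      ((b * (1 + c * b)) ^ n) (x := fun q => E.pair q.1 q.2 (box B φ)) (d := diag ν n (box B φ))
      (fun q => (E.pair_box_toReal q.1 q.2 hB φ).1) (E.diag_box hB φ).1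
    have hK : (((b * (1 + c * b)) ^ n : ℝ≥0) : ℝ) = ((b : ℝ) * (1 + c * b)) ^ n := by push_cast; rfl
    rw [← hK] at h
    exact key.2 h
  · rw [Measure.finsetSum_apply]
    refine ENNReal.sum_lt_top.2 fun q _ => ?_
    rw [Measure.smul_apply, smul_eq_mul]
    refine ENNReal.mul_lt_top ?_ (E.pair_box_toReal q.1 q.2 hB φ).1.lt_top
    split_ifs
    · exact ENNReal.pow_lt_top ENNReal.coe_lt_top
    · exact ENNReal.zero_lt_top

theorem pair_cube_lt_top {n : ℕ} (S S' : Finset (Fin n)) (R : ℕ) :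
    E.pair S S' (cube (Fin n ⊕ Fin n) R) < ∞ :=
  measure_boxSystem_lt_top (fun _ _ _ hB φ => (E.pair_box_toReal S S' hB φ).1.lt_top)
    (cube_mem_boxSystem _ _)

include E in
theorem ν_cube_lt_top (n R : ℕ) : ν n (cube (Fin n) R) < ∞ :=
  measure_boxSystem_lt_top (fun _ _ _ hB φ => E.ν_box_lt_top n hB φ) (cube_mem_boxSystem _ _)

/-- The integral of `f` with respect to `tau`, which is the integral with respect to the
factorial measure of degree `k` of the integral of `f` over the last `n - k` variables. -/
def level {n : ℕ} (f : (Fin n → ℝ) → ℝ) (k : ℕ) (μ : Config) : ℝ :=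
  if h : k ≤ n then ∫ z, f z ∂(E.tau h μ) else 0

/-- The polynomial of degree `n` with leading coefficient `f`. -/
def poly {n : ℕ} (f : (Fin n → ℝ) → ℝ) (μ : Config) : ℝ :=
  ∑ k ∈ Finset.range (n + 1), (n.choose k : ℝ) * ((-(b : ℝ)) ^ (n - k) * E.level f k μ)

theorem level_of_le {n k : ℕ} (h : k ≤ n) (f : (Fin n → ℝ) → ℝ) (μ : Config) :
    E.level f k μ = ∫ z, f z ∂(E.tau h μ) := dif_pos h

theorem measurable_level {n : ℕ} {f : (Fin n → ℝ) → ℝ} (hf : Measurable f) (k : ℕ) :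
    Measurable (E.level f k) := by
  unfold level
  split_ifs with h
  · exact hf.stronglyMeasurable.integral_kernel.measurable
  · exact measurable_const

theorem measurable_poly {n : ℕ} {f : (Fin n → ℝ) → ℝ} (hf : Measurable f) :
    Measurable (E.poly f) :=
  Finset.measurable_fun_sum _ fun k _ => ((E.measurable_level hf k).const_mul _).const_mul _

theorem poly_eq_sum {n : ℕ} (f : (Fin n → ℝ) → ℝ) (μ : Config) :
    E.poly f μ = ∑ S : Finset (Fin n), (-(b : ℝ)) ^ Sᶜ.card * E.level f S.card μ := by
  have := Finset.sum_powerset_apply_card (x := (Finset.univ : Finset (Fin n)))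
    (fun k => (-(b : ℝ)) ^ (n - k) * E.level f k μ)
  rw [Finset.card_univ, Fintype.card_fin, Finset.powerset_univ] at this
  simp only [Finset.card_compl, Fintype.card_fin]
  rw [this, poly]
  simp only [nsmul_eq_mul]

theorem ae_integrable_tau {n : ℕ} {f : (Fin n → ℝ) → ℝ} (hf : Measurable f)
    (hi : Integrable f (ν n)) : ∀ᵐ μ ∂π, ∀ k (h : k ≤ n), Integrable f (E.tau h μ) := by
  refine ae_all_iff.2 fun k => ?_
  by_cases h : k ≤ n
  · have h1 : ∫⁻ μ, ∫⁻ z, ‖f z‖ₑ ∂(E.tau h μ) ∂π ≠ ∞ := by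
      rw [E.lintegral_lintegral_tau h hf.enorm]
      exact ENNReal.mul_ne_top (ENNReal.pow_ne_top ENNReal.coe_ne_top) hi.2.ne
    filter_upwards [ae_lt_top hf.enorm.lintegral_kernel h1] with μ hμ _
    exact ⟨hf.aestronglyMeasurable, hμ⟩
  · exact Eventually.of_forall fun μ h' => absurd h' h

theorem poly_add {n : ℕ} {f g : (Fin n → ℝ) → ℝ} (hf : Measurable f) (hg : Measurable g)
    (hfi : Integrable f (ν n)) (hgi : Integrable g (ν n)) :
    E.poly (f + g) =ᵐ[π] E.poly f + E.poly g := by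
  filter_upwards [E.ae_integrable_tau hf hfi, E.ae_integrable_tau hg hgi] with μ h1 h2
  simp only [Pi.add_apply, poly]
  rw [← Finset.sum_add_distrib]
  refine Finset.sum_congr rfl fun k hk => ?_
  have hk' : k ≤ n := Nat.lt_succ_iff.1 (Finset.mem_range.1 hk)
  rw [E.level_of_le hk', E.level_of_le hk', E.level_of_le hk',
    integral_add' (h1 k hk') (h2 k hk')]
  ring

theorem poly_smul {n : ℕ} (a : ℝ) (f : (Fin n → ℝ) → ℝ) : E.poly (a • f) = a • E.poly f := by
  ext μ
  simp only [Pi.smul_apply, poly, smul_eq_mul, Finset.mul_sum]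
  refine Finset.sum_congr rfl fun k hk => ?_
  have hk' : k ≤ n := Nat.lt_succ_iff.1 (Finset.mem_range.1 hk)
  rw [E.level_of_le hk', E.level_of_le hk']
  simp only [Pi.smul_apply, smul_eq_mul, integral_const_mul]
  ring

theorem poly_sub {n : ℕ} {f g : (Fin n → ℝ) → ℝ} (hf : Measurable f) (hg : Measurable g)
    (hfi : Integrable f (ν n)) (hgi : Integrable g (ν n)) :
    E.poly (f - g) =ᵐ[π] E.poly f - E.poly g := by
  have h := E.poly_add hf (hg.const_smul (-1 : ℝ)) hfi (hgi.smul (-1 : ℝ))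
  rw [E.poly_smul] at h
  simpa [sub_eq_add_neg] using h

/-- Each level is bounded in `L¹` because the mean of `tau` is a multiple of `ν n`. This continuity
identifies the `L²` extension with the explicit formula on `L¹ ∩ L²`. -/
theorem lintegral_enorm_poly_le {n : ℕ} {f : (Fin n → ℝ) → ℝ} (hf : Measurable f) :
    ∫⁻ μ, ‖E.poly f μ‖ₑ ∂π ≤ (∑ k ∈ Finset.range (n + 1),
      ((n.choose k : ℝ≥0∞) * (b ^ (n - k) * b ^ k))) * ∫⁻ x, ‖f x‖ₑ ∂(ν n) := by
  have h1 : ∀ μ, ‖E.poly f μ‖ₑ ≤ ∑ k ∈ Finset.range (n + 1),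
      ((n.choose k : ℝ≥0∞) * (b ^ (n - k) * ‖E.level f k μ‖ₑ)) := by
    intro μ
    refine (enorm_sum_le _ _).trans_eq (Finset.sum_congr rfl fun k _ => ?_)
    rw [enorm_mul, enorm_mul, enorm_pow, enorm_neg]
    have hb : ‖(b : ℝ)‖ₑ = b := by rw [Real.enorm_eq_ofReal b.coe_nonneg, ENNReal.ofReal_coe_nnreal]
    have hn : ‖(n.choose k : ℝ)‖ₑ = n.choose k := by
      rw [Real.enorm_eq_ofReal (Nat.cast_nonneg _), ENNReal.ofReal_natCast]
    rw [hb, hn]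
  have h2 : ∀ k ∈ Finset.range (n + 1), ∫⁻ μ, ‖E.level f k μ‖ₑ ∂π ≤
      (b : ℝ≥0∞) ^ k * ∫⁻ x, ‖f x‖ₑ ∂(ν n) := by
    intro k hk
    have hk' : k ≤ n := Nat.lt_succ_iff.1 (Finset.mem_range.1 hk)
    rw [← E.lintegral_lintegral_tau hk' hf.enorm]
    refine lintegral_mono fun μ => ?_
    rw [E.level_of_le hk']
    exact enorm_integral_le_lintegral_enorm _
  refine (lintegral_mono h1).trans ?_
  rw [lintegral_finsetSum _ fun k _ =>
    ((E.measurable_level hf k).enorm.const_mul _).const_mul _, Finset.sum_mul]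
  refine Finset.sum_le_sum fun k hk => ?_
  rw [lintegral_const_mul _ ((E.measurable_level hf k).enorm.const_mul _),
    lintegral_const_mul _ (E.measurable_level hf k).enorm, mul_assoc, mul_assoc]
  gcongr
  exact h2 k hk

/-- The isometry property of the polynomials, for nonnegative bounded functions with bounded
support. -/
theorem integral_poly_sq {n : ℕ} {f : (Fin n → ℝ) → ℝ} (hf : IsTest f) (hs : IsSymm f)
    (h0 : ∀ x, 0 ≤ f x) : Integrable (fun μ => E.poly f μ ^ 2) π ∧
      ∫ μ, E.poly f μ ^ 2 ∂π =
        ((b * (1 + c * b)) ^ n * n.factorial : ℝ) * (∫⁻ x, ‖f x‖ₑ ^ 2 ∂(ν n)).toReal := by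
  classical
  obtain ⟨hfm, ⟨C, hC⟩, hbd⟩ := hf
  obtain ⟨R, hR⟩ := exists_subset_cube hbd
  set F : (Fin n → ℝ) → ℝ≥0∞ := fun x => ‖f x‖ₑ with hF
  have hFm : Measurable F := hfm.enorm
  have hFs : ∀ (s : Equiv.Perm (Fin n)) x, F (fun i => x (s i)) = F x := by
    intro s x; simp only [hF, hs s x]
  have hFC : ∀ x, F x ≤ ENNReal.ofReal C := by
    intro x
    simp only [hF, ← ofReal_norm]
    exact ENNReal.ofReal_le_ofReal (hC x)
  have hFR : ∀ x, x ∉ cube (Fin n) R → F x = 0 := by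
    intro x hx
    have : f x = 0 := by
      by_contra h
      exact hx (hR h)
    simp [hF, this]
  set L : Finset (Fin n) → Config → ℝ≥0∞ := fun S μ => ∫⁻ z, F z ∂(E.tau (card_le_fin S) μ)
  have hLm : ∀ S, Measurable (L S) := fun S => hFm.lintegral_kernel
  have hLlt : ∀ S μ, L S μ < ∞ := by
    intro S μ
    have : ∀ z, F z ≤ (cube (Fin n) R).indicator (fun _ => ENNReal.ofReal C) z := by
      intro z
      by_cases hz : z ∈ cube (Fin n) R
      · rw [Set.indicator_of_mem hz]; exact hFC z
      · rw [hFR z hz]; exact zero_le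
    refine (lintegral_mono this).trans_lt ?_
    rw [lintegral_indicator_const (measurableSet_cube _ _)]
    exact ENNReal.mul_lt_top ENNReal.ofReal_lt_top (E.tau_cube_lt_top _ μ R)
  have hlev : ∀ S μ, E.level f S.card μ = (L S μ).toReal := by
    intro S μ
    rw [E.level_of_le (card_le_fin S), integral_eq_lintegral_of_nonneg_ae
      (Eventually.of_forall h0) hfm.aestronglyMeasurable]
    congr 1
    refine lintegral_congr fun z => ?_
    simp only [hF, Real.enorm_eq_ofReal (h0 z)]
  have hpair : ∀ S S', ∫⁻ w, F (fun j => w (Sum.inl j)) * F (fun j => w (Sum.inr j))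
      ∂(E.pair S S') = ∫⁻ μ, L S μ * L S' μ ∂π := by
    intro S S'
    rw [E.lintegral_pair S S' hFm hFm]
    simp only [E.lintegral_tauSub _ _ hFm hFs, L]
  have hpfin : ∀ S S', ∫⁻ μ, L S μ * L S' μ ∂π ≠ ∞ := by
    intro S S'
    rw [← hpair]
    have : ∀ w : Fin n ⊕ Fin n → ℝ, F (fun j => w (Sum.inl j)) * F (fun j => w (Sum.inr j)) ≤
        (cube (Fin n ⊕ Fin n) R).indicator
          (fun _ => ENNReal.ofReal C * ENNReal.ofReal C) w := by
      intro w
      by_cases hw : w ∈ cube (Fin n ⊕ Fin n) R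
      · rw [Set.indicator_of_mem hw]; exact mul_le_mul' (hFC _) (hFC _)
      · by_cases h1 : (fun j => w (Sum.inl j)) ∈ cube (Fin n) R
        · rw [hFR (fun j => w (Sum.inr j)), mul_zero]
          · exact zero_le
          · intro h2
            refine hw fun j _ => ?_
            rcases j with j | j
            · exact h1 j trivial
            · exact h2 j trivial
        · rw [hFR _ h1, zero_mul]; exact zero_le
    refine ((lintegral_mono this).trans_lt ?_).ne
    rw [lintegral_indicator_const (measurableSet_cube _ _)]
    exact ENNReal.mul_lt_top (ENNReal.mul_lt_top ENNReal.ofReal_lt_top ENNReal.ofReal_lt_top)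
      (E.pair_cube_lt_top S S' R)
  have hLi : ∀ S S', Integrable (fun μ => (L S μ).toReal * (L S' μ).toReal) π := by
    intro S S'
    have := integrable_toReal_of_lintegral_ne_top ((hLm S).mul (hLm S')).aemeasurable
      (hpfin S S')
    simpa only [Pi.mul_apply, ENNReal.toReal_mul] using this
  have hLv : ∀ S S', ∫ μ, (L S μ).toReal * (L S' μ).toReal ∂π =
      (∫⁻ μ, L S μ * L S' μ ∂π).toReal := by
    intro S S'
    have := integral_toReal ((hLm S).mul (hLm S')).aemeasurable
      (Eventually.of_forall fun μ => ENNReal.mul_lt_top (hLlt S μ) (hLlt S' μ)) (μ := π)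
    simpa only [Pi.mul_apply, ENNReal.toReal_mul] using this
  have hexp : ∀ μ, E.poly f μ ^ 2 = ∑ q : Finset (Fin n) × Finset (Fin n),
      (-(b : ℝ)) ^ (q.1ᶜ.card + q.2ᶜ.card) * ((L q.1 μ).toReal * (L q.2 μ).toReal) := by
    intro μ
    rw [E.poly_eq_sum, sq, Finset.sum_mul_sum, Fintype.sum_prod_type]
    refine Finset.sum_congr rfl fun S _ => Finset.sum_congr rfl fun S' _ => ?_
    rw [hlev, hlev, pow_add]
    ring
  have hνfin : ∫⁻ x, F x * F x ∂(ν n) ≠ ∞ := by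
    have : ∀ z, F z * F z ≤ (cube (Fin n) R).indicator
        (fun _ => ENNReal.ofReal C * ENNReal.ofReal C) z := by
      intro z
      by_cases hz : z ∈ cube (Fin n) R
      · rw [Set.indicator_of_mem hz]; exact mul_le_mul' (hFC z) (hFC z)
      · rw [hFR z hz, zero_mul]; exact zero_le
    refine ((lintegral_mono this).trans_lt ?_).ne
    rw [lintegral_indicator_const (measurableSet_cube _ _)]
    exact ENNReal.mul_lt_top (ENNReal.mul_lt_top ENNReal.ofReal_lt_top ENNReal.ofReal_lt_top)
      (E.ν_cube_lt_top n R)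
  simp only [hexp]
  refine ⟨integrable_finsetSum _ fun q _ => (hLi _ _).const_mul _, ?_⟩
  rw [integral_finsetSum _ fun q _ => (hLi _ _).const_mul _]
  simp only [integral_const_mul, hLv]
  -- The identity of measures is integrated against `F ⊗ F`: every `pair` gives the mean of a
  -- product of two levels, and `diag` gives `n!` times the squared norm. All terms are finite, so
  -- the negative ones may be moved back.
  have hm := congrArg (fun m => ∫⁻ w, F (fun j => w (Sum.inl j)) * F (fun j => w (Sum.inr j)) ∂m)
    (E.sum_pair n)
  simp only [lintegral_add_measure, lintegral_finsetSum_measure, lintegral_smul_measure,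
    smul_eq_mul, hpair, lintegral_diag hFm hFs] at hm
  have := (sum_even_eq_iff (fun q : Finset (Fin n) × Finset (Fin n) => q.1ᶜ.card + q.2ᶜ.card) b
    ((b * (1 + c * b)) ^ n) (fun q => hpfin q.1 q.2)
    (ENNReal.mul_ne_top (ENNReal.natCast_ne_top _) hνfin)).1 hm
  rw [this, ENNReal.toReal_mul, ENNReal.toReal_natCast]
  simp only [sq]
  push_cast
  ring

end Ensemble

/-! ### Square-integrable functions and kernels -/

section L2

variable {Y Z : Type*} [MeasurableSpace Y] [MeasurableSpace Z]

theorem eLpNorm_two_sq (m : Measure Y) (f : Y → ℝ) :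
    eLpNorm f 2 m ^ 2 = ∫⁻ y, ‖f y‖ₑ ^ 2 ∂m := by
  have := eLpNorm_nnreal_pow_eq_lintegral (f := f) (μ := m) (p := 2) (by norm_num)
  simpa using this

/-- Averaging with respect to a probability measure contracts the square norm: for each `y` the `L¹`
norm is at most the `L²` norm, and the squares are then integrated over `y`. -/
theorem memLp_integral_kernel {m : Measure Y} (κ : Kernel Y Z) [IsMarkovKernel κ] {G : Z → ℝ}
    (hG : Measurable G) (h : MemLp G 2 (m.bind κ)) :
    (∀ᵐ y ∂m, Integrable G (κ y)) ∧ MemLp (fun y => ∫ z, G z ∂(κ y)) 2 m ∧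
      eLpNorm (fun y => ∫ z, G z ∂(κ y)) 2 m ≤ eLpNorm G 2 (m.bind κ) := by
  have hm : Measurable fun z => ‖G z‖ₑ ^ 2 := hG.enorm.pow_const 2
  have h1 : ∫⁻ y, ∫⁻ z, ‖G z‖ₑ ^ 2 ∂(κ y) ∂m = eLpNorm G 2 (m.bind κ) ^ 2 := by
    rw [eLpNorm_two_sq, Measure.lintegral_bind κ.measurable.aemeasurable hm.aemeasurable]
  have h2 : ∫⁻ y, ∫⁻ z, ‖G z‖ₑ ^ 2 ∂(κ y) ∂m ≠ ∞ := by
    rw [h1]; exact ENNReal.pow_ne_top h.2.ne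
  have h3 : eLpNorm (fun y => ∫ z, G z ∂(κ y)) 2 m ≤ eLpNorm G 2 (m.bind κ) := by
    rw [← ENNReal.pow_le_pow_left_iff two_ne_zero, eLpNorm_two_sq, ← h1]
    refine lintegral_mono fun y => ?_
    rw [← eLpNorm_two_sq]
    refine pow_le_pow_left₀ zero_le ?_ 2
    refine (enorm_integral_le_lintegral_enorm _).trans ?_
    rw [← eLpNorm_one_eq_lintegral_enorm]
    exact eLpNorm_le_eLpNorm_of_exponent_le one_le_two hG.aestronglyMeasurable
  refine ⟨?_, ⟨hG.stronglyMeasurable.integral_kernel.aestronglyMeasurable, h3.trans_lt h.2⟩, h3⟩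
  filter_upwards [ae_lt_top hm.lintegral_kernel h2] with y hy
  have : MemLp G 2 (κ y) := by
    refine ⟨hG.aestronglyMeasurable, ?_⟩
    by_contra hn
    rw [not_lt, top_le_iff] at hn
    rw [← eLpNorm_two_sq, hn] at hy
    simp at hy
  exact this.integrable one_le_two

end L2

/-! ### Symmetric test functions -/

theorem IsTest.memLp {n : ℕ} {ν : Measure (Fin n → ℝ)} (hν : ∀ R, ν (cube (Fin n) R) < ∞)
    {f : (Fin n → ℝ) → ℝ} (hf : IsTest f) (p : ℝ≥0∞) : MemLp f p ν := by
  obtain ⟨hfm, ⟨C, hC⟩, hbd⟩ := hf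
  obtain ⟨R, hR⟩ := exists_subset_cube hbd
  have h1 : f = (cube (Fin n) R).indicator f := by
    ext x
    by_cases hx : x ∈ cube (Fin n) R
    · rw [Set.indicator_of_mem hx]
    · rw [Set.indicator_of_notMem hx]
      by_contra h
      exact hx (hR h)
  rw [h1, memLp_indicator_iff_restrict (measurableSet_cube _ _)]
  have : IsFiniteMeasure (ν.restrict (cube (Fin n) R)) :=
    ⟨by rw [Measure.restrict_apply_univ]; exact hν R⟩
  exact MemLp.of_bound hfm.aestronglyMeasurable C (Eventually.of_forall hC)

theorem isBounded_cube (J : Type) [Fintype J] (R : ℕ) : Bornology.IsBounded (cube J R) :=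
  Bornology.IsBounded.pi fun _ => Metric.isBounded_Icc _ _

theorem mem_cube_perm {n R : ℕ} (s : Equiv.Perm (Fin n)) (x : Fin n → ℝ) :
    (fun i => x (s i)) ∈ cube (Fin n) R ↔ x ∈ cube (Fin n) R := by
  constructor
  · intro h j _
    simpa using h (s.symm j) trivial
  · intro h j _
    exact h (s j) trivial

/-- The truncation of a function. -/
def truncate {n : ℕ} (j : ℕ) (f : (Fin n → ℝ) → ℝ) : (Fin n → ℝ) → ℝ :=
  (cube (Fin n) j ∩ {x | |f x| ≤ j}).indicator f

theorem isTest_truncate {n : ℕ} (j : ℕ) {f : (Fin n → ℝ) → ℝ} (hf : Measurable f) :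
    IsTest (truncate j f) := by
  have hA : MeasurableSet (cube (Fin n) j ∩ {x | |f x| ≤ j}) :=
    (measurableSet_cube _ _).inter (measurableSet_le hf.abs measurable_const)
  refine ⟨hf.indicator hA, ⟨j, fun x => ?_⟩, ?_⟩
  · by_cases hx : x ∈ cube (Fin n) j ∩ {x | |f x| ≤ j}
    · rw [truncate, Set.indicator_of_mem hx]; exact hx.2
    · rw [truncate, Set.indicator_of_notMem hx]; simp
  · refine (isBounded_cube (Fin n) j).subset fun x hx => ?_
    by_contra hn
    exact hx (Set.indicator_of_notMem (fun h => hn h.1) _)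

theorem isSymm_truncate {n : ℕ} (j : ℕ) {f : (Fin n → ℝ) → ℝ} (hf : IsSymm f) :
    IsSymm (truncate j f) := by
  intro s x
  have : (fun i => x (s i)) ∈ cube (Fin n) j ∩ {x | |f x| ≤ j} ↔
      x ∈ cube (Fin n) j ∩ {x | |f x| ≤ j} := by
    rw [Set.mem_inter_iff, Set.mem_inter_iff, mem_cube_perm]
    simp only [Set.mem_ofPred_eq, hf s x]
  by_cases hx : x ∈ cube (Fin n) j ∩ {x | |f x| ≤ j}
  · rw [truncate, Set.indicator_of_mem hx, Set.indicator_of_mem (this.2 hx), hf s x]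
  · rw [truncate, Set.indicator_of_notMem hx, Set.indicator_of_notMem (fun h => hx (this.1 h))]

theorem tendsto_eLpNorm_truncate {n : ℕ} {ν : Measure (Fin n → ℝ)} {f : (Fin n → ℝ) → ℝ}
    (hf : Measurable f) (p : ℝ≥0) (hp : p ≠ 0) (h : MemLp f p ν) :
    Tendsto (fun j => eLpNorm (truncate j f - f) p ν) atTop (nhds 0) := by
  have hp' : (0 : ℝ) < p := by positivity
  have h1 : ∫⁻ x, ‖f x‖ₑ ^ (p : ℝ) ∂ν ≠ ∞ := by
    rw [← eLpNorm_nnreal_pow_eq_lintegral hp]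
    exact (ENNReal.rpow_lt_top_of_nonneg hp'.le h.2.ne).ne
  have h2 : Tendsto (fun j => ∫⁻ x, ‖(truncate j f - f) x‖ₑ ^ (p : ℝ) ∂ν) atTop
      (nhds (∫⁻ _, 0 ∂ν)) := by
    refine tendsto_lintegral_of_dominated_convergence (fun x => ‖f x‖ₑ ^ (p : ℝ))
      (fun j => (((isTest_truncate j hf).1.sub hf).enorm.pow_const _)) (fun j => ?_) h1 ?_
    · refine Eventually.of_forall fun x => ENNReal.rpow_le_rpow ?_ hp'.le
      by_cases hx : x ∈ cube (Fin n) j ∩ {x | |f x| ≤ j}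
      · rw [Pi.sub_apply, truncate, Set.indicator_of_mem hx, sub_self, enorm_zero]
        exact zero_le
      · rw [Pi.sub_apply, truncate, Set.indicator_of_notMem hx, zero_sub, enorm_neg]
    · refine Eventually.of_forall fun x => tendsto_const_nhds.congr' ?_
      obtain ⟨R, hR⟩ := exists_mem_cube x
      obtain ⟨R', hR'⟩ := exists_nat_ge |f x|
      filter_upwards [eventually_ge_atTop R, eventually_ge_atTop R'] with j hj hj'
      have hx : x ∈ cube (Fin n) j ∩ {x | |f x| ≤ j} :=
        ⟨cube_mono _ hj hR, hR'.trans (by exact_mod_cast hj')⟩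
      rw [Pi.sub_apply, truncate, Set.indicator_of_mem hx, sub_self, enorm_zero,
        ENNReal.zero_rpow_of_pos hp']
  rw [lintegral_zero] at h2
  have h3 := h2.ennrpow_const (1 / (p : ℝ))
  rw [ENNReal.zero_rpow_of_pos (by positivity)] at h3
  refine h3.congr fun j => ?_
  rw [← eLpNorm_nnreal_pow_eq_lintegral hp, ← ENNReal.rpow_mul, mul_one_div_cancel hp'.ne',
    ENNReal.rpow_one]

/-- The space of the symmetric functions in `𝒞_n`. -/
def symTest (n : ℕ) : Submodule ℝ ((Fin n → ℝ) → ℝ) where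
  carrier := {f | IsTest f ∧ IsSymm f}
  add_mem' := by
    rintro f g ⟨⟨hf, ⟨C, hC⟩, hb⟩, hs⟩ ⟨⟨hg, ⟨D, hD⟩, hb'⟩, hs'⟩
    refine ⟨⟨hf.add hg, ⟨C + D, fun x => ?_⟩, ?_⟩, fun s x => ?_⟩
    · exact (abs_add_le _ _).trans (add_le_add (hC x) (hD x))
    · exact (hb.union hb').subset (Function.support_add f g)
    · simp only [Pi.add_apply, hs s x, hs' s x]
  zero_mem' := ⟨⟨measurable_zero, ⟨0, fun x => by simp⟩, by simp⟩, fun _ _ => rfl⟩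
  smul_mem' := by
    rintro a f ⟨⟨hf, ⟨C, hC⟩, hb⟩, hs⟩
    refine ⟨⟨hf.const_smul a, ⟨|a| * C, fun x => ?_⟩, ?_⟩, fun s x => ?_⟩
    · rw [Pi.smul_apply, smul_eq_mul, abs_mul]
      exact mul_le_mul_of_nonneg_left (hC x) (abs_nonneg a)
    · exact hb.subset (Function.support_const_smul_subset a f)
    · simp only [Pi.smul_apply, hs s x]

theorem memL2Sym_of_mem_symTest {n : ℕ} {ν : Measure (Fin n → ℝ)}
    (hν : ∀ R, ν (cube (Fin n) R) < ∞) {f : (Fin n → ℝ) → ℝ} (hf : f ∈ symTest n) :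
    MemL2Sym ν f := ⟨hf.1.1, hf.2, hf.1.memLp hν 2⟩

theorem truncate_mem_symTest {n : ℕ} (j : ℕ) {f : (Fin n → ℝ) → ℝ} (hf : Measurable f)
    (hs : IsSymm f) : truncate j f ∈ symTest n := ⟨isTest_truncate j hf, isSymm_truncate j hs⟩

theorem posPart_mem_symTest {n : ℕ} {f : (Fin n → ℝ) → ℝ} (hf : f ∈ symTest n) :
    (fun x => max (f x) 0) ∈ symTest n := by
  obtain ⟨⟨hm, ⟨C, hC⟩, hb⟩, hs⟩ := hf
  refine ⟨⟨hm.max measurable_const, ⟨C, fun x => ?_⟩, hb.subset fun x hx h => hx ?_⟩,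
    fun s x => by simp only [hs s x]⟩
  · rw [abs_of_nonneg (le_max_right _ _)]
    exact max_le ((le_abs_self _).trans (hC x)) ((abs_nonneg _).trans (hC x))
  · simp [h]

theorem MemL2Sym.norm_toL2Sym {n : ℕ} {ν : Measure (Fin n → ℝ)} {f : (Fin n → ℝ) → ℝ}
    (hf : MemL2Sym ν f) : ‖hf.toL2Sym‖ = (eLpNorm f 2 ν).toReal :=
  Lp.norm_toLp f hf.2.2

theorem MemL2Sym.sub {n : ℕ} {ν : Measure (Fin n → ℝ)} {f g : (Fin n → ℝ) → ℝ}
    (hf : MemL2Sym ν f) (hg : MemL2Sym ν g) : MemL2Sym ν (f - g) :=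
  ⟨hf.1.sub hg.1, fun s x => by simp only [Pi.sub_apply, hf.2.1 s x, hg.2.1 s x],
    hf.2.2.sub hg.2.2⟩

theorem MemL2Sym.toL2Sym_sub {n : ℕ} {ν : Measure (Fin n → ℝ)} {f g : (Fin n → ℝ) → ℝ}
    (hf : MemL2Sym ν f) (hg : MemL2Sym ν g) :
    (hf.sub hg).toL2Sym = hf.toL2Sym - hg.toL2Sym :=
  Subtype.ext (MemLp.toLp_sub hf.2.2 hg.2.2)

theorem MemL2Sym.toL2Sym_congr {n : ℕ} {ν : Measure (Fin n → ℝ)} {f g : (Fin n → ℝ) → ℝ}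
    (hf : MemL2Sym ν f) (hg : MemL2Sym ν g) (h : f =ᵐ[ν] g) : hf.toL2Sym = hg.toL2Sym :=
  Subtype.ext ((MemLp.toLp_eq_toLp_iff hf.2.2 hg.2.2).2 h)

/-! ### Extension of the polynomials to square-integrable functions -/

namespace Ensemble

variable {c : ℕ} {b : ℝ≥0} {α : Measure ℝ}
  {κ : (k m : ℕ) → (Fin k → ℝ) → Measure (Fin m → ℝ)} {ν : (n : ℕ) → Measure (Fin n → ℝ)}
  {π : Measure Config} (E : Ensemble c b α κ ν π)

theorem eLpNorm_poly_of_nonneg {n : ℕ} {f : (Fin n → ℝ) → ℝ} (hf : f ∈ symTest n)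
    (h0 : ∀ x, 0 ≤ f x) : eLpNorm (E.poly f) 2 π ≤
      (((b * (1 + c * b)) ^ n * n.factorial + 1 : ℝ≥0) : ℝ≥0∞) * eLpNorm f 2 (ν n) := by
  obtain ⟨h1, h2⟩ := E.integral_poly_sq hf.1 hf.2 h0
  set K : ℝ≥0 := (b * (1 + c * b)) ^ n * n.factorial with hK
  have hfin : ∫⁻ x, ‖f x‖ₑ ^ 2 ∂(ν n) ≠ ∞ := by
    rw [← eLpNorm_two_sq]
    exact ENNReal.pow_ne_top (hf.1.memLp (E.ν_cube_lt_top n) 2).2.ne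
  have h3 : eLpNorm (E.poly f) 2 π ^ 2 = K * eLpNorm f 2 (ν n) ^ 2 := by
    rw [eLpNorm_two_sq, eLpNorm_two_sq]
    have : ∀ μ, ‖E.poly f μ‖ₑ ^ 2 = ENNReal.ofReal (E.poly f μ ^ 2) := by
      intro μ
      rw [← Real.enorm_eq_ofReal (sq_nonneg _), enorm_pow]
    simp only [this]
    rw [← ofReal_integral_eq_lintegral_ofReal h1 (Eventually.of_forall fun μ => sq_nonneg _), h2,
      ENNReal.ofReal_mul (by positivity), ENNReal.ofReal_toReal hfin]
    congr 1
    rw [← ENNReal.ofReal_coe_nnreal, hK]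
    push_cast
    rfl
  rw [← ENNReal.pow_le_pow_left_iff two_ne_zero, h3, mul_pow]
  gcongr
  -- The sharp constant would be the square root of `K`; the cruder `K + 1` avoids roots.
  have : K ≤ (K + 1) ^ 2 := by
    nlinarith [K.2, sq_nonneg (K : ℝ), (zero_le : 0 ≤ K ^ 2), (zero_le : 0 ≤ K)]
  exact_mod_cast this

/-- The norm formula is available for nonnegative functions. Splitting into positive and negative
parts, whose norms do not exceed that of `f`, costs a factor of two, which is enough for
boundedness. -/
theorem exists_eLpNorm_poly_le (n : ℕ) : ∃ C : ℝ≥0, ∀ f ∈ symTest n,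
    eLpNorm (E.poly f) 2 π ≤ C * eLpNorm f 2 (ν n) := by
  set K : ℝ≥0 := (b * (1 + c * b)) ^ n * n.factorial + 1
  refine ⟨K + K, fun f hf => ?_⟩
  have hp := posPart_mem_symTest hf
  have hn := posPart_mem_symTest ((symTest n).neg_mem hf)
  have h1 := E.poly_sub hp.1.1 hn.1.1
    (memLp_one_iff_integrable.1 (hp.1.memLp (E.ν_cube_lt_top n) 1))
    (memLp_one_iff_integrable.1 (hn.1.memLp (E.ν_cube_lt_top n) 1))
  have h2 : ((fun x => max (f x) 0) - fun x => max ((-f) x) 0) = f := by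
    ext x
    exact max_zero_sub_max_neg_zero_eq_self (f x)
  rw [h2] at h1
  rw [eLpNorm_congr_ae h1]
  refine (eLpNorm_sub_le (E.measurable_poly hp.1.1).aestronglyMeasurable
    (E.measurable_poly hn.1.1).aestronglyMeasurable one_le_two).trans ?_
  rw [ENNReal.coe_add, add_mul]
  refine add_le_add ((E.eLpNorm_poly_of_nonneg hp fun x => le_max_right _ _).trans ?_)
    ((E.eLpNorm_poly_of_nonneg hn fun x => le_max_right _ _).trans ?_)
  · gcongr
    refine eLpNorm_mono fun x => ?_
    rw [Real.norm_eq_abs, Real.norm_eq_abs, abs_of_nonneg (le_max_right _ _)]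
    exact max_le (le_abs_self _) (abs_nonneg _)
  · gcongr
    refine eLpNorm_mono fun x => ?_
    rw [Real.norm_eq_abs, Real.norm_eq_abs, abs_of_nonneg (le_max_right _ _)]
    exact max_le (neg_le_abs _) (abs_nonneg _)

theorem memLp_poly {n : ℕ} {f : (Fin n → ℝ) → ℝ} (hf : f ∈ symTest n) :
    MemLp (E.poly f) 2 π := by
  obtain ⟨C, hC⟩ := E.exists_eLpNorm_poly_le n
  exact ⟨(E.measurable_poly hf.1.1).aestronglyMeasurable, (hC f hf).trans_lt
    (ENNReal.mul_lt_top ENNReal.coe_lt_top (hf.1.memLp (E.ν_cube_lt_top n) 2).2)⟩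

/-- Truncation shows that symmetric test functions are dense in `L²_sym`, so the bounded operator on
them extends by continuity. -/
theorem exists_isL2Extension (n : ℕ) : ∃ J, IsL2Extension (ν n) π (E.poly (n := n)) J := by
  have hint : ∀ f ∈ symTest n, Integrable f (ν n) := fun f hf =>
    memLp_one_iff_integrable.1 (hf.1.memLp (E.ν_cube_lt_top n) 1)
  let e : symTest n →ₗ[ℝ] L2Sym (ν n) :=
    { toFun := fun f => (memL2Sym_of_mem_symTest (E.ν_cube_lt_top n) f.2).toL2Sym
      map_add' := fun f g => rfl
      map_smul' := fun a f => rfl }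
  let T : symTest n →ₗ[ℝ] Lp ℝ 2 π :=
    { toFun := fun f => (E.memLp_poly f.2).toLp _
      map_add' := fun f g => by
        rw [← MemLp.toLp_add, MemLp.toLp_eq_toLp_iff]
        exact E.poly_add f.2.1.1 g.2.1.1 (hint f f.2) (hint g g.2)
      map_smul' := fun a f => by
        rw [RingHom.id_apply, ← MemLp.toLp_const_smul, MemLp.toLp_eq_toLp_iff]
        exact Eventually.of_forall fun μ => congrFun (E.poly_smul a f.1) μ }
  obtain ⟨C, hC⟩ := E.exists_eLpNorm_poly_le n
  have hnorm : ∀ f, ‖T f‖ ≤ C * ‖e f‖ := by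
    intro f
    have h1 : ‖T f‖ = (eLpNorm (E.poly f.1) 2 π).toReal :=
      Lp.norm_toLp _ (E.memLp_poly f.2)
    have h2 : ‖e f‖ = (eLpNorm f.1 2 (ν n)).toReal :=
      (memL2Sym_of_mem_symTest (E.ν_cube_lt_top n) f.2).norm_toL2Sym
    rw [h1, h2, ← ENNReal.coe_toReal, ← ENNReal.toReal_mul]
    exact ENNReal.toReal_mono (ENNReal.mul_ne_top ENNReal.coe_ne_top
      (f.2.1.memLp (E.ν_cube_lt_top n) 2).2.ne) (hC f.1 f.2)
  have hdense : DenseRange e := by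
    intro g
    obtain ⟨f, hf, hs, hgf⟩ := g.2
    have hm : MemL2Sym (ν n) f := ⟨hf, hs, (memLp_congr_ae hgf).1 (Lp.memLp g.1)⟩
    have hg : g = hm.toL2Sym := Subtype.ext (Lp.ext (hgf.trans hm.2.2.coeFn_toLp.symm))
    have ht := tendsto_eLpNorm_truncate hf 2 two_ne_zero hm.2.2
    refine mem_closure_of_tendsto (f := fun j => e ⟨truncate j f, truncate_mem_symTest j hf hs⟩)
      (b := atTop) ?_ (Eventually.of_forall fun j => ⟨_, rfl⟩)
    rw [hg, tendsto_iff_norm_sub_tendsto_zero]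
    have h3 := (ENNReal.tendsto_toReal ENNReal.zero_ne_top).comp ht
    refine h3.congr fun j => ?_
    have hj := memL2Sym_of_mem_symTest (E.ν_cube_lt_top n) (truncate_mem_symTest j hf hs)
    have h4 := (hj.sub hm).norm_toL2Sym
    rw [MemL2Sym.toL2Sym_sub hj hm] at h4
    exact h4.symm
  refine ⟨T.extendOfNorm e, fun f hf ht => ?_⟩
  have h1 := LinearMap.extendOfNorm_eq (f := T) (e := e) hdense ⟨C, hnorm⟩ ⟨f, ht, hf.2.1⟩
  have h2 : e ⟨f, ht, hf.2.1⟩ = hf.toL2Sym := rfl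
  rw [h2] at h1
  rw [h1]
  exact MemLp.coeFn_toLp (E.memLp_poly ⟨ht, hf.2.1⟩)

theorem norm_sub_le {n : ℕ} (J : L2Sym (ν n) →L[ℝ] Lp ℝ 2 π) {f g : (Fin n → ℝ) → ℝ}
    (hf : MemL2Sym (ν n) f) (hg : MemL2Sym (ν n) g) :
    eLpNorm (J hf.toL2Sym - J hg.toL2Sym : Lp ℝ 2 π) 2 π ≤
      ENNReal.ofReal ‖J‖ * eLpNorm (f - g) 2 (ν n) := by
  have h1 := J.le_opNorm (hf.toL2Sym - hg.toL2Sym)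
  rw [map_sub, ← MemL2Sym.toL2Sym_sub, MemL2Sym.norm_toL2Sym, Lp.norm_def] at h1
  rw [← ENNReal.ofReal_toReal (hf.sub hg).2.2.2.ne, ← ENNReal.ofReal_mul (norm_nonneg J),
    ← ENNReal.ofReal_toReal (Lp.eLpNorm_ne_top _)]
  exact ENNReal.ofReal_le_ofReal h1

/-- An extension of the polynomial is given by the same formula for all functions that are
integrable and square-integrable. -/
theorem ae_eq_poly {n : ℕ} {J : L2Sym (ν n) →L[ℝ] Lp ℝ 2 π}
    (hJ : IsL2Extension (ν n) π (E.poly (n := n)) J) {f : (Fin n → ℝ) → ℝ}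
    (hf : MemL2Sym (ν n) f) (hi : Integrable f (ν n)) : J hf.toL2Sym =ᵐ[π] E.poly f := by
  have ht : ∀ j, MemL2Sym (ν n) (truncate j f) := fun j =>
    memL2Sym_of_mem_symTest (E.ν_cube_lt_top n) (truncate_mem_symTest j hf.1 hf.2.1)
  have hti : ∀ j, Integrable (truncate j f) (ν n) := fun j =>
    memLp_one_iff_integrable.1 ((isTest_truncate j hf.1).memLp (E.ν_cube_lt_top n) 1)
  -- The images of the truncations converge to `J f` in `L²` and to `poly f` in `L¹`. Both imply
  -- convergence in measure, where limits are almost everywhere unique.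
  have h1 : TendstoInMeasure π (fun j => (J (ht j).toL2Sym : Config → ℝ)) atTop
      (J hf.toL2Sym) := by
    refine tendstoInMeasure_of_tendsto_eLpNorm (p := 2) two_ne_zero
      (fun j => Lp.aestronglyMeasurable _) (Lp.aestronglyMeasurable _) ?_
    have h2 := tendsto_eLpNorm_truncate hf.1 2 two_ne_zero hf.2.2
    have h3 := ENNReal.Tendsto.const_mul (a := ENNReal.ofReal ‖J‖) h2
      (Or.inr ENNReal.ofReal_ne_top)
    rw [mul_zero] at h3
    refine tendsto_of_tendsto_of_tendsto_of_le_of_le tendsto_const_nhds h3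
      (fun _ => zero_le) fun j => ?_
    rw [← eLpNorm_congr_ae (Lp.coeFn_sub _ _)]
    exact norm_sub_le J (ht j) hf
  have h2 : TendstoInMeasure π (fun j => (J (ht j).toL2Sym : Config → ℝ)) atTop (E.poly f) := by
    refine tendstoInMeasure_of_tendsto_eLpNorm (p := 1) one_ne_zero
      (fun j => Lp.aestronglyMeasurable _) (E.measurable_poly hf.1).aestronglyMeasurable ?_
    have h2 := tendsto_eLpNorm_truncate hf.1 1 one_ne_zero (memLp_one_iff_integrable.2 hi)
    set C : ℝ≥0∞ := ∑ k ∈ Finset.range (n + 1), ((n.choose k : ℝ≥0∞) * (b ^ (n - k) * b ^ k))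
    have hC : C ≠ ∞ := ENNReal.sum_ne_top.2 fun k _ =>
      ENNReal.mul_ne_top (ENNReal.natCast_ne_top _) (ENNReal.mul_ne_top
        (ENNReal.pow_ne_top ENNReal.coe_ne_top) (ENNReal.pow_ne_top ENNReal.coe_ne_top))
    have h3 := ENNReal.Tendsto.const_mul (a := C) h2 (Or.inr hC)
    rw [mul_zero] at h3
    refine tendsto_of_tendsto_of_tendsto_of_le_of_le tendsto_const_nhds h3
      (fun _ => zero_le) fun j => ?_
    have h4 : (J (ht j).toL2Sym : Config → ℝ) - E.poly f =ᵐ[π] E.poly (truncate j f - f) :=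
      ((hJ _ (ht j) (isTest_truncate j hf.1)).sub (EventuallyEq.refl _ _)).trans
        (E.poly_sub (ht j).1 hf.1 (hti j) hi).symm
    simp only
    rw [eLpNorm_congr_ae h4, eLpNorm_one_eq_lintegral_enorm, ENNReal.coe_one,
      eLpNorm_one_eq_lintegral_enorm]
    exact E.lintegral_enorm_poly_le ((ht j).1.sub hf.1)
  exact tendstoInMeasure_ae_unique h1 h2

end Ensemble

/-! ### The semigroup of `n` particles on `L²` -/

theorem unlabel_sub {n : ℕ} (f g : (Fin n → ℝ) → ℝ) (μ : Config) :
    unlabel (f - g) μ = unlabel f μ - unlabel g μ := by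
  unfold unlabel
  split_ifs <;> simp

theorem unlabel_nonneg {n : ℕ} {f : (Fin n → ℝ) → ℝ} (hf : ∀ x, 0 ≤ f x) (μ : Config) :
    0 ≤ unlabel f μ := by
  unfold unlabel
  split_ifs
  · exact hf _
  · exact le_rfl

theorem abs_unlabel_le {n : ℕ} {f : (Fin n → ℝ) → ℝ} {C : ℝ} (hf : ∀ x, |f x| ≤ C) (μ : Config) :
    |unlabel f μ| ≤ max C 0 := by
  unfold unlabel
  split_ifs
  · exact (hf _).trans (le_max_left _ _)
  · simp

namespace MarkovFamily

variable {Ω : Type*} [MeasurableSpace Ω] (X : MarkovFamily Ω)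

theorem semigroup_eq {n : ℕ} (t : ℝ≥0) {f : (Fin n → ℝ) → ℝ} (hf : Measurable f) (hs : IsSymm f)
    (x : Fin n → ℝ) : X.semigroup t f x = ∫ μ, unlabel f μ ∂(X.transKernel t n x) := by
  rw [transKernel_apply, integral_map (X.measurable_η t).aemeasurable
    (measurable_unlabel hs hf).aestronglyMeasurable, semigroup]

theorem bind_transKernel (hX : X.IsConservative) {n : ℕ} (ν : Measure (Fin n → ℝ))
    (hν : 1 ≤ n → X.IsReversible (ν.map iota)) (t : ℝ≥0) :
    ν.bind (X.transKernel t n) = ν.map iota := by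
  ext s hs
  have hm : Measurable (s.indicator (fun _ => (1 : ℝ≥0∞))) := measurable_const.indicator hs
  have h := X.lintegral_trans hX ν hν t hm
  rw [Measure.bind_apply hs (Kernel.measurable _).aemeasurable,
    Measure.map_apply measurable_iota hs]
  have h1 : ∀ x : Fin n → ℝ, X.trans t (s.indicator fun _ => 1) (iota x) =
      X.transKernel t n x s := by
    intro x
    rw [trans, transKernel_apply, ← lintegral_map hm (X.measurable_η t),
      lintegral_indicator_const hs, one_mul]
  simp only [h1] at h
  rw [h, ← lintegral_map hm measurable_iota, lintegral_indicator_const hs, one_mul,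
    Measure.map_apply measurable_iota hs]

theorem memLp_unlabel {n : ℕ} {ν : Measure (Fin n → ℝ)} {f : (Fin n → ℝ) → ℝ}
    (hf : MemL2Sym ν f) : MemLp (unlabel f) 2 (ν.map iota) ∧
      eLpNorm (unlabel f) 2 (ν.map iota) = eLpNorm f 2 ν := by
  have hm := measurable_unlabel hf.2.1 hf.1
  have h : eLpNorm (unlabel f) 2 (ν.map iota) = eLpNorm f 2 ν := by
    rw [eLpNorm_map_measure hm.aestronglyMeasurable measurable_iota.aemeasurable]
    congr 1
    ext x
    exact unlabel_iota hf.2.1 x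
  exact ⟨⟨hm.aestronglyMeasurable, by rw [h]; exact hf.2.2.2⟩, h⟩

theorem isSymm_semigroup {n : ℕ} (t : ℝ≥0) (f : (Fin n → ℝ) → ℝ) : IsSymm (X.semigroup t f) := by
  intro s x
  unfold semigroup
  rw [iota_comp_equiv x s]

variable (hX : X.IsConservative) {n : ℕ} {ν : Measure (Fin n → ℝ)}
  (hν : 1 ≤ n → X.IsReversible (ν.map iota)) (t : ℝ≥0)

include hX hν in
-- The transition kernel carries `ν` to its image under `iota`, where `unlabel f` has the same norm
-- as `f`; averaging over the kernel is a contraction.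
theorem memL2Sym_semigroup {f : (Fin n → ℝ) → ℝ} (hf : MemL2Sym ν f) :
    MemL2Sym ν (X.semigroup t f) ∧ eLpNorm (X.semigroup t f) 2 ν ≤ eLpNorm f 2 ν := by
  have hm := measurable_unlabel hf.2.1 hf.1
  obtain ⟨h1, h2⟩ := memLp_unlabel hf
  rw [← X.bind_transKernel hX ν hν t] at h1 h2
  have h3 : X.semigroup t f = fun x => ∫ μ, unlabel f μ ∂(X.transKernel t n x) :=
    funext fun x => X.semigroup_eq t hf.1 hf.2.1 x
  obtain ⟨-, h4, h5⟩ := memLp_integral_kernel (X.transKernel t n) hm h1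
  rw [← h3, h2] at h5
  rw [← h3] at h4
  refine ⟨⟨?_, X.isSymm_semigroup t f, h4⟩, h5⟩
  rw [h3]
  exact hm.stronglyMeasurable.integral_kernel.measurable

include hX hν in
-- Linearity is claimed only almost everywhere, because the two integrals are only known to exist
-- for almost every starting point.
theorem semigroup_sub {f g : (Fin n → ℝ) → ℝ} (hf : MemL2Sym ν f) (hg : MemL2Sym ν g) :
    X.semigroup t (f - g) =ᵐ[ν] X.semigroup t f - X.semigroup t g := by
  have h1 := (memLp_unlabel hf).1
  have h2 := (memLp_unlabel hg).1
  rw [← X.bind_transKernel hX ν hν t] at h1 h2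
  filter_upwards [(memLp_integral_kernel (X.transKernel t n)
    (measurable_unlabel hf.2.1 hf.1) h1).1, (memLp_integral_kernel (X.transKernel t n)
    (measurable_unlabel hg.2.1 hg.1) h2).1] with x hx hx'
  rw [Pi.sub_apply, X.semigroup_eq t (hf.sub hg).1 (hf.sub hg).2.1, X.semigroup_eq t hf.1 hf.2.1,
    X.semigroup_eq t hg.1 hg.2.1, ← integral_sub hx hx']
  simp only [unlabel_sub]

theorem ofReal_semigroup {f : (Fin n → ℝ) → ℝ} (hf : f ∈ symTest n) (h0 : ∀ x, 0 ≤ f x)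
    (x : Fin n → ℝ) : ENNReal.ofReal (X.semigroup t f x) =
      X.trans t (fun μ => ENNReal.ofReal (unlabel f μ)) (iota x) := by
  obtain ⟨C, hC⟩ := hf.1.2.1
  have hm := measurable_unlabel hf.2 hf.1.1
  rw [semigroup, ofReal_integral_eq_lintegral_ofReal, trans]
  · exact Integrable.of_bound (hm.comp (X.measurable_η t)).aestronglyMeasurable (max C 0)
      (Eventually.of_forall fun ω => abs_unlabel_le hC _)
  · exact Eventually.of_forall fun ω => unlabel_nonneg h0 _

theorem semigroup_nonneg {f : (Fin n → ℝ) → ℝ} (h0 : ∀ x, 0 ≤ f x) (x : Fin n → ℝ) :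
    0 ≤ X.semigroup t f x := integral_nonneg fun _ => unlabel_nonneg h0 _

end MarkovFamily

/-! ### Intertwining -/

namespace Ensemble

variable {Ω : Type*} [MeasurableSpace Ω] (X : MarkovFamily Ω) {c : ℕ} {b : ℝ≥0} {α : Measure ℝ}
  {κ : (k m : ℕ) → (Fin k → ℝ) → Measure (Fin m → ℝ)} {ν : (n : ℕ) → Measure (Fin n → ℝ)}

/-- Invariance of `ν n` gives `P_t f` the same integral as `f`. Together with square-integrability
this lets `ae_eq_poly` apply to `P_t f`, which may fail to be a test function. -/
theorem integrable_semigroup {π : Measure Config} (E : Ensemble c b α κ ν π)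
    (hX : X.IsConservative) (hrev : ∀ n, 1 ≤ n → X.IsReversible ((ν n).map iota)) (t : ℝ≥0)
    {n : ℕ} {f : (Fin n → ℝ) → ℝ} (hf : f ∈ symTest n) (h0 : ∀ x, 0 ≤ f x) :
    Integrable (X.semigroup t f) (ν n) := by
  have hm := measurable_unlabel hf.2 hf.1.1
  have h1 := (X.memL2Sym_semigroup hX (hrev n) t
    (memL2Sym_of_mem_symTest (E.ν_cube_lt_top n) hf)).1.1
  refine ⟨h1.aestronglyMeasurable, ?_⟩
  have h2 : ∀ x, ‖X.semigroup t f x‖ₑ =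
      X.trans t (fun μ => ENNReal.ofReal (unlabel f μ)) (iota x) := by
    intro x
    rw [← X.ofReal_semigroup t hf h0, Real.enorm_eq_ofReal (X.semigroup_nonneg t h0 x)]
  rw [HasFiniteIntegral]
  simp only [h2]
  rw [X.lintegral_trans hX (ν n) (hrev n) t hm.ennreal_ofReal]
  simp only [unlabel_iota hf.2]
  exact (memLp_one_iff_integrable.1 (hf.1.memLp (E.ν_cube_lt_top n) 1)).lintegral_lt_top

/-- The relation holds level by level by `lintegral_trans_tau`. Nonnegativity of `f` makes it an
identity of integrals in `ℝ≥0∞`, finite for almost every `μ`, and the levels are then combined with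
the signs of `poly`. -/
theorem integral_poly_trans {π : Measure Config} (E : Ensemble c b α κ ν π)
    (hX : X.IsConservative) (hc : X.IsConsistent)
    (hrev : ∀ n, 1 ≤ n → X.IsReversible ((ν n).map iota)) (t : ℝ≥0)
    {n : ℕ} {f : (Fin n → ℝ) → ℝ} (hf : f ∈ symTest n) (h0 : ∀ x, 0 ≤ f x) :
    ∀ᵐ μ ∂π, ∫ ω, E.poly f (X.η t ω) ∂(X.P μ) = E.poly (X.semigroup t f) μ := by
  have hm := measurable_unlabel hf.2 hf.1.1
  have hF : Measurable fun μ => ENNReal.ofReal (unlabel f μ) := hm.ennreal_ofReal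
  have hSm := (X.memL2Sym_semigroup hX (hrev n) t
    (memL2Sym_of_mem_symTest (E.ν_cube_lt_top n) hf)).1.1
  have h1 : ∀ᵐ μ ∂π, ∀ k (hk : k ≤ n),
      ∫⁻ ω, ∫⁻ z, ENNReal.ofReal (unlabel f (iota z)) ∂(E.tau hk (X.η t ω)) ∂(X.P μ) =
      ∫⁻ z, X.trans t (fun μ => ENNReal.ofReal (unlabel f μ)) (iota z) ∂(E.tau hk μ) := by
    refine ae_all_iff.2 fun k => ?_
    by_cases hk : k ≤ n
    · filter_upwards [E.lintegral_trans_tau X hX hc hrev hk t hF] with μ hμ _ using hμ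
    · exact Eventually.of_forall fun μ h => absurd h hk
  filter_upwards [h1, E.ae_integrable_tau hSm (E.integrable_semigroup X hX hrev t hf h0)]
    with μ hμ hint
  have h2 : ∀ k (hk : k ≤ n), Integrable (fun ω => E.level f k (X.η t ω)) (X.P μ) ∧
      ∫ ω, E.level f k (X.η t ω) ∂(X.P μ) = E.level (X.semigroup t f) k μ := by
    intro k hk
    have h3 := hμ k hk
    simp only [← X.ofReal_semigroup t hf h0, unlabel_iota hf.2] at h3
    have hlm : Measurable fun ω => ∫⁻ z, ENNReal.ofReal (f z) ∂(E.tau hk (X.η t ω)) :=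
      (Measurable.lintegral_kernel (κ := E.tau hk) hf.1.1.ennreal_ofReal).comp
        (X.measurable_η t)
    have h4 : ∫⁻ ω, ∫⁻ z, ENNReal.ofReal (f z) ∂(E.tau hk (X.η t ω)) ∂(X.P μ) ≠ ∞ := by
      rw [h3]
      exact (hint k hk).lintegral_lt_top.ne
    have h5 : ∀ ω, E.level f k (X.η t ω) =
        (∫⁻ z, ENNReal.ofReal (f z) ∂(E.tau hk (X.η t ω))).toReal := by
      intro ω
      rw [E.level_of_le hk, integral_eq_lintegral_of_nonneg_ae (Eventually.of_forall h0)
        hf.1.1.aestronglyMeasurable]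
    simp only [h5]
    refine ⟨integrable_toReal_of_lintegral_ne_top hlm.aemeasurable h4, ?_⟩
    rw [integral_toReal hlm.aemeasurable (ae_lt_top hlm h4), h3, E.level_of_le hk,
      integral_eq_lintegral_of_nonneg_ae (Eventually.of_forall (X.semigroup_nonneg t h0))
        hSm.aestronglyMeasurable]
  unfold poly
  rw [integral_finsetSum]
  · refine Finset.sum_congr rfl fun k hk => ?_
    rw [integral_const_mul, integral_const_mul,
      (h2 k (Nat.lt_succ_iff.1 (Finset.mem_range.1 hk))).2]
  · intro k hk
    exact ((h2 k (Nat.lt_succ_iff.1 (Finset.mem_range.1 hk))).1.const_mul _).const_mul _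

variable {Ω' : Type*} [MeasurableSpace Ω'] {Pr : Measure Ω'}

theorem integral_kernel_sub {K : Kernel Ω' Config} [IsMarkovKernel K] {π : Measure Config}
    (hK : Pr.bind K = π) (g h : Lp ℝ 2 π) :
    (fun ω => ∫ μ, (g - h : Lp ℝ 2 π) μ ∂(K ω)) =ᵐ[Pr]
      fun ω => ∫ μ, g μ ∂(K ω) - ∫ μ, h μ ∂(K ω) := by
  subst hK
  filter_upwards [Measure.ae_ae_of_ae_comp (Lp.coeFn_sub g h),
    (memLp_integral_kernel K (Lp.stronglyMeasurable g).measurable (Lp.memLp g)).1,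
    (memLp_integral_kernel K (Lp.stronglyMeasurable h).measurable (Lp.memLp h)).1]
    with ω h1 h2 h3
  rw [integral_congr_ae h1, ← integral_sub h2 h3]
  rfl

/-- The intertwining relation for an extension of the polynomials. -/
theorem intertwines [IsProbabilityMeasure Pr] {ζ : Ω' → Config} (hζ : IsProper ζ)
    (hζm : Measurable ζ) (E : Ensemble c b α κ ν (Pr.map ζ)) (hX : X.IsConservative)
    (hc : X.IsConsistent) (hrev : ∀ n, 1 ≤ n → X.IsReversible ((ν n).map iota)) {n : ℕ}
    {J : L2Sym (ν n) →L[ℝ] Lp ℝ 2 (Pr.map ζ)}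
    (hJ : IsL2Extension (ν n) (Pr.map ζ) (E.poly (n := n)) J) : X.Intertwines Pr ζ (ν n) J := by
  intro t
  set K := X.initKernel hζ t
  have hK : Pr.bind K = Pr.map ζ := bind_initKernel X hζ hζm E hX hc hrev t
  have hP : ∀ {f : (Fin n → ℝ) → ℝ}, MemL2Sym (ν n) f → MemL2Sym (ν n) (X.semigroup t f) :=
    fun hf => (X.memL2Sym_semigroup hX (hrev n) t hf).1
  have htest : ∀ {f : (Fin n → ℝ) → ℝ}, f ∈ symTest n → MemL2Sym (ν n) f := fun hf =>
    memL2Sym_of_mem_symTest (E.ν_cube_lt_top n) hf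
  have hnonneg : ∀ (f : (Fin n → ℝ) → ℝ) (hf : f ∈ symTest n), (∀ x, 0 ≤ f x) →
      (fun ω => ∫ μ, J (htest hf).toL2Sym μ ∂(K ω)) =ᵐ[Pr]
        fun ω => J (hP (htest hf)).toL2Sym (ζ ω) := by
    intro f hf h0
    have h1 : ∀ᵐ μ ∂(Pr.bind K), J (htest hf).toL2Sym μ = E.poly f μ := by
      rw [hK]; exact hJ f (htest hf) hf.1
    have h2 := E.ae_eq_poly hJ (hP (htest hf)) (E.integrable_semigroup X hX hrev t hf h0)
    have h3 := E.integral_poly_trans X hX hc hrev t hf h0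
    filter_upwards [Measure.ae_ae_of_ae_comp h1, ae_of_ae_map hζm.aemeasurable h2,
      ae_of_ae_map hζm.aemeasurable h3] with ω e1 e2 e3
    rw [e2, ← e3, integral_congr_ae e1, X.initKernel_apply hζ t ω,
      integral_map (X.measurable_η t).aemeasurable
        (E.measurable_poly hf.1.1).aestronglyMeasurable]
  have hsub : ∀ {f g : (Fin n → ℝ) → ℝ} (hf : MemL2Sym (ν n) f) (hg : MemL2Sym (ν n) g),
      (hP (hf.sub hg)).toL2Sym = (hP hf).toL2Sym - (hP hg).toL2Sym := by
    intro f g hf hg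
    rw [← MemL2Sym.toL2Sym_sub (hP hf) (hP hg)]
    exact MemL2Sym.toL2Sym_congr _ _ (X.semigroup_sub hX (hrev n) t hf hg)
  -- Positive and negative parts of a symmetric test function are again symmetric test functions,
  -- and both sides are additive almost surely.
  have hsym : ∀ (f : (Fin n → ℝ) → ℝ) (hf : f ∈ symTest n),
      (fun ω => ∫ μ, J (htest hf).toL2Sym μ ∂(K ω)) =ᵐ[Pr]
        fun ω => J (hP (htest hf)).toL2Sym (ζ ω) := by
    intro f hf
    have hp := posPart_mem_symTest hf
    have hn := posPart_mem_symTest ((symTest n).neg_mem hf)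
    have h2 : ((fun x => max (f x) 0) - fun x => max ((-f) x) 0) = f := by
      ext x
      exact max_zero_sub_max_neg_zero_eq_self (f x)
    have e1 : (htest hf).toL2Sym = (htest hp).toL2Sym - (htest hn).toL2Sym := by
      rw [← MemL2Sym.toL2Sym_sub (htest hp) (htest hn)]
      exact MemL2Sym.toL2Sym_congr _ _ (by rw [h2])
    have e2 : (hP (htest hf)).toL2Sym = (hP (htest hp)).toL2Sym - (hP (htest hn)).toL2Sym := by
      rw [← hsub (htest hp) (htest hn)]
      exact MemL2Sym.toL2Sym_congr _ _ (by rw [h2])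
    rw [e1, e2, map_sub, map_sub]
    filter_upwards [integral_kernel_sub hK (J (htest hp).toL2Sym) (J (htest hn).toL2Sym),
      hnonneg _ hp fun x => le_max_right _ _, hnonneg _ hn fun x => le_max_right _ _,
      ae_of_ae_map hζm.aemeasurable (Lp.coeFn_sub (J (hP (htest hp)).toL2Sym)
        (J (hP (htest hn)).toL2Sym))] with ω a1 a2 a3 a4
    rw [a1, a2, a3, a4]
    rfl
  have hAm : ∀ g : Lp ℝ 2 (Pr.map ζ), AEStronglyMeasurable (fun ω => ∫ μ, g μ ∂(K ω)) Pr :=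
    fun g => (Lp.stronglyMeasurable g).integral_kernel.aestronglyMeasurable
  have hBm : ∀ g : Lp ℝ 2 (Pr.map ζ), AEStronglyMeasurable (fun ω => g (ζ ω)) Pr :=
    fun g => ((Lp.stronglyMeasurable g).comp_measurable hζm).aestronglyMeasurable
  have hA : ∀ g : Lp ℝ 2 (Pr.map ζ),
      eLpNorm (fun ω => ∫ μ, g μ ∂(K ω)) 2 Pr ≤ eLpNorm g 2 (Pr.map ζ) := by
    intro g
    have h1 : MemLp g 2 (Pr.bind K) := by rw [hK]; exact Lp.memLp g
    have := (memLp_integral_kernel K (Lp.stronglyMeasurable g).measurable h1).2.2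
    rwa [hK] at this
  have hall : ∀ (f : (Fin n → ℝ) → ℝ) (hf : MemL2Sym (ν n) f),
      (fun ω => ∫ μ, J hf.toL2Sym μ ∂(K ω)) =ᵐ[Pr] fun ω => J (hP hf).toL2Sym (ζ ω) := by
    intro f hf
    set e : ℕ → ℝ≥0∞ := fun j => eLpNorm (truncate j f - f) 2 (ν n)
    have he : Tendsto e atTop (nhds 0) := tendsto_eLpNorm_truncate hf.1 2 two_ne_zero hf.2.2
    set D : Ω' → ℝ := fun ω => ∫ μ, J hf.toL2Sym μ ∂(K ω) - J (hP hf).toL2Sym (ζ ω) with hD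
    -- The defect of `f` is compared with that of its truncation, which is zero. One error term is
    -- controlled by the contraction `P_t` of the `n`-particle system, the other by the contraction
    -- coming from invariance of the law of `ζ`.
    have hle : ∀ j, eLpNorm D 2 Pr ≤ ENNReal.ofReal ‖J‖ * e j + ENNReal.ofReal ‖J‖ * e j := by
      intro j
      have hj := truncate_mem_symTest j hf.1 hf.2.1
      have h1 : D =ᵐ[Pr] (fun ω => J (hP (htest hj)).toL2Sym (ζ ω) - J (hP hf).toL2Sym (ζ ω)) -
          (fun ω => ∫ μ, (J (htest hj).toL2Sym - J hf.toL2Sym : Lp ℝ 2 _) μ ∂(K ω)) := by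
        filter_upwards [hsym _ hj,
          integral_kernel_sub hK (J (htest hj).toL2Sym) (J hf.toL2Sym)] with ω a1 a2
        rw [Pi.sub_apply, a2, hD, ← a1]
        ring
      rw [eLpNorm_congr_ae h1]
      refine (eLpNorm_sub_le ((hBm _).sub (hBm _)) (hAm _) one_le_two).trans (add_le_add ?_ ?_)
      · have h2 : (fun ω => J (hP (htest hj)).toL2Sym (ζ ω) - J (hP hf).toL2Sym (ζ ω)) =ᵐ[Pr]
            fun ω => (J (hP (htest hj)).toL2Sym - J (hP hf).toL2Sym : Lp ℝ 2 _) (ζ ω) := by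
          filter_upwards [ae_of_ae_map hζm.aemeasurable (Lp.coeFn_sub
            (J (hP (htest hj)).toL2Sym) (J (hP hf).toL2Sym))] with ω hω
          rw [hω]; rfl
        have h3 := eLpNorm_map_measure (p := 2) (Lp.aestronglyMeasurable
          (J (hP (htest hj)).toL2Sym - J (hP hf).toL2Sym : Lp ℝ 2 _)) hζm.aemeasurable
        refine (eLpNorm_congr_ae h2).trans_le ?_
        refine (le_of_eq h3.symm).trans ((norm_sub_le J _ _).trans ?_)
        gcongr
        rw [← eLpNorm_congr_ae (X.semigroup_sub hX (hrev n) t (htest hj) hf)]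
        exact (X.memL2Sym_semigroup hX (hrev n) t ((htest hj).sub hf)).2
      · exact (hA _).trans (norm_sub_le J (htest hj) hf)
    have h0 : eLpNorm D 2 Pr = 0 := by
      have h1 := ENNReal.Tendsto.const_mul (a := ENNReal.ofReal ‖J‖) he
        (Or.inr ENNReal.ofReal_ne_top)
      have h2 := h1.add h1
      rw [mul_zero, add_zero] at h2
      exact le_antisymm (ge_of_tendsto' h2 hle) zero_le
    have hDm : AEStronglyMeasurable D Pr := (hAm _).sub (hBm _)
    rw [eLpNorm_eq_zero_iff hDm two_ne_zero] at h0
    filter_upwards [h0] with ω hω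
    exact sub_eq_zero.1 hω
  intro f hf
  refine ⟨hP hf, fun G hG => ?_⟩
  have hg : MemLp (J hf.toL2Sym) 2 (Pr.bind K) := by rw [hK]; exact Lp.memLp _
  -- By invariance, a set that is null for the law of `ζ` is almost surely null for the conditional
  -- law at time `t`, so every version `G` gives the same expected value.
  have hGK : ∀ᵐ μ ∂(Pr.bind K), G μ = J hf.toL2Sym μ := by rw [hK]; exact hG
  filter_upwards [hall f hf, Measure.ae_ae_of_ae_comp hGK, (memLp_integral_kernel K
    (Lp.stronglyMeasurable (J hf.toL2Sym)).measurable hg).1] with ω h1 h2 h3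
  have h4 : ∀ᵐ ω' ∂(X.P (ζ ω)), G (X.η t ω') = J hf.toL2Sym (X.η t ω') :=
    ae_of_ae_map (X.measurable_η t).aemeasurable h2
  have h5 : Integrable (fun ω' => J hf.toL2Sym (X.η t ω')) (X.P (ζ ω)) :=
    h3.comp_measurable (X.measurable_η t)
  refine ⟨h5.congr (h4.mono fun _ h => h.symm), ?_⟩
  rw [integral_congr_ae h4, ← h1, X.initKernel_apply hζ t ω,
    integral_map (X.measurable_η t).aemeasurable (Lp.stronglyMeasurable _).aestronglyMeasurable]

end Ensemble

/-! ### Sums over partitions -/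

/-- A partition is determined by the block `insert x T` containing `x` and by the partition that it
induces on the remaining points. -/
theorem sum_finpartition_insert {U R : Type*} [DecidableEq U] [CommSemiring R] {s : Finset U}
    {x : U} (hx : x ∉ s) (w : Finset U → R) :
    ∑ σ : Finpartition (insert x s), ∏ A ∈ σ.parts, w A =
      ∑ T ∈ s.powerset, w (insert x T) * ∑ σ : Finpartition (s \ T), ∏ A ∈ σ.parts, w A := by
  have hxi : x ∈ insert x s := Finset.mem_insert_self x s
  rw [← Finset.sum_fiberwise_of_maps_to (s := Finset.univ) (t := s.powerset)
    (g := fun σ : Finpartition (insert x s) => (σ.part x).erase x)]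
  · refine Finset.sum_congr rfl fun T hT => ?_
    have hT' : T ⊆ s := Finset.mem_powerset.1 hT
    have hxT : x ∉ T := fun h => hx (hT' h)
    have hsd : insert x s \ insert x T = s \ T := by
      ext y
      simp only [Finset.mem_sdiff, Finset.mem_insert, not_or]
      constructor
      · rintro ⟨h1 | h1, h2, h3⟩
        · exact absurd h1 h2
        · exact ⟨h1, h3⟩
      · rintro ⟨h1, h2⟩
        exact ⟨Or.inr h1, fun h => hx (h ▸ h1), h2⟩
    have hne : insert x T ≠ ⊥ := Finset.insert_ne_empty x T
    have hdis : Disjoint (s \ T) (insert x T) := by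
      rw [Finset.disjoint_insert_right]
      exact ⟨fun h => hx (Finset.mem_sdiff.1 h).1, Finset.sdiff_disjoint⟩
    have hun : s \ T ⊔ insert x T = insert x s := by
      rw [Finset.sup_eq_union, Finset.union_insert, Finset.sdiff_union_of_subset hT']
    have hpart : ∀ σ : Finpartition (insert x s), (σ.part x).erase x = T ↔
        insert x T ∈ σ.parts := by
      intro σ
      constructor
      · rintro rfl
        rw [Finset.insert_erase (σ.mem_part_self.2 hxi)]
        exact σ.part_mem.2 hxi
      · intro h
        rw [σ.part_eq_of_mem h (Finset.mem_insert_self x T), Finset.erase_insert hxT]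
    have hnot : ∀ σ : Finpartition (s \ T), insert x T ∉ σ.parts := by
      intro σ h
      exact hx (Finset.mem_sdiff.1 (σ.subset h (Finset.mem_insert_self x T))).1
    rw [Finset.mul_sum]
    refine Finset.sum_bij' (fun σ _ => (σ.avoid (insert x T)).copy hsd)
      (fun σ _ => σ.extend hne hdis hun) (fun _ _ => Finset.mem_univ _) ?_ ?_ ?_ ?_
    · intro σ _
      rw [Finset.mem_filter, hpart]
      exact ⟨Finset.mem_univ _, Finset.mem_insert_self _ _⟩
    · intro σ hσ
      rw [Finset.mem_filter, hpart] at hσ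
      refine Finpartition.ext ?_
      ext C
      change C ∈ insert (insert x T) (σ.avoid (insert x T)).parts ↔ _
      rw [Finset.mem_insert, Finpartition.mem_avoid]
      constructor
      · rintro (rfl | ⟨D, hD, hn, rfl⟩)
        · exact hσ.2
        · have : Disjoint D (insert x T) := σ.disjoint hD hσ.2 (fun h => hn (h ▸ le_rfl))
          rwa [this.sdiff_eq_left]
      · intro hC
        by_cases h : C = insert x T
        · exact Or.inl h
        · have : Disjoint C (insert x T) := σ.disjoint hC hσ.2 h
          refine Or.inr ⟨C, hC, fun hle => ?_, this.sdiff_eq_left⟩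
          exact σ.ne_bot hC (le_bot_iff.1 (this le_rfl hle))
    · intro σ _
      refine Finpartition.ext ?_
      ext C
      change C ∈ ((σ.extend hne hdis hun).avoid (insert x T)).parts ↔ _
      rw [Finpartition.mem_avoid]
      constructor
      · rintro ⟨D, hD, hn, rfl⟩
        rcases Finset.mem_insert.1 hD with rfl | hD
        · exact absurd le_rfl hn
        · have : Disjoint D (insert x T) := hdis.mono_left (σ.subset hD)
          rwa [this.sdiff_eq_left]
      · intro hC
        have : Disjoint C (insert x T) := hdis.mono_left (σ.subset hC)
        refine ⟨C, Finset.mem_insert_of_mem hC, fun hle => ?_, this.sdiff_eq_left⟩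
        exact σ.ne_bot hC (le_bot_iff.1 (this le_rfl hle))
    · intro σ hσ
      rw [Finset.mem_filter, hpart] at hσ
      have : σ.parts = insert (insert x T) (σ.avoid (insert x T)).parts := by
        ext C
        rw [Finset.mem_insert, Finpartition.mem_avoid]
        constructor
        · intro hC
          by_cases h : C = insert x T
          · exact Or.inl h
          · have : Disjoint C (insert x T) := σ.disjoint hC hσ.2 h
            refine Or.inr ⟨C, hC, fun hle => ?_, this.sdiff_eq_left⟩
            exact σ.ne_bot hC (le_bot_iff.1 (this le_rfl hle))
        · rintro (rfl | ⟨D, hD, hn, rfl⟩)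
          · exact hσ.2
          · have : Disjoint D (insert x T) := σ.disjoint hD hσ.2 (fun h => hn (h ▸ le_rfl))
            rwa [this.sdiff_eq_left]
      rw [this, Finset.prod_insert]
      · rfl
      · exact hnot ((σ.avoid (insert x T)).copy hsd)
  · intro σ _
    rw [Finset.mem_powerset]
    intro y hy
    rw [Finset.mem_erase] at hy
    exact (Finset.mem_insert.1 (σ.part_subset x hy.2)).resolve_left hy.1

/-- With `C(N,t) t!` written as a falling factorial, the terms with `t ≥ 1` for `N + 1` are `N + 1`
times the sum for `N`. The term `t = 0` contributes the remaining `a`, giving the factor `a + N +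
1`. -/
theorem sum_choose_factorial_rise {R : Type*} [CommSemiring R] (a : R) (N : ℕ) :
    ∑ t ∈ Finset.range (N + 1), (N.choose t : R) * (t.factorial * (a * rise 1 a (N - t))) =
      rise 1 a (N + 1) := by
  have h : ∀ N t : ℕ, (N.choose t : R) * (t.factorial * (a * rise 1 a (N - t))) =
      (N.descFactorial t : R) * (a * rise 1 a (N - t)) := by
    intro N t
    rw [Nat.descFactorial_eq_factorial_mul_choose]
    push_cast
    ring
  simp only [h]
  induction N with
  | zero => simp [rise]
  | succ N ih =>
    have h2 : ∑ t ∈ Finset.range (N + 1), ((N + 1).descFactorial (t + 1) : R) *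
        (a * rise 1 a (N + 1 - (t + 1))) = (N + 1) * rise 1 a (N + 1) := by
      rw [← ih, Finset.mul_sum]
      refine Finset.sum_congr rfl fun t _ => ?_
      rw [Nat.succ_descFactorial_succ, Nat.add_sub_add_right]
      push_cast
      ring
    rw [Finset.sum_range_succ', h2, rise_succ 1 a (N + 1), Nat.descFactorial_zero, Nat.sub_zero]
    push_cast
    ring

open Classical in
/-- The mass that the block `A` contributes to the box with labels `φ`. -/
def blockMass {U ι : Type*} [Fintype ι] (φ : U → ι) (a : ι → ℝ≥0∞) (A : Finset U) : ℝ≥0∞ :=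
  ∑ i, if ∀ j ∈ A, φ j = i then a i else 0

open Classical in
-- The block of a chosen point `x` has nonzero mass only if it stays inside the fiber of `x`.
-- Removing it and using the induction hypothesis leaves the other fibers untouched, and the sum
-- over the size of the block is `sum_choose_factorial_rise`.
theorem sum_finpartition_blockMass {U ι : Type*} [DecidableEq U] [Fintype ι] (φ : U → ι)
    (a : ι → ℝ≥0∞) : ∀ (N : ℕ) (s : Finset U), s.card = N →
    ∑ σ : Finpartition s, ∏ A ∈ σ.parts, (((A.card - 1).factorial : ℕ) * blockMass φ a A) =
      ∏ i, rise 1 (a i) (s.filter fun j => φ j = i).card := by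
  intro N
  induction N using Nat.strong_induction_on with
  | _ N ih =>
    intro s hs
    rcases s.eq_empty_or_nonempty with rfl | ⟨x, hxs⟩
    · rw [Fintype.sum_eq_single 
        (show Finpartition (∅ : Finset U) from Finpartition.empty (Finset U))]
      · simp [rise]
      · intro σ hσ
        exact absurd (Subsingleton.elim (α := Finpartition (⊥ : Finset U)) σ _) hσ
    · obtain ⟨s, hx, rfl⟩ : ∃ s', x ∉ s' ∧ insert x s' = s :=
        ⟨s.erase x, Finset.notMem_erase x s, Finset.insert_erase hxs⟩
      rw [Finset.card_insert_of_notMem hx] at hs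
      rw [sum_finpartition_insert hx]
      set F := s.filter fun j => φ j = φ x with hF
      have h1 : ∀ T ∈ s.powerset,
          ((((insert x T).card - 1).factorial : ℕ) * blockMass φ a (insert x T)) *
            ∑ σ : Finpartition (s \ T), ∏ A ∈ σ.parts,
              (((A.card - 1).factorial : ℕ) * blockMass φ a A) =
          if T ⊆ F then (T.card.factorial * (a (φ x) * rise 1 (a (φ x)) (F.card - T.card))) *
            ∏ i ∈ Finset.univ.erase (φ x), rise 1 (a i) (s.filter fun j => φ j = i).card
          else 0 := by
        intro T hT
        have hT' : T ⊆ s := Finset.mem_powerset.1 hT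
        have hxT : x ∉ T := fun h => hx (hT' h)
        have hb : blockMass φ a (insert x T) = if T ⊆ F then a (φ x) else 0 := by
          rw [blockMass, Fintype.sum_eq_single (φ x)]
          · congr 1
            simp only [Finset.mem_insert, forall_eq_or_imp, true_and, eq_iff_iff]
            exact ⟨fun h j hj => Finset.mem_filter.2 ⟨hT' hj, h j hj⟩,
              fun h j hj => (Finset.mem_filter.1 (h hj)).2⟩
          · intro i hi
            rw [if_neg]
            exact fun h => hi (h x (Finset.mem_insert_self x T)).symm
        rw [hb, Finset.card_insert_of_notMem hxT, Nat.add_sub_cancel,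
          ih (s \ T).card (by
            have := Finset.card_le_card (Finset.sdiff_subset : s \ T ⊆ s)
            omega) (s \ T) rfl]
        split_ifs with hTF
        · rw [← Finset.mul_prod_erase _ _ (Finset.mem_univ (φ x)), mul_assoc, mul_assoc, mul_assoc]
          congr 3
          · have : ((s \ T).filter fun j => φ j = φ x) = F \ T := by
              ext j
              simp only [hF, Finset.mem_filter, Finset.mem_sdiff]
              tauto
            rw [this, Finset.card_sdiff_of_subset hTF]
          · refine Finset.prod_congr rfl fun i hi => ?_
            congr 2
            ext j
            simp only [Finset.mem_filter, Finset.mem_sdiff]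
            constructor
            · rintro ⟨⟨h1, -⟩, h2⟩
              exact ⟨h1, h2⟩
            · rintro ⟨h1, h2⟩
              refine ⟨⟨h1, fun h => ?_⟩, h2⟩
              exact (Finset.mem_erase.1 hi).1 (h2.symm.trans (Finset.mem_filter.1 (hTF h)).2)
        · rw [mul_zero, zero_mul]
      rw [Finset.sum_congr rfl h1, ← Finset.sum_filter]
      have h2 : s.powerset.filter (fun T => T ⊆ F) = F.powerset := by
        ext T
        simp only [Finset.mem_filter, Finset.mem_powerset]
        exact ⟨fun h => h.2, fun h => ⟨h.trans (Finset.filter_subset _ _), h⟩⟩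
      rw [h2, ← Finset.sum_mul]
      have h3 := Finset.sum_powerset_apply_card (x := F)
        (fun t => (t.factorial : ℝ≥0∞) * (a (φ x) * rise 1 (a (φ x)) (F.card - t)))
      rw [h3]
      simp only [nsmul_eq_mul]
      rw [sum_choose_factorial_rise, ← Finset.mul_prod_erase _ _ (Finset.mem_univ (φ x))]
      congr 1
      · rw [Finset.filter_insert, if_pos rfl, Finset.card_insert_of_notMem]
        exact fun h => hx (Finset.mem_filter.1 h).1
      · refine Finset.prod_congr rfl fun i hi => ?_
        rw [Finset.filter_insert, if_neg]
        exact fun h => (Finset.mem_erase.1 hi).1 h.symm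

/-! ### The measures `λ_n` and `κ_{n,k}` -/

theorem partitionMeasure_box (α : Measure ℝ) [SigmaFinite α] {n : ℕ}
    (σ : Finpartition (Finset.univ : Finset (Fin n))) {ι : Type} [Fintype ι] {B : ι → Set ℝ}
    (hB : IsCell B) (φ : Fin n → ι) :
    partitionMeasure α σ (box B φ) = ∏ A ∈ σ.parts, blockMass φ (fun i => α (B i)) A := by
  classical
  have hm : Measurable fun (z : {A // A ∈ σ.parts} → ℝ) (i : Fin n) =>
      z ⟨σ.part i, σ.part_mem.2 (Finset.mem_univ i)⟩ :=
    measurable_pi_lambda _ fun i => measurable_pi_apply _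
  rw [partitionMeasure, Measure.map_apply hm (hB.measurableSet_box φ)]
  have h1 : (fun (z : {A // A ∈ σ.parts} → ℝ) (i : Fin n) =>
      z ⟨σ.part i, σ.part_mem.2 (Finset.mem_univ i)⟩) ⁻¹' box B φ =
      Set.univ.pi fun A : {A // A ∈ σ.parts} => ⋂ i ∈ A.1, B (φ i) := by
    ext z
    simp only [Set.mem_preimage, mem_box, Set.mem_univ_pi, Set.mem_iInter]
    constructor
    · rintro h ⟨A, hA⟩ i hi
      have h2 := h i
      have h3 : σ.part i = A := σ.part_eq_of_mem hA hi
      have h4 : (⟨σ.part i, σ.part_mem.2 (Finset.mem_univ i)⟩ : {A // A ∈ σ.parts}) =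
        ⟨A, hA⟩ := Subtype.ext h3
      rwa [h4] at h2
    · intro h i
      exact h _ i (σ.mem_part_self.2 (Finset.mem_univ i))
  rw [h1, Measure.pi_pi, ← Finset.prod_coe_sort σ.parts]
  refine Finset.prod_congr rfl fun A _ => ?_
  obtain ⟨x, hx⟩ := σ.nonempty_of_mem_parts A.2
  rw [blockMass, Fintype.sum_eq_single (φ x)]
  · split_ifs with h
    · congr 1
      ext y
      simp only [Set.mem_iInter]
      exact ⟨fun hy => hy x hx, fun hy i hi => by rw [h i hi]; exact hy⟩
    · have : ⋂ i ∈ A.1, B (φ i) = ∅ := by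
        refine Set.eq_empty_of_forall_notMem fun y hy => h fun j hj => ?_
        simp only [Set.mem_iInter] at hy
        exact hB.eq_of_mem (hy j hj) (hy x hx)
      rw [this, measure_empty]
  · intro i hi
    rw [if_neg]
    exact fun h => hi (h x hx).symm

theorem lambdaMeasure_box (α : Measure ℝ) [SigmaFinite α] {n : ℕ} {ι : Type} [Fintype ι]
    {B : ι → Set ℝ} (hB : IsCell B) (φ : Fin n → ι) :
    lambdaMeasure α n (box B φ) = ∏ i, rise 1 (α (B i)) (fib φ i) := by
  classical
  have h := sum_finpartition_blockMass φ (fun i => α (B i)) _ (Finset.univ : Finset (Fin n)) rfl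
  rw [lambdaMeasure, Measure.finsetSum_apply]
  simp only [Measure.smul_apply, nsmul_eq_mul, partitionMeasure_box α _ hB φ]
  refine Eq.trans ?_ (h.trans ?_)
  · refine Finset.sum_congr rfl fun σ _ => ?_
    rw [Finset.prod_mul_distrib]
    push_cast
    rfl
  · refine Finset.prod_congr rfl fun i _ => ?_
    rw [fib]

theorem addKernel_apply (α : Measure ℝ) {k : ℕ} (x : Fin k → ℝ) (m : ℕ) (y : Fin m → ℝ)
    {B : Set ℝ} (hB : MeasurableSet B) :
    addKernel α x m y B = α B + cntVec B x + cntVec B y := by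
  classical
  have h : ∀ {l : ℕ} (z : Fin l → ℝ), ∑ i, Measure.dirac (z i) B = (cntVec B z : ℝ≥0∞) := by
    intro l z
    simp only [Measure.dirac_apply' _ hB, Set.indicator_apply, Pi.one_apply]
    rw [cntVec, Finset.card_filter]
    push_cast
    refine Finset.sum_congr rfl fun i _ => ?_
    split_ifs <;> rfl
  have h1 : addKernel α x m y =
      α + ∑ i, Measure.dirac (x i) + ∑ j, Measure.dirac (y j) := by
    unfold addKernel
    simp only [FunLike.coe_add, FunLike.coe_sum, Pi.add_apply, Finset.sum_apply,
      Kernel.const_apply, Kernel.deterministic_apply]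
  rw [h1, Measure.add_apply, Measure.add_apply, Measure.finsetSum_apply,
    Measure.finsetSum_apply, h x, h y]

instance isSFiniteKernel_addKernel (α : Measure ℝ) [SFinite α] {k : ℕ} (x : Fin k → ℝ) (m : ℕ) :
    IsSFiniteKernel (addKernel α x m) := by
  have h1 : IsSFiniteKernel (∑ i, Kernel.const (Fin m → ℝ) (Measure.dirac (x i))) :=
    Kernel.IsSFiniteKernel.finsetSum _ fun i _ => inferInstance
  have h2 : IsSFiniteKernel (∑ j : Fin m, Kernel.deterministic (fun y : Fin m → ℝ => y j)
      (measurable_pi_apply j)) := Kernel.IsSFiniteKernel.finsetSum _ fun i _ => inferInstance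
  unfold addKernel
  infer_instance

instance sFinite_kappa (α : Measure ℝ) [SFinite α] {k : ℕ} (x : Fin k → ℝ) (m : ℕ) :
    SFinite (kappa α x m) := by
  induction m with
  | zero => unfold kappa; infer_instance
  | succ m ih => unfold kappa; infer_instance

/-- As in a Pólya urn, every coordinate that falls into a cell raises the weight of that cell by one
for the next draw, which appends one factor to its rising factorial. -/
theorem kappa_box (α : Measure ℝ) [SFinite α] {k : ℕ} (x : Fin k → ℝ) (m : ℕ) {ι : Type}
    [Fintype ι] {B : ι → Set ℝ} (hB : IsCell B) (ψ : Fin m → ι) :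
    kappa α x m (box B ψ) = ∏ i, rise 1 (α (B i) + (1 : ℕ) * cntVec (B i) x) (fib ψ i) := by
  classical
  induction m with
  | zero =>
    have h1 : (Fin.elim0 : Fin 0 → ℝ) ∈ box B ψ := mem_box.2 fun j => j.elim0
    have h2 : ∀ i, fib ψ i = 0 := fun i => by simp [fib]
    rw [kappa, Measure.dirac_apply' _ (hB.measurableSet_box ψ), Set.indicator_of_mem h1]
    simp [h2, rise]
  | succ m ih =>
    have hsnoc : Measurable fun q : (Fin m → ℝ) × ℝ => (Fin.snoc q.1 q.2 : Fin (m + 1) → ℝ) := by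
      refine measurable_pi_lambda _ fun j => ?_
      refine Fin.lastCases ?_ (fun j => ?_) j
      · simp only [Fin.snoc_last]; exact measurable_snd
      · simp only [Fin.snoc_castSucc]
        exact (measurable_pi_apply j).comp measurable_fst
    have hpre : (fun q : (Fin m → ℝ) × ℝ => (Fin.snoc q.1 q.2 : Fin (m + 1) → ℝ)) ⁻¹' box B ψ =
        box B (fun j : Fin m => ψ j.castSucc) ×ˢ B (ψ (Fin.last m)) := by
      ext q
      simp [mem_box, Fin.forall_fin_succ', Fin.snoc_last, Fin.snoc_castSucc]
    rw [kappa, Measure.map_apply hsnoc (hB.measurableSet_box ψ), hpre,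
      Measure.compProd_apply_prod (hB.measurableSet_box _) (hB.meas _)]
    have h1 : ∀ y ∈ box B (fun j : Fin m => ψ j.castSucc), addKernel α x m y (B (ψ (Fin.last m))) =
        α (B (ψ (Fin.last m))) + cntVec (B (ψ (Fin.last m))) x +
          fib (fun j : Fin m => ψ j.castSucc) (ψ (Fin.last m)) := by
      intro y hy
      rw [addKernel_apply α x m y (hB.meas _), cntVec_of_mem_box hB hy]
    rw [setLIntegral_congr_fun (hB.measurableSet_box _) h1, setLIntegral_const, ih,
      ← Finset.mul_prod_erase _ _ (Finset.mem_univ (ψ (Fin.last m))),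
      ← Finset.mul_prod_erase Finset.univ (fun i => rise 1 _ (fib ψ i))
        (Finset.mem_univ (ψ (Fin.last m)))]
    have h2 : ∀ i, fib ψ i =
        fib (fun j : Fin m => ψ j.castSucc) i + if ψ (Fin.last m) = i then 1 else 0 := by
      intro i
      rw [fib_eq_sum, fib_eq_sum, Fin.sum_univ_castSucc]
    rw [h2 (ψ (Fin.last m)), if_pos rfl, rise_succ]
    have h3 : ∏ i ∈ Finset.univ.erase (ψ (Fin.last m)),
        rise 1 (α (B i) + (1 : ℕ) * cntVec (B i) x) (fib ψ i) =
        ∏ i ∈ Finset.univ.erase (ψ (Fin.last m)),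
        rise 1 (α (B i) + (1 : ℕ) * cntVec (B i) x) (fib (fun j : Fin m => ψ j.castSucc) i) := by
      refine Finset.prod_congr rfl fun i hi => ?_
      rw [h2 i, if_neg (fun h => (Finset.mem_erase.1 hi).1 h.symm), add_zero]
    rw [h3]
    simp only [Nat.cast_one, one_mul]
    ring

/-! ### Point processes with independent increments and given one-dimensional distributions -/

section Weight

/-- The weights `a (a + c) ⋯ (a + (j - 1) c) p ^ j / j! Z(a)`. -/
def weight (c : ℕ) (p : ℝ≥0) (Z : ℝ≥0 → ℝ≥0) (a : ℝ≥0) (j : ℕ) : ℝ≥0 :=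
  rise c a j * (p ^ j / j.factorial) * Z a

variable {c : ℕ} {p b : ℝ≥0} {Z : ℝ≥0 → ℝ≥0}

/-- Weighting the distribution with `(N)_k` and shifting by `k` yields the same family with
parameter `a + c k`; `hZ` is the compatibility of the normalizing constants. As shifted weights
again sum to one, the factorial moments can be read off. -/
theorem descFactorial_mul_weight (hZ : ∀ a (k : ℕ), Z a * p ^ k = b ^ k * Z (a + c * k)) (a : ℝ≥0)
    (i k : ℕ) : ((i + k).descFactorial k : ℝ≥0) * weight c p Z a (i + k) =
      b ^ k * rise c a k * weight c p Z (a + c * k) i := by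
  have h1 : ((i + k).factorial : ℝ≥0) = i.factorial * (i + k).descFactorial k := by
    have := Nat.factorial_mul_descFactorial (Nat.le_add_left k i)
    rw [Nat.add_sub_cancel] at this
    exact_mod_cast this.symm
  have h2 : (i.factorial : ℝ≥0) ≠ 0 := by exact_mod_cast i.factorial_ne_zero
  have h3 : ((i + k).descFactorial k : ℝ≥0) ≠ 0 := by
    intro h
    rw [h, mul_zero] at h1
    exact (i + k).factorial_ne_zero (by exact_mod_cast h1)
  have h4 : rise c a (i + k) = rise c a k * rise c (a + c * k) i := by
    rw [add_comm i k, rise_add]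
  rw [weight, weight, h1, h4, pow_add]
  calc _ = rise c a k * rise c (a + c * k) i * (p ^ i / i.factorial) * (Z a * p ^ k) := by
        field_simp
    _ = _ := by rw [hZ]; ring

theorem tsum_descFactorial_mul_weight
    (hZ : ∀ a (k : ℕ), Z a * p ^ k = b ^ k * Z (a + c * k))
    (h1 : ∀ a, ∑' j, (weight c p Z a j : ℝ≥0∞) = 1) (a : ℝ≥0) (k : ℕ) :
    ∑' j, (j.descFactorial k : ℝ≥0∞) * weight c p Z a j = b ^ k * (rise c a k : ℝ≥0) := by
  rw [← ENNReal.summable.sum_add_tsum_nat_add' (k := k), Finset.sum_eq_zero, zero_add]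
  · have : ∀ i, ((i + k).descFactorial k : ℝ≥0∞) * weight c p Z a (i + k) =
        b ^ k * (rise c a k : ℝ≥0) * weight c p Z (a + c * k) i := fun i => by
      exact_mod_cast congrArg ((↑) : ℝ≥0 → ℝ≥0∞) (descFactorial_mul_weight hZ a i k)
    simp only [this]
    rw [ENNReal.tsum_mul_left, h1, mul_one]
  · intro i hi
    rw [Nat.descFactorial_eq_zero_iff_lt.2 (Finset.mem_range.1 hi), Nat.cast_zero, zero_mul]

end Weight

section Law

variable {Ω' : Type*} [MeasurableSpace Ω'] {Pr : Measure Ω'} {ζ : Ω' → Config}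

theorem ae_lt_top_of_law [IsProbabilityMeasure Pr] (hζm : Measurable ζ) {A : Set ℝ}
    (hA : MeasurableSet A) {w : ℕ → ℝ≥0∞} (hw : ∀ k : ℕ, Pr {ω | (ζ ω).1 A = k} = w k)
    (h1 : ∑' k, w k = 1) : ∀ᵐ ω ∂Pr, (ζ ω).1 A < ∞ := by
  have hm : Measurable fun ω => (ζ ω).1 A :=
    (Measure.measurable_coe hA).comp (measurable_subtype_coe.comp hζm)
  have hs : ∀ k : ℕ, MeasurableSet {ω | (ζ ω).1 A = k} := fun k => hm (measurableSet_singleton _)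
  have h2 : Pr (⋃ k : ℕ, {ω | (ζ ω).1 A = k}) = 1 := by
    rw [measure_iUnion _ hs]
    · simp only [hw, h1]
    · intro i j hij
      refine Set.disjoint_left.2 fun ω hi hj => hij ?_
      have hi' : (ζ ω).1 A = i := hi
      have hj' : (ζ ω).1 A = j := hj
      exact_mod_cast hi'.symm.trans hj'
  have h3 : ∀ᵐ ω ∂Pr, ω ∈ ⋃ k : ℕ, {ω | (ζ ω).1 A = k} :=
    (prob_compl_eq_zero_iff (MeasurableSet.iUnion hs)).2 h2
  filter_upwards [h3] with ω hω
  obtain ⟨k, hk⟩ := Set.mem_iUnion.1 hω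
  have hk' : (ζ ω).1 A = k := hk
  rw [hk']
  exact ENNReal.natCast_lt_top k

theorem lintegral_comp_cnt [IsProbabilityMeasure Pr] (hζm : Measurable ζ) {A : Set ℝ}
    (hA : MeasurableSet A) {w : ℕ → ℝ≥0∞} (hw : ∀ k : ℕ, Pr {ω | (ζ ω).1 A = k} = w k)
    (h1 : ∑' k, w k = 1) (g : ℕ → ℝ≥0∞) :
    ∫⁻ μ, g (cnt A μ) ∂(Pr.map ζ) = ∑' k, g k * w k := by
  rw [lintegral_map (f := fun μ => g (cnt A μ)) (measurable_from_nat.comp (measurable_cnt hA)) hζm,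
    ← lintegral_map (f := g) (g := fun ω => cnt A (ζ ω)) measurable_from_nat
      ((measurable_cnt hA).comp hζm), lintegral_countable']
  refine tsum_congr fun k => ?_
  rw [Measure.map_apply (f := fun ω => cnt A (ζ ω)) ((measurable_cnt hA).comp hζm)
    (measurableSet_singleton _), ← hw k]
  congr 1
  refine measure_congr ?_
  filter_upwards [ae_lt_top_of_law hζm hA hw h1] with ω hω
  refine propext ?_
  change cnt A (ζ ω) = k ↔ (ζ ω).1 A = k
  rw [← natCast_cnt hA hω]
  exact Nat.cast_inj.symm

theorem iIndepFun_cnt_map (hζm : Measurable ζ)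
    (h : ∀ (N : ℕ) (A : Fin N → Set ℝ), (∀ i, MeasurableSet (A i)) →
      Pairwise (fun i j => Disjoint (A i) (A j)) → iIndepFun (fun i ω => (ζ ω).1 (A i)) Pr)
    {ι : Type} [Fintype ι] {B : ι → Set ℝ} (hB : IsCell B) :
    iIndepFun (fun i => cnt (B i)) (Pr.map ζ) := by
  set e := (Fintype.equivFin ι).symm
  have h1 := h (Fintype.card ι) (fun i => B (e i)) (fun i => hB.meas _)
    fun i j hij => hB.disj (e.injective.ne hij)
  have h2 : iIndepFun (fun i ω => (ζ ω).1 (B i)) Pr :=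
    (iIndepFun_precomp_of_bijective e.bijective).1 h1
  have h3 : iIndepFun (fun i ω => cnt (B i) (ζ ω)) Pr :=
    h2.comp (fun _ x => ⌊x.toReal⌋₊) fun _ => Nat.measurable_floor.comp ENNReal.measurable_toReal
  rw [iIndepFun_iff_measure_inter_preimage_eq_mul] at h3 ⊢
  intro S s hs
  have hm : ∀ i, Measurable (cnt (B i)) := fun i => measurable_cnt (hB.meas i)
  rw [Measure.map_apply hζm (Finset.measurableSet_biInter _ fun i hi => hm i (hs i hi))]
  have h4 := h3 S hs
  simp only [Set.preimage_iInter]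
  refine h4.trans (Finset.prod_congr rfl fun i hi => ?_)
  rw [Measure.map_apply hζm (hm i (hs i hi))]
  rfl

theorem ensemble_of_law [IsProbabilityMeasure Pr] {c : ℕ} {p b : ℝ≥0} {Z : ℝ≥0 → ℝ≥0}
    (hZ : ∀ a (k : ℕ), Z a * p ^ k = b ^ k * Z (a + c * k))
    (h1 : ∀ a, ∑' j, (weight c p Z a j : ℝ≥0∞) = 1) {α : Measure ℝ}
    (hα : ∀ B : Set ℝ, Bornology.IsBounded B → α B < ∞)
    {κ : (k m : ℕ) → (Fin k → ℝ) → Measure (Fin m → ℝ)} {ν : (n : ℕ) → Measure (Fin n → ℝ)}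
    (hκ : ∀ (k m : ℕ) (x : Fin k → ℝ) (ι : Type) [Fintype ι] (B : ι → Set ℝ), IsCell B →
      ∀ ψ : Fin m → ι, κ k m x (box B ψ) = ∏ i, rise c (α (B i) + c * cntVec (B i) x) (fib ψ i))
    (hν : ∀ (n : ℕ) (ι : Type) [Fintype ι] (B : ι → Set ℝ), IsCell B →
      ∀ φ : Fin n → ι, ν n (box B φ) = ∏ i, rise c (α (B i)) (fib φ i))
    (hζm : Measurable ζ)
    (h : ∀ (N : ℕ) (A : Fin N → Set ℝ), (∀ i, MeasurableSet (A i)) →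
      Pairwise (fun i j => Disjoint (A i) (A j)) → iIndepFun (fun i ω => (ζ ω).1 (A i)) Pr)
    (hw : ∀ A : Set ℝ, MeasurableSet A → α A < ∞ → ∀ k : ℕ,
      Pr {ω | (ζ ω).1 A = k} = (weight c p Z (α A).toNNReal k : ℝ≥0)) :
    Ensemble c b α κ ν (Pr.map ζ) where
  prob := Measure.isProbabilityMeasure_map hζm.aemeasurable
  fin := hα
  κ_box := hκ
  ν_box := hν
  locFin := by
    refine (ae_map_iff hζm.aemeasurable measurableSet_isLocFin).2 (ae_all_iff.2 fun R => ?_)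
    exact ae_lt_top_of_law hζm measurableSet_Icc
      (hw _ measurableSet_Icc (hα _ (Metric.isBounded_Icc _ _))) (h1 _)
  indep := fun ι _ B hB => iIndepFun_cnt_map hζm h hB
  fact := by
    intro B hB hb k
    rw [lintegral_comp_cnt hζm hB (hw B hB (hα B hb)) (h1 _)
      (fun j => ((j.descFactorial k : ℕ) : ℝ≥0∞)), tsum_descFactorial_mul_weight hZ h1]
    congr 1
    have h2 : ((rise c (α B).toNNReal k : ℝ≥0) : ℝ≥0∞) = rise c ((α B).toNNReal : ℝ≥0∞) k :=
      rise_map ENNReal.ofNNRealHom c (α B).toNNReal k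
    rwa [ENNReal.coe_toNNReal (hα B hb).ne] at h2

end Law

/-! ### The Poisson and the Pascal distribution -/

theorem rise_zero_left {R : Type*} [CommSemiring R] (a : R) (m : ℕ) : rise 0 a m = a ^ m := by
  simp [rise]

theorem tsum_coe_eq_one {w : ℕ → ℝ≥0} (h : HasSum (fun j => (w j : ℝ)) 1) :
    ∑' j, (w j : ℝ≥0∞) = 1 := by
  have h1 : HasSum w 1 := NNReal.hasSum_coe.1 (by rwa [NNReal.coe_one])
  rw [← ENNReal.coe_tsum h1.summable, h1.tsum_eq, ENNReal.coe_one]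

theorem coe_weight_poisson (a : ℝ≥0) (j : ℕ) :
    (weight 0 1 (fun a => ⟨Real.exp (-a), (Real.exp_pos _).le⟩) a j : ℝ) =
      Real.exp (-a) * a ^ j / j.factorial := by
  simp only [weight, rise_zero_left, one_pow]
  change (a : ℝ) ^ j * (1 / j.factorial) * Real.exp (-a) = _
  ring

theorem hasSum_rise {p : ℝ} (hp : 0 < p) (hp1 : p < 1) (a : ℝ) :
    HasSum (fun j : ℕ => rise 1 a j * (p ^ j / j.factorial)) ((1 - p) ^ (-a)) := by
  have h := (Real.one_div_one_sub_rpow_hasFPowerSeriesOnBall_zero a).hasSum (y := p) (by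
    rw [Metric.mem_eball, edist_eq_enorm_sub, sub_zero, Real.enorm_eq_ofReal hp.le]
    exact_mod_cast ENNReal.ofReal_lt_one.2 hp1)
  rw [zero_add, one_div, ← Real.rpow_neg (by linarith)] at h
  -- The coefficients of the negative binomial series are generalized binomial coefficients, that
  -- is, ascending Pochhammer symbols divided by `j!`.
  have key : ∀ j : ℕ, Ring.choose (a + j - 1) j = rise 1 a j / j.factorial := by
    intro j
    have h1 : Ring.choose (a + j - 1) j = Ring.multichoose a j := by
      rw [Ring.choose]; congr 1; ring
    rw [h1, eq_div_iff (by positivity), mul_comm, ← nsmul_eq_mul,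
      Ring.factorial_nsmul_multichoose_eq_ascPochhammer, Polynomial.ascPochhammer_smeval_eq_eval]
    clear h1
    induction j with
    | zero => simp [rise_zero]
    | succ j ih => rw [rise_succ, ascPochhammer_succ_eval, ih, Nat.cast_one, one_mul]
  have h2 : (fun n : ℕ => FormalMultilinearSeries.ofScalars ℝ
      (fun n : ℕ => Ring.choose (a + n - 1) n) n fun _ => p) =
      fun j => rise 1 a j * (p ^ j / j.factorial) := by
    funext j
    rw [FormalMultilinearSeries.ofScalars_apply_eq, key, smul_eq_mul]
    ring
  rw [h2] at h
  exact h

theorem tsum_weight_poisson (a : ℝ≥0) :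
    ∑' j, (weight 0 1 (fun a => ⟨Real.exp (-a), (Real.exp_pos _).le⟩) a j : ℝ≥0∞) = 1 :=
  tsum_coe_eq_one (by simpa only [coe_weight_poisson] using hasSum_one_poissonMeasure a)

theorem ensemble_poisson {Ω' : Type*} [MeasurableSpace Ω'] {Pr : Measure Ω'}
    [IsProbabilityMeasure Pr] {ζ : Ω' → Config} (h : IsPoissonProcess Pr ζ) :
    Ensemble 0 1 volume (fun _ _ _ => volume) (fun _ => volume) (Pr.map ζ) := by
  have hbox : ∀ (m : ℕ) (ι : Type) [Fintype ι] (B : ι → Set ℝ), IsCell B → ∀ ψ : Fin m → ι,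
      (volume : Measure (Fin m → ℝ)) (box B ψ) = ∏ i, volume (B i) ^ fib ψ i := by
    intro m ι _ B _ ψ
    rw [box, volume_pi_pi]
    classical
    simp only [fib, Finset.card_filter, ← Finset.prod_pow_eq_pow_sum]
    rw [Finset.prod_comm]
    refine Finset.prod_congr rfl fun j _ => ?_
    rw [Finset.prod_eq_single (ψ j) (fun i _ hi => by simp [hi.symm]) (by simp)]
    simp
  refine ensemble_of_law (p := 1) (Z := fun a => ⟨Real.exp (-a), (Real.exp_pos _).le⟩)
    (fun a k => by simp only [one_pow, Nat.cast_zero, zero_mul, add_zero]; exact mul_comm _ _)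
    tsum_weight_poisson (fun B hB => hB.measure_lt_top) ?_ ?_ h.1 h.2.1 ?_
  · intro k m x ι _ B hB ψ
    simp only [rise_zero_left, Nat.cast_zero, zero_mul, add_zero]
    exact hbox m ι B hB ψ
  · intro n ι _ B hB φ
    simp only [rise_zero_left]
    exact hbox n ι B hB φ
  · intro A hA hA' k
    rw [h.2.2.1 A hA hA' k, poissonMeasure_singleton, ← coe_weight_poisson,
      ENNReal.ofReal_coe_nnreal]

theorem coe_weight_pascal {p : ℝ} (hp : 0 < p) (hp1 : p < 1) (a : ℝ≥0) (j : ℕ) :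
    (weight 1 ⟨p, hp.le⟩ (fun a => ⟨(1 - p) ^ (a : ℝ), Real.rpow_nonneg (by linarith) _⟩) a j : ℝ) =
      rise 1 (a : ℝ) j * (p ^ j / j.factorial) * (1 - p) ^ (a : ℝ) := by
  have h : ((rise 1 a j : ℝ≥0) : ℝ) = rise 1 (a : ℝ) j := rise_map NNReal.toRealHom 1 a j
  rw [← h]
  rfl

theorem tsum_weight_pascal {p : ℝ} (hp : 0 < p) (hp1 : p < 1) (a : ℝ≥0) :
    ∑' j, (weight 1 ⟨p, hp.le⟩
      (fun a => ⟨(1 - p) ^ (a : ℝ), Real.rpow_nonneg (by linarith) _⟩) a j : ℝ≥0∞) = 1 := by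
  refine tsum_coe_eq_one ?_
  simp only [coe_weight_pascal hp hp1]
  have h := (hasSum_rise hp hp1 a).mul_right ((1 - p) ^ (a : ℝ))
  rwa [← Real.rpow_add (by linarith), neg_add_cancel, Real.rpow_zero] at h

theorem alpha_lt_top (θ : ℝ≥0) {B : Set ℝ} (hB : Bornology.IsBounded B) : alpha θ B < ∞ := by
  rw [alpha, Measure.smul_apply]
  exact ENNReal.mul_lt_top ENNReal.coe_lt_top hB.measure_lt_top

theorem ensemble_pascal {Ω' : Type*} [MeasurableSpace Ω'] {Pr : Measure Ω'}
    [IsProbabilityMeasure Pr] {ζ : Ω' → Config} {θ : ℝ≥0} {p : ℝ} (hp : 0 < p) (hp1 : p < 1)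
    (h : IsPascalProcess p (alpha θ) Pr ζ) :
    Ensemble 1 ⟨p / (1 - p), div_nonneg hp.le (by linarith)⟩ (alpha θ)
      (fun _ m x => kappa (alpha θ) x m) (lambdaMeasure (alpha θ)) (Pr.map ζ) := by
  have hq : 0 < 1 - p := by linarith
  refine ensemble_of_law (p := ⟨p, hp.le⟩)
    (Z := fun a => ⟨(1 - p) ^ (a : ℝ), Real.rpow_nonneg hq.le _⟩)
    (fun a k => ?_) (tsum_weight_pascal hp hp1) (fun B hB => alpha_lt_top θ hB) ?_ ?_ h.1 h.2.1 ?_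
  · refine NNReal.eq ?_
    change (1 - p) ^ (a : ℝ) * p ^ k = (p / (1 - p)) ^ k * (1 - p) ^ ((a + (1 : ℕ) * k : ℝ≥0) : ℝ)
    push_cast
    rw [one_mul, Real.rpow_add hq, Real.rpow_natCast, div_pow]
    field_simp
  · intro k m x ι _ B hB ψ
    exact kappa_box (alpha θ) x m hB ψ
  · intro n ι _ B hB φ
    exact lambdaMeasure_box (alpha θ) hB φ
  · intro A hA hA' k
    rw [← ENNReal.ofReal_coe_nnreal, coe_weight_pascal hp hp1, ENNReal.coe_toNNReal_eq_toReal]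
    -- The formula for the distribution is given only for positive `α A`. For `α A = 0` the weight
    -- formula is the point mass at zero, in agreement with `ζ(A) = 0` almost surely.
    rcases eq_or_ne (alpha θ A) 0 with h0 | h0
    · have h1 := h.2.2.2.1 A hA h0
      rw [h0, ENNReal.toReal_zero, Real.rpow_zero, mul_one]
      cases k with
      | zero =>
        rw [rise_zero]
        have h2 : {ω | (ζ ω).1 A = (0 : ℕ)} =ᵐ[Pr] Set.univ :=
          eventuallyEq_univ.2 (h1.mono fun ω h3 => h3.trans Nat.cast_zero.symm)
        rw [measure_congr h2, measure_univ]
        simp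
      | succ k =>
        have h2 : rise 1 (0 : ℝ) (k + 1) = 0 :=
          Finset.prod_eq_zero (Finset.mem_range.2 k.succ_pos) (by simp)
        rw [h2, zero_mul, ENNReal.ofReal_zero]
        refine measure_mono_null ?_ (ae_iff.1 h1)
        intro ω hω h3
        have hω' : (ζ ω).1 A = ((k + 1 : ℕ) : ℝ≥0∞) := hω
        rw [h3] at hω'
        exact k.succ_ne_zero (by exact_mod_cast hω'.symm)
    · rw [h.2.2.1 A hA (pos_iff_ne_zero.2 h0) hA' k]
      simp only [rise, Nat.cast_one, one_mul]

/-! ### The polynomials in terms of the factorial measures -/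

theorem symmetrize_eq {n : ℕ} {f : (Fin n → ℝ) → ℝ} (hf : IsSymm f) : symmetrize f = f := by
  funext x
  rw [symmetrize, Finset.sum_congr rfl fun s _ => hf s x, Finset.sum_const, Finset.card_univ,
    Fintype.card_perm, Fintype.card_fin, nsmul_eq_mul, ← mul_assoc,
    inv_mul_cancel₀ (by exact_mod_cast n.factorial_ne_zero), one_mul]

namespace Ensemble

variable {c : ℕ} {b : ℝ≥0} {α : Measure ℝ}
  {κ : (k m : ℕ) → (Fin k → ℝ) → Measure (Fin m → ℝ)} {ν : (n : ℕ) → Measure (Fin n → ℝ)}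
  {π : Measure Config} (E : Ensemble c b α κ ν π)

theorem level_eq {n k : ℕ} (hk : k ≤ n) {f : (Fin n → ℝ) → ℝ} (hf : f ∈ symTest n) {μ : Config}
    (hμ : IsLocFin μ) : E.level f k μ =
      ∫ x, (∫ y, symmetrize f (glue x y) ∂(κ k (n - k) x)) ∂(factorialMeasure k μ.1) := by
  have hi : Integrable f ((E.ext hk ∘ₖ factKernel k) μ) :=
    memLp_one_iff_integrable.1 (hf.1.memLp (E.tau_cube_lt_top hk μ) 1)
  rw [E.level_of_le hk, tau, Kernel.integral_comp hi, factKernel_apply k hμ, symmetrize_eq hf.2]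
  refine integral_congr_ae (Eventually.of_forall fun x => ?_)
  change ∫ y, f y ∂(E.ext hk x) = _
  rw [E.ext_apply hk, integral_map (measurable_glue_right x).aemeasurable
    hf.1.1.aestronglyMeasurable]

theorem poly_ae_eq {n : ℕ} {f : (Fin n → ℝ) → ℝ} (hf : f ∈ symTest n) :
    E.poly f =ᵐ[π] fun μ => ∑ k ∈ Finset.range (n + 1), (n.choose k : ℝ) * (-(b : ℝ)) ^ (n - k) *
      ∫ x, (∫ y, symmetrize f (glue x y) ∂(κ k (n - k) x)) ∂(factorialMeasure k μ.1) := by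
  filter_upwards [E.locFin] with μ hμ
  refine Finset.sum_congr rfl fun k hk => ?_
  rw [E.level_eq (Nat.lt_succ_iff.1 (Finset.mem_range.1 hk)) hf hμ, mul_assoc]

end Ensemble

theorem isL2Extension_congr {n : ℕ} {ν : Measure (Fin n → ℝ)} {π : Measure Config}
    {T T' : ((Fin n → ℝ) → ℝ) → Config → ℝ} (h : ∀ f ∈ symTest n, T f =ᵐ[π] T' f)
    {J : L2Sym ν →L[ℝ] Lp ℝ 2 π} : IsL2Extension ν π T J ↔ IsL2Extension ν π T' J :=
  forall_congr' fun f => forall_congr' fun hf => forall_congr' fun hf' =>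
    ⟨fun h' => h'.trans (h f ⟨hf', hf.2.1⟩), fun h' => h'.trans (h f ⟨hf', hf.2.1⟩).symm⟩

variable {Ω Ω' : Type*} [MeasurableSpace Ω] [MeasurableSpace Ω']

theorem l2Extension_intertwines (X : MarkovFamily Ω) {Pr : Measure Ω'} [IsProbabilityMeasure Pr]
    {ζ : Ω' → Config} (hζ : IsProper ζ) (hζm : Measurable ζ)
    {c : ℕ} {b : ℝ≥0} {α : Measure ℝ} {κ : (k m : ℕ) → (Fin k → ℝ) → Measure (Fin m → ℝ)}
    {ν : (n : ℕ) → Measure (Fin n → ℝ)} (E : Ensemble c b α κ ν (Pr.map ζ))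
    (hX : X.IsConservative) (hc : X.IsConsistent)
    (hrev : ∀ n, 1 ≤ n → X.IsReversible ((ν n).map iota)) {n : ℕ}
    {T : ((Fin n → ℝ) → ℝ) → Config → ℝ} (hT : ∀ f ∈ symTest n, E.poly f =ᵐ[Pr.map ζ] T f) :
    IsL2Extension (ν n) (Pr.map ζ) T (l2Extension (ν n) (Pr.map ζ) T) ∧
      X.Intertwines Pr ζ (ν n) (l2Extension (ν n) (Pr.map ζ) T) := by
  have h : ∃ J, IsL2Extension (ν n) (Pr.map ζ) T J := by
    obtain ⟨J, hJ⟩ := E.exists_isL2Extension n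
    exact ⟨J, (isL2Extension_congr hT).1 hJ⟩
  have h1 : IsL2Extension (ν n) (Pr.map ζ) T (l2Extension (ν n) (Pr.map ζ) T) := by
    rw [l2Extension, dif_pos h]
    exact h.choose_spec
  exact ⟨h1, E.intertwines X hζ hζm hX hc hrev ((isL2Extension_congr hT).2 h1)⟩

end Intertwining

end

/-! ### The intertwining relations for the Poisson and the Pascal process -/

open MeasureTheory ProbabilityTheory Intertwining
theorem mainTheorem1 {Ω Ω' : Type*} [MeasurableSpace Ω] [MeasurableSpace Ω']
    (X : MarkovFamily Ω) (hproper : ∀ t, IsProper (X.η t))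
    (hcons : X.IsConsistent) (hconserv : X.IsConservative)
    (Pr : Measure Ω') [IsProbabilityMeasure Pr] (ζ : Ω' → Config) (hζ : IsProper ζ) :
    (IsPoissonProcess Pr ζ →
      (∀ n : ℕ, 1 ≤ n →
        X.IsReversible ((volume : Measure (Fin n → ℝ)).map iota)) →
      ∀ n : ℕ,
        IsL2Extension volume (Pr.map ζ) (wienerItoTest n) (wienerIto n (Pr.map ζ)) ∧
        X.Intertwines Pr ζ volume (wienerIto n (Pr.map ζ))) ∧
    (∀ (θ : ℝ≥0) (p : ℝ), 0 < θ → 0 < p → p < 1 →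
      IsPascalProcess p (alpha θ) Pr ζ →
      (∀ n : ℕ, 1 ≤ n →
        X.IsReversible ((lambdaMeasure (alpha θ) n).map iota)) →
      ∀ n : ℕ,
        IsL2Extension (lambdaMeasure (alpha θ) n) (Pr.map ζ) (meixnerTest p (alpha θ) n)
          (meixner p (alpha θ) n (Pr.map ζ)) ∧
        X.Intertwines Pr ζ (lambdaMeasure (alpha θ) n) (meixner p (alpha θ) n (Pr.map ζ))) := by
  constructor
  · intro h hrev n
    have E := ensemble_poisson h
    refine l2Extension_intertwines X hζ h.1 E hconserv hcons hrev fun f hf => ?_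
    refine (E.poly_ae_eq hf).trans (Filter.Eventually.of_forall fun μ => ?_)
    simp only [wienerItoTest, NNReal.coe_one]
  · intro θ p _ hp hp1 h hrev n
    have E := ensemble_pascal hp hp1 h
    refine l2Extension_intertwines X hζ h.1 E hconserv hcons hrev fun f hf => ?_
    refine (E.poly_ae_eq hf).trans (Filter.Eventually.of_forall fun μ => ?_)
    refine Finset.sum_congr rfl fun k hk => ?_
    have hk' : k ≤ n := Nat.lt_succ_iff.1 (Finset.mem_range.1 hk)
    have hq : 1 - p ≠ 0 := by linarith
    congr 2
    -- The inverse of `1 - 1 / p` is `-p / (1 - p) = -b`, so `(1 - 1 / p)^(k - n)` with its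
    -- nonpositive exponent is `(-b)^(n - k)`.
    have h1 : (k : ℤ) - n = -((n - k : ℕ) : ℤ) := by omega
    rw [h1, zpow_neg, zpow_natCast, ← inv_pow]
    congr 1
    change -(p / (1 - p)) = _
    have hp' : 1 - 1 / p = -((1 - p) / p) := by field_simp; ring
    rw [hp', inv_neg, inv_div]
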